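/- **Setting.** Let $F$ be a totally real number field and $\mathcal K/F$ a totally imaginary quadratic extension with $\mathrm{Gal}(\mathcal K/F)=\{1,c\}$. Let $D$ be a central simple $\mathcal K$-algebra of dimension $n^2$ with an $F$-linear anti-involution $\star$ such that $\star|_{\mathcal K}=c$. For a commutative $F$-algebra $R$ put $U(R)=\{x\in (R\otimes_F D)^\times : xx^\star=1\}$, and let $G=\mathrm{Res}_{F/\mathbb Q}U$. Assume that $G(\mathbb R)=U(F\otimes_{\mathbb Q}\mathbb R)$ is compact. Let $p$ be a prime such that every place $v\mid p$ of $F$ splits in $\mathcal K$ and $D$ is split at the places above $v$. For each $v\mid p$ choose a place $\tilde v\mid v$ of $\mathcal K$ and an isomorphism $D_{\tilde v}\simeq M_n(\mathcal K_{\tilde v})$. They give $G(\mathbb Q_p)=\prod_{v\mid p}U(F_v)\simeq\prod_{v\mid p}\mathrm{GL}_n(\mathcal K_{\tilde v})$, and $G(\mathbb Z_p)\subset G(\mathbb Q_p)$ denotes the subgroup corresponding to $\prod_{v\mid p}\mathrm{GL}_n(\mathcal O_{\tilde v})$. Let $L$ be a finite extension of $\mathbb Q_p$ with ring of integers $\mathcal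 O$. Let $K^p=\prod_{v\nmid p}K_v\subset G(\mathbb A_f^p)$ be a decomposable compact open subgroup (a tame level), and let $\tilde H^0(K^p)$ be the $L$-Banach space of continuous functions $Y(K^p)=G(\mathbb Q)\backslash G(\mathbb A_f)/K^p\to L$ with the supremum norm, on which $G(\mathbb Q_p)$ acts by right translation. Let $S$ be a set of places $v\nmid p$ of $F$ (for example the finite set of those at which $K_v$ is not hyperspecial). Let $\mathbb T$ be the closure, for the topology of pointwise convergence, of the image in the continuous $L$-linear endomorphisms of $\tilde H^0(K^p)$ of the $\mathcal O$-valued Hecke algebra of the $K_v$, $v\nmid p$, $v\notin S$; and let $\mathbb T(K^p)$ be its centre. (If $K_v$ is hyperspecial for all $v\notin S$, then $\mathbb T$ is commutative and $\mathbb T(K^p)=\mathbb T$.) For a maximal ideal $\mathfrak m$ of $\mathbb T(K^p)$ let $\tilde H^0(K^p)_{\mathfrak m}=\tilde H^0(K^p)\otimes_{\mathbb T(K^p)}\mathbb T(K^p)_{\mathfrak m}$, with the quotient topology from $\tilde H^0(K^p)$ and the induced action of $G(\mathbb Q_p)$. A vector $f$ in one of these representations is called $G(\mathbb Z_p)$-locally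 algebraic if the $L$-span $\langle G(\mathbb Z_p)f\rangle$ is an algebraic representation of $G(\mathbb Z_p)$, that is, it is finite-dimensional and its matrix coefficients are restrictions to $G(\mathbb Z_p)$ of regular functions on the algebraic group $G_L$. **Proposition.** For every tame level $K^p$ (in particular for every sufficiently small one), the $G(\mathbb Z_p)$-locally algebraic vectors are dense in $\tilde H^0(K^p)$; and for every maximal ideal $\mathfrak m$ of $\mathbb T(K^p)$ the $G(\mathbb Z_p)$-locally algebraic vectors are dense in $\tilde H^0(K^p)_{\mathfrak m}$. -/

import Mathlib

open scoped TensorProduct NumberField RestrictedProduct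
open IsDedekindDomain NumberField

namespace DefiniteUnitary

/-! ### Unitary groups of algebras with an involution of the second kind -/

/-- An `F`-linear anti-involution of the `K`-algebra `D` (where `K / F` is quadratic) which restricts
to the non-trivial `F`-automorphism of `K`. -/
structure InvolutionSecondKind (F K D : Type*) [Field F] [Field K] [Algebra F K] [Ring D]
    [Algebra F D] [Algebra K D] extends D →ₗ[F] D where
  map_mul_rev : ∀ a b : D, toFun (a * b) = toFun b * toFun a
  involutive : ∀ a : D, toFun (toFun a) = a
  second_kind : ∃ c : K ≃ₐ[F] K, c ≠ 1 ∧
    ∀ x : K, toFun (algebraMap K D x) = algebraMap K D (c x)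

section UnitaryGroup

variable {F K D : Type*} [Field F] [Field K] [Algebra F K] [Ring D] [Algebra F D] [Algebra K D]
variable (s : InvolutionSecondKind F K D) (R : Type*) [CommRing R] [Algebra F R]

/-- The `R`-linear extension of the involution to `R ⊗ D`. -/
noncomputable def starBase : R ⊗[F] D →ₗ[R] R ⊗[F] D := s.toLinearMap.baseChange R

theorem starBase_tmul (r : R) (d : D) :
    starBase s R (r ⊗ₜ[F] d) = r ⊗ₜ[F] (s.toLinearMap d) := rfl

theorem starBase_mul (a b : R ⊗[F] D) :
    starBase s R (a * b) = starBase s R b * starBase s R a := by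
  induction a using TensorProduct.induction_on with
  | zero => simp
  | add x y hx hy => simp [add_mul, mul_add, hx, hy]
  | tmul r d =>
    induction b using TensorProduct.induction_on with
    | zero => simp
    | add x y hx hy => simp [add_mul, mul_add, hx, hy]
    | tmul r' d' =>
      simp only [Algebra.TensorProduct.tmul_mul_tmul, starBase_tmul]
      rw [mul_comm r r']
      congr 1
      exact s.map_mul_rev d d'

theorem starBase_starBase (a : R ⊗[F] D) : starBase s R (starBase s R a) = a := by
  induction a using TensorProduct.induction_on with
  | zero => simp
  | add x y hx hy => simp [hx, hy]
  | tmul r d =>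
    simp only [starBase_tmul]
    congr 1
    exact s.involutive d

theorem starBase_one : starBase s R 1 = 1 := by
  have h := starBase_mul s R (starBase s R 1) 1
  rw [mul_one, starBase_starBase, mul_one] at h
  exact h.symm

/-- The `R`-points `U(R) = {x ∈ (R ⊗ D)ˣ : x x⋆ = 1}` of the unitary group of `(D, ⋆)` over `F`. -/
def unitaryGroup : Subgroup (R ⊗[F] D)ˣ where
  carrier := {x | (x : R ⊗[F] D) * starBase s R x = 1}
  one_mem' := by simp [starBase_one]
  mul_mem' {a b} ha hb := by
    simp only [Set.mem_ofPred_eq, Units.val_mul, starBase_mul] at *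
    rw [mul_assoc, ← mul_assoc (b : R ⊗[F] D), hb, one_mul, ha]
  inv_mem' {a} ha := by
    simp only [Set.mem_ofPred_eq] at *
    have h : ((a⁻¹ : (R ⊗[F] D)ˣ) : R ⊗[F] D) = starBase s R a := by
      rw [Units.inv_eq_of_mul_eq_one_right ha]
    rw [h, starBase_starBase, ← h, Units.inv_mul]

/-- `U(R)` as a type. -/
abbrev U : Type _ := ↥(unitaryGroup s R)

/-- For a topological ring `R`, the group `U(R)` carries the topology induced from the free
`R`-module `R ⊗ D`, which has its canonical topology. (Passing to units gives nothing new because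
`x⁻¹ = x⋆` on `U(R)`.) -/
noncomputable instance instTopologicalSpaceU [TopologicalSpace R] : TopologicalSpace (U s R) :=
  TopologicalSpace.induced (fun x : U s R => ((x : (R ⊗[F] D)ˣ) : R ⊗[F] D))
    (moduleTopology R (R ⊗[F] D))

instance instSeparatelyContinuousMulU [TopologicalSpace R] [IsTopologicalRing R] :
    SeparatelyContinuousMul (U s R) := by
  let _ : TopologicalSpace (R ⊗[F] D) := moduleTopology R (R ⊗[F] D)
  have : IsModuleTopology R (R ⊗[F] D) := ⟨rfl⟩
  have : ContinuousAdd (R ⊗[F] D) := IsModuleTopology.toContinuousAdd R _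
  have : ContinuousSMul R (R ⊗[F] D) := IsModuleTopology.toContinuousSMul R _
  constructor
  · intro u
    refine continuous_induced_rng.2 ?_
    exact (IsModuleTopology.continuous_of_linearMap
      (LinearMap.mulLeft R ((u : (R ⊗[F] D)ˣ) : R ⊗[F] D))).comp continuous_induced_dom
  · intro u
    refine continuous_induced_rng.2 ?_
    exact (IsModuleTopology.continuous_of_linearMap
      (LinearMap.mulRight R ((u : (R ⊗[F] D)ˣ) : R ⊗[F] D))).comp continuous_induced_dom

variable {R} {R' : Type*} [CommRing R'] [Algebra F R']

theorem starBase_map (φ : R →ₐ[F] R') (a : R ⊗[F] D) :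
    starBase s R' (Algebra.TensorProduct.map φ (AlgHom.id F D) a) =
      Algebra.TensorProduct.map φ (AlgHom.id F D) (starBase s R a) := by
  induction a using TensorProduct.induction_on with
  | zero => simp
  | add x y hx hy => simp [hx, hy]
  | tmul r d => simp [starBase_tmul]

/-- Functoriality of `R ↦ U(R)`. -/
noncomputable def U.map (φ : R →ₐ[F] R') : U s R →* U s R' :=
  ((Units.map (Algebra.TensorProduct.map φ (AlgHom.id F D) :
    R ⊗[F] D →* R' ⊗[F] D)).comp (unitaryGroup s R).subtype).codRestrict (unitaryGroup s R') (by
      rintro ⟨x, hx⟩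
      have hx' : (x : R ⊗[F] D) * starBase s R x = 1 := hx
      change Algebra.TensorProduct.map φ (AlgHom.id F D) (x : R ⊗[F] D) *
        starBase s R' (Algebra.TensorProduct.map φ (AlgHom.id F D) (x : R ⊗[F] D)) = 1
      rw [starBase_map, ← map_mul, hx', map_one])

end UnitaryGroup

/-! ### Places, adeles and adelic points -/

section Adelic

variable (p : ℕ) (F : Type*) [Field F] [NumberField F]

/-- The finite places of `F` above `p`. -/
abbrev PlaceAbove : Type _ := {v : HeightOneSpectrum (𝓞 F) // (p : 𝓞 F) ∈ v.asIdeal}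

/-- The finite places of `F` not above `p`. -/
abbrev PlaceAway : Type _ := {v : HeightOneSpectrum (𝓞 F) // (p : 𝓞 F) ∉ v.asIdeal}

/-- The ring of finite adeles of `F` away from `p`: the restricted product of the completions `F_v`
with respect to their rings of integers, over the finite places `v` not above `p`. -/
abbrev AdeleAway : Type _ :=
  Πʳ v : PlaceAway p F, [v.1.adicCompletion F, v.1.adicCompletionIntegers F]

/-- The projection from all finite adeles to the adeles away from `p`. -/
noncomputable def toAdeleAway : FiniteAdeleRing (𝓞 F) F →+* AdeleAway p F :=
  RestrictedProduct.mapAlongRingHom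
    (fun v : HeightOneSpectrum (𝓞 F) => v.adicCompletion F)
    (fun v : PlaceAway p F => v.1.adicCompletion F)
    Subtype.val Subtype.val_injective.tendsto_cofinite (fun _ => RingHom.id _)
    (Filter.Eventually.of_forall fun _ _ hx => hx)

/-- The diagonal embedding of `F`. -/
noncomputable instance instAlgebraAdeleAway : Algebra F (AdeleAway p F) :=
  ((toAdeleAway p F).comp (algebraMap F (FiniteAdeleRing (𝓞 F) F))).toAlgebra

/-- The `v`-component of an adele. -/
noncomputable def evalAway (v : PlaceAway p F) : AdeleAway p F →ₐ[F] v.1.adicCompletion F :=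
  { RestrictedProduct.evalRingHom
      (fun v : PlaceAway p F => v.1.adicCompletion F) v with
    commutes' := fun _ => rfl }

variable {F} {K D : Type*} [Field K] [Algebra F K] [Ring D] [Algebra F D] [Algebra K D]
variable (s : InvolutionSecondKind F K D)

/-- `G(ℚ_p) = ∏_{v ∣ p} U(F_v)`, where `G` is the restriction of scalars of `U` to `ℚ`. -/
abbrev Gp : Type _ := (v : PlaceAbove p F) → U s (v.1.adicCompletion F)

instance instSeparatelyContinuousMulGp : SeparatelyContinuousMul (Gp p s) where
  continuous_const_mul := continuous_pi fun v =>
    (continuous_const_mul _).comp (continuous_apply v)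
  continuous_mul_const := continuous_pi fun v =>
    (continuous_mul_const _).comp (continuous_apply v)

/-- `G(𝔸_f^p) = U(𝔸_{F,f}^p)`. -/
abbrev Gaway : Type _ := U s (AdeleAway p F)

/-- `G(𝔸_f) = G(ℚ_p) × G(𝔸_f^p)`. -/
abbrev Gf : Type _ := Gp p s × Gaway p s

/-- The diagonal embedding of `G(ℚ) = U(F)` into `G(𝔸_f)`. -/
noncomputable def diag : U s F →* Gf p s :=
  (MonoidHom.pi fun v => U.map s (Algebra.ofId F (v.1.adicCompletion F))).prod
    (U.map s (Algebra.ofId F (AdeleAway p F)))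

/-- The component at `v` of an element of `G(𝔸_f^p)`. -/
noncomputable def compAway (v : PlaceAway p F) : Gaway p s →* U s (v.1.adicCompletion F) :=
  U.map s (evalAway p F v)

/-- A tame level: a compact open subgroup `K^p` of `G(𝔸_f^p)` which is decomposable,
`K^p = ∏_{v ∤ p} K_v`, with `K_v` a compact open subgroup of `U(F_v)`. (Openness of the product in
the adelic topology forces `K_v` to be hyperspecial for all but finitely many `v`.) -/
structure TameLevel where
  loc : (v : PlaceAway p F) → Subgroup (U s (v.1.adicCompletion F))
  isOpen_loc : ∀ v, IsOpen (loc v : Set (U s (v.1.adicCompletion F)))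
  isCompact_loc : ∀ v, IsCompact (loc v : Set (U s (v.1.adicCompletion F)))
  isOpen_prod : IsOpen {g : Gaway p s | ∀ v, compAway p s v g ∈ loc v}
  isCompact_prod : IsCompact {g : Gaway p s | ∀ v, compAway p s v g ∈ loc v}

variable {p s}

/-- The subgroup `K^p = ∏_{v ∤ p} K_v` of `G(𝔸_f^p)`. -/
def TameLevel.group (T : TameLevel p s) : Subgroup (Gaway p s) where
  carrier := {g | ∀ v, compAway p s v g ∈ T.loc v}
  one_mem' v := by rw [map_one]; exact one_mem _
  mul_mem' ha hb v := by rw [map_mul]; exact mul_mem (ha v) (hb v)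
  inv_mem' ha v := by rw [map_inv]; exact inv_mem (ha v)

end Adelic

/-! ### The maximal compact subgroup `G(ℤ_p)` -/

/-- The homomorphism `A ⊗_F D → B ⊗_K D ≃ M_n(B)` attached to `j : A → B`. -/
noncomputable def baseChangeMatrix {F K D A B : Type*} {n : ℕ} [Field F] [Field K] [Algebra F K]
    [Ring D] [Algebra F D] [Algebra K D] [IsScalarTower F K D] [CommRing A] [Algebra F A]
    [CommRing B] [Algebra F B] [Algebra K B] [IsScalarTower F K B] (j : A →ₐ[F] B)
    (e : B ⊗[K] D ≃ₐ[B] Matrix (Fin n) (Fin n) B) :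
    A ⊗[F] D →ₐ[F] Matrix (Fin n) (Fin n) B :=
  Algebra.TensorProduct.lift
    (((Algebra.ofId B (Matrix (Fin n) (Fin n) B)).restrictScalars F).comp j)
    (((e.toAlgHom.restrictScalars K).comp
      (Algebra.TensorProduct.includeRight : D →ₐ[K] B ⊗[K] D)).restrictScalars F)
    (fun x _ => Algebra.commutes (j x) _)

section AtP

variable {p n : ℕ} {F K D : Type*} [Field F] [NumberField F] [Field K] [NumberField K]
  [Algebra F K] [Ring D] [Algebra F D] [Algebra K D] [IsScalarTower F K D]

/-- A place `v` of `F` splits in `K` and `D` splits above it; the structure records the choice of a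
place `w` (usually written `ṽ`) of `K` above `v` and of an isomorphism `D_w ≃ M_n(K_w)`. -/
structure SplitPlace (n : ℕ) (K D : Type*) [Field K] [NumberField K] [Algebra F K] [Ring D]
    [Algebra F D] [Algebra K D] [IsScalarTower F K D] (v : HeightOneSpectrum (𝓞 F)) where
  w : HeightOneSpectrum (𝓞 K)
  liesOver : w.asIdeal.comap (algebraMap (𝓞 F) (𝓞 K)) = v.asIdeal
  /-- `w` is not the only place above `v`; since `K / F` is quadratic, `v` splits. -/
  split : ∃ w' : HeightOneSpectrum (𝓞 K),
    w'.asIdeal.comap (algebraMap (𝓞 F) (𝓞 K)) = v.asIdeal ∧ w' ≠ w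
  /-- The canonical embedding `F_v → K_w`, that is, the unique continuous homomorphism extending
  `F → K`. -/
  emb : v.adicCompletion F →ₐ[F] w.adicCompletion K
  continuous_emb : Continuous emb
  iso : w.adicCompletion K ⊗[K] D ≃ₐ[w.adicCompletion K] Matrix (Fin n) (Fin n) (w.adicCompletion K)

variable {v : HeightOneSpectrum (𝓞 F)}

/-- The homomorphism `F_v ⊗_F D → K_w ⊗_K D ≃ M_n(K_w)`. -/
noncomputable def SplitPlace.toMatrix (e : SplitPlace n K D v) :
    v.adicCompletion F ⊗[F] D →ₐ[F] Matrix (Fin n) (Fin n) (e.w.adicCompletion K) :=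
  baseChangeMatrix e.emb e.iso

variable (s : InvolutionSecondKind F K D)

/-- `GL_n(𝒪_w)` inside `U(F_v) ≃ GL_n(K_w)`: the elements `g` such that the matrices of `g` and
`g⁻¹` have integral entries. -/
noncomputable def SplitPlace.integralPoints (e : SplitPlace n K D v) :
    Subgroup (U s (v.adicCompletion F)) where
  carrier := {g |
    (∀ i j, e.toMatrix ((g : (v.adicCompletion F ⊗[F] D)ˣ) : v.adicCompletion F ⊗[F] D) i j ∈
      e.w.adicCompletionIntegers K) ∧
    (∀ i j, e.toMatrix ((g⁻¹ : (v.adicCompletion F ⊗[F] D)ˣ) : v.adicCompletion F ⊗[F] D) i j ∈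
      e.w.adicCompletionIntegers K)}
  one_mem' := by
    have h : ∀ i j, (1 : Matrix (Fin n) (Fin n) (e.w.adicCompletion K)) i j ∈
        e.w.adicCompletionIntegers K := by
      intro i j
      by_cases hij : i = j
      · subst hij; simp [one_mem]
      · simp [Matrix.one_apply_ne hij, zero_mem]
    constructor <;> intro i j <;> simpa using h i j
  mul_mem' {a b} ha hb := by
    constructor
    · intro i j
      simp only [Subgroup.coe_mul, Units.val_mul, map_mul, Matrix.mul_apply]
      exact sum_mem fun k _ => mul_mem (ha.1 i k) (hb.1 k j)
    · intro i j
      simp only [Subgroup.coe_mul, mul_inv_rev, Units.val_mul, map_mul, Matrix.mul_apply]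
      exact sum_mem fun k _ => mul_mem (hb.2 i k) (ha.2 k j)
  inv_mem' {a} ha := by
    refine ⟨ha.2, ?_⟩
    simpa using ha.1

/-- `G(ℤ_p) = ∏_{v ∣ p} GL_n(𝒪_ṽ)` inside `G(ℚ_p)`. -/
noncomputable def GZp (e : (v : PlaceAbove p F) → SplitPlace n K D v.1) : Subgroup (Gp p s) :=
  Subgroup.pi Set.univ fun v => (e v).integralPoints s

end AtP

/-! ### Completed cohomology in degree zero

In this section `P`, `A`, `Q` stand for `G(ℚ_p)`, `G(𝔸_f^p)`, `G(ℚ)`, the homomorphism `ι` is the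
diagonal embedding `G(ℚ) → G(𝔸_f) = G(ℚ_p) × G(𝔸_f^p)`, and `N` is the tame level `K^p`. -/

section Completed

variable {P A Q : Type*} [Group P] [Group A] [Group Q] [TopologicalSpace P] [TopologicalSpace A]
variable (ι : Q →* P × A) (N : Subgroup A) (L : Type*) [NormedField L]

/-- The bounded continuous functions `f : P × A → L` with `f (γ x u) = f x` for `γ ∈ Q` and
`u ∈ N`. -/
def invariantFunctions : Submodule L (BoundedContinuousFunction (P × A) L) where
  carrier := {f | ∀ (γ : Q) (x : P × A), ∀ u ∈ N, f (ι γ * x * (1, u)) = f x}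
  add_mem' hf hg γ x u hu := by
    simp only [BoundedContinuousFunction.coe_add, Pi.add_apply, hf γ x u hu, hg γ x u hu]
  zero_mem' γ x u hu := rfl
  smul_mem' c f hf γ x u hu := by
    simp only [BoundedContinuousFunction.coe_smul, hf γ x u hu]

/-- `H̃⁰(K^p)`: continuous `L`-valued functions on `Y(K^p) = G(ℚ) \ G(𝔸_f) / K^p`, with the supremum
norm. They are viewed as functions on `G(𝔸_f)`; since `Y(K^p)` is compact, boundedness is
automatic and only serves to have the supremum norm available. -/
def H0 : Type _ := ↥(invariantFunctions ι N L)

noncomputable instance : NormedAddCommGroup (H0 ι N L) :=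
  inferInstanceAs (NormedAddCommGroup ↥(invariantFunctions ι N L))

noncomputable instance : NormedSpace L (H0 ι N L) :=
  inferInstanceAs (NormedSpace L ↥(invariantFunctions ι N L))

variable {ι N L}

/-- The underlying function on `G(𝔸_f)`. -/
def H0.toFun (f : H0 ι N L) : P × A → L := f.1

theorem H0.ext {f g : H0 ι N L} (h : ∀ x, f.toFun x = g.toFun x) : f = g :=
  Subtype.ext (BoundedContinuousFunction.ext h)

section Translate

variable [SeparatelyContinuousMul P]

theorem continuous_translate (k : P) : Continuous fun x : P × A => x * (k, 1) := by
  have h : (fun x : P × A => x * (k, 1)) = fun x => (x.1 * k, x.2) := by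
    funext x
    exact Prod.ext rfl (mul_one _)
  rw [h]
  exact ((continuous_mul_const k).comp continuous_fst).prodMk continuous_snd

/-- Right translation by `k ∈ G(ℚ_p)`, `(k f)(x) = f (x k)`. -/
noncomputable def translate (k : P) : H0 ι N L →L[L] H0 ι N L :=
  LinearMap.mkContinuous
    { toFun := fun f => ⟨f.1.compContinuous ⟨fun x => x * (k, 1), continuous_translate k⟩, by
        intro γ x u hu
        have h : ι γ * x * (1, u) * (k, 1) = ι γ * (x * (k, 1)) * (1, u) := by
          simp [mul_assoc]
        change f.1 (ι γ * x * (1, u) * (k, 1)) = f.1 (x * (k, 1))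
        rw [h]
        exact f.2 γ _ u hu⟩
      map_add' := fun _ _ => rfl
      map_smul' := fun _ _ => rfl }
    1 (fun f => (BoundedContinuousFunction.norm_compContinuous_le f.1 _).trans (one_mul _).ge)

theorem translate_apply (k : P) (f : H0 ι N L) (x : P × A) :
    (translate k f).toFun x = f.toFun (x * (k, 1)) := rfl

theorem translate_one (f : H0 ι N L) : translate (1 : P) f = f := by
  refine H0.ext fun x => ?_
  rw [translate_apply, ← Prod.one_eq_mk, mul_one]

theorem translate_mul (k k' : P) (f : H0 ι N L) :
    translate (k * k') f = translate k (translate k' f) := by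
  refine H0.ext fun x => ?_
  rw [translate_apply, translate_apply, translate_apply]
  congr 1
  ext1 <;> simp [mul_assoc]

variable (ι N L) in
/-- The action of `G(ℚ_p)` on `H̃⁰(K^p)` by right translation. -/
noncomputable def rightRegular : Representation L P (H0 ι N L) where
  toFun k := (translate k : H0 ι N L →L[L] H0 ι N L).toLinearMap
  map_one' := LinearMap.ext translate_one
  map_mul' k k' := LinearMap.ext (translate_mul k k')

end Translate

/-! ### Hecke operators away from `p` -/

/-- The cosets in `K^p g K^p / K^p`. -/
def doubleCoset (N : Subgroup A) (g : A) : Set (A ⧸ N) :=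
  {c | ∃ u ∈ N, c = QuotientGroup.mk (u * g)}

/-- `φ` is the Hecke operator `[K^p g K^p]`, given by `(φ f)(x) = ∑ f (x h)`, where `h` runs through
representatives of the (finitely many) cosets in `K^p g K^p / K^p`. -/
def IsHeckeOperator (g : A) (φ : H0 ι N L →L[L] H0 ι N L) : Prop :=
  ∀ (f : H0 ι N L) (x : P × A),
    (φ f).toFun x = ∑ᶠ c : doubleCoset N g, f.toFun (x * (1, c.1.out))

variable (ι N L) in
/-- The subring of `End H̃⁰(K^p)` generated by the scalars in the valuation ring
`𝒪 = {‖a‖ ≤ 1}` of `L` and by the operators `[K^p g K^p]` with `g ∈ X`. -/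
noncomputable def heckeImage (X : Set A) : Subring (H0 ι N L →L[L] H0 ι N L) :=
  Subring.closure
    ({φ | ∃ g ∈ X, IsHeckeOperator g φ} ∪
      {φ | ∃ a : L, ‖a‖ ≤ 1 ∧ φ = a • ContinuousLinearMap.id L (H0 ι N L)})

theorem heckeImage_comm [SeparatelyContinuousMul P] (X : Set A) (k : P)
    {φ : H0 ι N L →L[L] H0 ι N L} (hφ : φ ∈ heckeImage ι N L X) (f : H0 ι N L) :
    φ (translate k f) = translate k (φ f) := by
  induction hφ using Subring.closure_induction generalizing f with
  | mem φ hφ =>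
    rcases hφ with ⟨g, -, hg⟩ | ⟨a, -, rfl⟩
    · refine H0.ext fun x => ?_
      rw [hg, translate_apply, hg]
      refine finsum_congr fun c => ?_
      rw [translate_apply]
      congr 1
      ext1 <;> simp
    · simp
  | zero => simp
  | one => rfl
  | add φ ψ _ _ hφ hψ => simp [hφ, hψ]
  | neg φ _ hφ => simp [hφ]
  | mul φ ψ _ _ hφ hψ => simp [hφ, hψ]

section PointwiseClosure

variable {H : Type*} [NormedAddCommGroup H] [NormedSpace L H]

/-- The closure of a subring of continuous endomorphisms for the topology of pointwise
convergence. -/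
noncomputable def pointwiseClosure (B : Subring (H →L[L] H)) : Subring (H →L[L] H) where
  carrier := {φ | (φ : H → H) ∈ closure ((fun ψ : H →L[L] H => (ψ : H → H)) '' B)}
  one_mem' := subset_closure ⟨1, one_mem _, rfl⟩
  zero_mem' := subset_closure ⟨0, zero_mem _, rfl⟩
  add_mem' {φ ψ} hφ hψ :=
    map_mem_closure₂ (f := fun a b : H → H => a + b) continuous_add hφ hψ (by
      rintro _ ⟨a, ha, rfl⟩ _ ⟨b, hb, rfl⟩
      exact ⟨a + b, add_mem ha hb, rfl⟩)
  neg_mem' {φ} hφ :=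
    map_mem_closure (f := fun a : H → H => -a) continuous_neg hφ (by
      rintro _ ⟨a, ha, rfl⟩
      exact ⟨-a, neg_mem ha, rfl⟩)
  mul_mem' {φ ψ} hφ hψ := by
    refine closure_minimal subset_rfl isClosed_closure (map_mem_closure
      (f := fun a : H → H => a ∘ ψ)
      (t := closure ((fun ψ : H →L[L] H => (ψ : H → H)) '' B))
      (continuous_pi fun x => continuous_apply (ψ x)) hφ ?_)
    rintro _ ⟨a, ha, rfl⟩
    refine map_mem_closure (f := fun b : H → H => a ∘ b)
      (continuous_pi fun x => a.continuous.comp (continuous_apply x)) hψ ?_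
    rintro _ ⟨b, hb, rfl⟩
    exact ⟨a * b, mul_mem ha hb, rfl⟩

theorem pointwiseClosure_comm (B : Subring (H →L[L] H)) (τ : H →L[L] H)
    (hB : ∀ φ ∈ B, ∀ f, φ (τ f) = τ (φ f)) {φ : H →L[L] H} (hφ : φ ∈ pointwiseClosure B) (f : H) :
    φ (τ f) = τ (φ f) := by
  have hcl : IsClosed {a : H → H | a (τ f) = τ (a f)} :=
    isClosed_eq (continuous_apply _) (τ.continuous.comp (continuous_apply f))
  refine closure_minimal ?_ hcl hφ
  rintro _ ⟨a, ha, rfl⟩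
  exact hB a ha f

/-- The centre of a ring of endomorphisms, as a type. -/
noncomputable def CenterRing (B : Subring (H →L[L] H)) : Type _ := ↥(Subring.center B)

variable (B : Subring (H →L[L] H))

noncomputable instance : CommRing (CenterRing B) := inferInstanceAs (CommRing (Subring.center B))

noncomputable instance : Module (CenterRing B) H := inferInstanceAs (Module (Subring.center B) H)

instance : SMulCommClass (CenterRing B) L H where
  smul_comm z a f := (z.1.1 : H →L[L] H).map_smul a f

/-! ### Localization at a maximal ideal of the Hecke algebra -/

variable {B} (m : Ideal (CenterRing B)) [m.IsPrime]

/-- The localization `H_𝔪 = H ⊗_𝕋 𝕋_𝔪` of a module `H`, where `𝕋` is the centre of `B`. -/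
noncomputable def LocModule : Type _ := H ⊗[CenterRing B] Localization.AtPrime m

noncomputable instance : AddCommGroup (LocModule m) :=
  inferInstanceAs (AddCommGroup (H ⊗[CenterRing B] Localization.AtPrime m))

noncomputable instance : Module L (LocModule m) :=
  inferInstanceAs (Module L (H ⊗[CenterRing B] Localization.AtPrime m))

/-- The canonical map `H → H_𝔪`. -/
noncomputable def toLocModule (f : H) : LocModule m :=
  (f ⊗ₜ[CenterRing B] (1 : Localization.AtPrime m) : H ⊗[CenterRing B] Localization.AtPrime m)

/-- `H_𝔪` carries the quotient topology from `H`. -/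
noncomputable instance : TopologicalSpace (LocModule m) :=
  TopologicalSpace.coinduced (toLocModule m) inferInstance

/-- The endomorphism of `H_𝔪` induced by an endomorphism of `H` that commutes with `B`. -/
noncomputable def locMap (τ : H →ₗ[L] H) (hτ : ∀ φ ∈ B, ∀ f, φ (τ f) = τ (φ f)) :
    LocModule m →ₗ[L] LocModule m :=
  let t : H →ₗ[CenterRing B] H :=
    { toFun := τ
      map_add' := map_add τ
      map_smul' := fun z f => (hτ z.1.1 z.1.2 f).symm }
  { toFun := LinearMap.rTensor (Localization.AtPrime m) t
    map_add' := map_add (LinearMap.rTensor (Localization.AtPrime m) t)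
    map_smul' := fun a x => by
      change LinearMap.rTensor (Localization.AtPrime m) t
        (a • (show H ⊗[CenterRing B] Localization.AtPrime m from x)) =
        a • LinearMap.rTensor (Localization.AtPrime m) t x
      induction x using TensorProduct.induction_on with
      | zero => simp
      | tmul f y =>
        rw [TensorProduct.smul_tmul', LinearMap.rTensor_tmul, LinearMap.rTensor_tmul,
          TensorProduct.smul_tmul']
        congr 1
        exact map_smul τ a f
      | add x y hx hy => rw [smul_add, map_add, hx, hy, map_add, smul_add] }

/-- The representation on `H_𝔪` induced by a representation on `H` that commutes with `B`. -/
noncomputable def locRep {Γ : Type*} [Group Γ] (ρ : Representation L Γ H)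
    (hρ : ∀ g, ∀ φ ∈ B, ∀ f, φ (ρ g f) = ρ g (φ f)) : Representation L Γ (LocModule m) where
  toFun g := locMap m (ρ g) (hρ g)
  map_one' := by
    refine LinearMap.ext fun x => ?_
    change H ⊗[CenterRing B] Localization.AtPrime m at x
    induction x using TensorProduct.induction_on with
    | zero => exact map_zero _
    | tmul f y =>
      change (ρ 1 f) ⊗ₜ[CenterRing B] y = f ⊗ₜ[CenterRing B] y
      rw [map_one]
      rfl
    | add x y hx hy => exact (map_add _ _ _).trans (congrArg₂ _ hx hy)
  map_mul' g h := by
    refine LinearMap.ext fun x => ?_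
    change H ⊗[CenterRing B] Localization.AtPrime m at x
    induction x using TensorProduct.induction_on with
    | zero => exact (map_zero _).trans (map_zero _).symm
    | tmul f y =>
      change (ρ (g * h) f) ⊗ₜ[CenterRing B] y = (ρ g (ρ h f)) ⊗ₜ[CenterRing B] y
      rw [map_mul]
      rfl
    | add x y hx hy =>
      exact (map_add _ _ _).trans ((congrArg₂ _ hx hy).trans (map_add _ _ _).symm)

end PointwiseClosure

end Completed

/-! ### Algebraic vectors -/

section Algebraic

variable {Γ L V : Type*} [Group Γ] [Field L] [AddCommGroup V] [Module L V]

/-- Let `A` be an algebra of functions on `Γ`. A representation of `Γ` is algebraic with respect to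
`A` if it is finite-dimensional and its matrix coefficients lie in `A`. -/
def IsAlgebraicRep (A : Subalgebra L (Γ → L)) (ρ : Representation L Γ V) : Prop :=
  FiniteDimensional L V ∧ ∀ (w : V) (l : Module.Dual L V), (fun g => l (ρ g w)) ∈ A

/-- The subrepresentation `⟨Γ x⟩` generated by a vector `x`. -/
def cyclicSubrep (ρ : Representation L Γ V) (x : V) : Subrepresentation ρ where
  toSubmodule := Submodule.span L (Set.range fun g => ρ g x)
  apply_mem_toSubmodule g v hv := by
    induction hv using Submodule.span_induction with
    | mem y hy =>
      obtain ⟨h, rfl⟩ := hy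
      exact Submodule.subset_span ⟨g * h, by simp⟩
    | zero => simp
    | add y z _ _ hy hz => rw [map_add]; exact add_mem hy hz
    | smul a y _ hy => rw [map_smul]; exact Submodule.smul_mem _ a hy

/-- `x` is an algebraic vector if the representation `⟨Γ x⟩` is algebraic. -/
def IsAlgebraicVector (A : Subalgebra L (Γ → L)) (ρ : Representation L Γ V) (x : V) : Prop :=
  IsAlgebraicRep A (cyclicSubrep ρ x).toRepresentation

end Algebraic

section Regular

variable {p n : ℕ} {F K D : Type*} [Field F] [NumberField F] [Field K] [NumberField K]
  [Algebra F K] [Ring D] [Algebra F D] [Algebra K D] [IsScalarTower F K D]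
  {s : InvolutionSecondKind F K D}

/-- The functions on `G(ℤ_p)` that are restrictions of regular functions on the algebraic group
`G_L`. A continuous additive map `F_v ⊗ D → L` is the same as a `ℚ_p`-linear one, and since
`G` is a closed subgroup of the affine space of `D ⊗ ℚ_p = ∏_{v ∣ p} F_v ⊗ D` (on `G` the inverse is
the linear map `x ↦ x⋆`), its ring of regular functions over `L` is generated by these coordinate
functions. -/
def regularFunctions (L : Type*) [NormedField L]
    (e : (v : PlaceAbove p F) → SplitPlace n K D v.1) : Subalgebra L (GZp s e → L) :=
  Algebra.adjoin L {a | ∃ (v : PlaceAbove p F) (l : v.1.adicCompletion F ⊗[F] D →+ L),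
    (@Continuous _ _ (moduleTopology (v.1.adicCompletion F) (v.1.adicCompletion F ⊗[F] D)) _ l) ∧
    a = fun g => l ((g.1 v : (v.1.adicCompletion F ⊗[F] D)ˣ) : v.1.adicCompletion F ⊗[F] D)}

end Regular

/-! ### The objects attached to a tame level -/

section Level

variable {p n : ℕ} {F K D : Type*} [Field F] [NumberField F] [Field K] [NumberField K]
  [Algebra F K] [Ring D] [Algebra F D] [Algebra K D] [IsScalarTower F K D]
  {s : InvolutionSecondKind F K D}
variable (T : TameLevel p s) (L : Type*) [NormedField L] (S : Set (PlaceAway p F))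
  (e : (v : PlaceAbove p F) → SplitPlace n K D v.1)

/-- `H̃⁰(K^p)` with coefficients in `L`. -/
abbrev CompletedH0 : Type _ := H0 (diag p s) T.group L

/-- The elements of `G(𝔸_f^p)` whose components at the places in `S` lie in `K^p`. -/
def outside : Set (Gaway p s) := {g | ∀ v ∈ S, compAway p s v g ∈ T.loc v}

/-- The algebra `𝕋(K^p)`: the closure in `End H̃⁰(K^p)` of the image of the `𝒪`-valued Hecke algebra
`⊗_{v ∉ S} ℋ_𝒪(K_v)` at the places `v ∤ p` outside `S`. (The operators `[K^p g K^p]`, with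
`g ∈ K^p ∏_{v ∉ S} U(F_v)`, come from an `𝒪`-basis of that Hecke algebra.) -/
noncomputable def heckeAlgebra : Subring (CompletedH0 T L →L[L] CompletedH0 T L) :=
  pointwiseClosure (heckeImage (diag p s) T.group L (outside T S))

/-- `𝕋(K^p)` as a commutative ring. When `K_v` is hyperspecial for all `v ∉ S`, the Hecke algebras
`ℋ_𝒪(K_v)`, `v ∉ S`, are commutative, so `heckeAlgebra` is commutative and is equal to its centre.
Taking the centre merely provides the commutative ring structure, for any `S`. -/
abbrev TameHeckeRing : Type _ := CenterRing (heckeAlgebra T L S)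

/-- The action of `G(ℤ_p)` on `H̃⁰(K^p)` by right translation. -/
noncomputable def actionGZp : Representation L (GZp s e) (CompletedH0 T L) :=
  (rightRegular (diag p s) T.group L).comp (GZp s e).subtype

variable {T L S} in
/-- The localization `H̃⁰(K^p)_𝔪`. -/
abbrev CompletedH0Loc (m : Ideal (TameHeckeRing T L S)) [m.IsPrime] : Type _ := LocModule m

variable {T L S} in
/-- The action of `G(ℤ_p)` on `H̃⁰(K^p)_𝔪`. -/
noncomputable def actionGZpLoc (m : Ideal (TameHeckeRing T L S)) [m.IsPrime] :
    Representation L (GZp s e) (CompletedH0Loc m) :=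
  locRep m (actionGZp T L e) fun g _ hφ f =>
    pointwiseClosure_comm _ (translate g.1)
      (fun _ hψ => heckeImage_comm (outside T S) g.1 hψ) hφ f

end Level

end DefiniteUnitary

open DefiniteUnitary

namespace DefiniteUnitary

open Filter Topology

/-! ### Rings of contractions and localization -/

section Contractions

variable {L H : Type*} [NormedField L] [NormedAddCommGroup H] [NormedSpace L H]

/-! Write P = G(ℚ_p), A = G(𝔸_f^p), H = G(ℤ_p), N = K^p.

Reduction to C(H, L). Definiteness makes the double coset space G(ℚ)\(P × A)/(H × N) finite and each
group Γ_x = G(ℚ) ∩ x(H × N)x⁻¹ finite. For a point x and b ∈ C(H, L), extend b by zero from H × N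
and put θ_x(b)(g) = ∑_γ b(x⁻¹γg). This is a finite sum, and θ_x is a contraction C(H, L) → H̃⁰ that
respects right translation by H. Applied to the restriction of f to xH it returns |Γ_x|·f on the
double coset of x and 0 elsewhere. Since L has characteristic zero, f = ∑_x |Γ_x|⁻¹ θ_x(f|xH)
(`exists_sum_theta`). Thus H̃⁰ is a continuous equivariant quotient of a finite power of C(H, L) at
every tame level, and it suffices that regular functions are dense in C(H, L)
(`dense_isAlgebraicVector`). This is a p-adic Stone–Weierstrass theorem: regular ℚ_p-valued
coordinates separate points, and by Mahler's theorem the closure of the algebra contains every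
continuous function of a ℤ_p-valued member, hence enough idempotents.

Finiteness. Compactness at infinity makes the form x⋆y on D anisotropic: otherwise suitable
unipotents 1 + nN would form an unbounded sequence in U(F). An element γ of G(𝔸_f) gives a lattice
Λ_γ in D on which x⋆y has uniformly bounded denominators, so nonzero vectors cannot be too short
(`exists_gap`). Moreover Λ_γ is self-dual for a trace form up to a uniform constant, so a pigeonhole
argument gives R^N vectors of size O(R), while the gap permits only O(R^(N-1)) in a hyperplane.
Hence vectors of bounded size span D (`exists_span_bounded_eq_top`). Their Gram matrices take
finitely many values, and equal Gram matrices differ by an element of U(F)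
(`exists_finite_classes`). The Γ_x are finite because elements of U(F) with bounded denominators are
also bounded at infinity.

Localization. It suffices that H̃⁰ → H̃⁰_𝔪 is surjective. Hecke operators are contractions commuting
with the compact group H, so orbits f, xf, x²f, … are recurrent (`exists_pow_close`). Then x^(n!)
converges pointwise to an idempotent e of 𝕋; x is invertible on e and topologically nilpotent on 1 -
e. For t ∉ 𝔪 choose a with at ≡ 1 modulo 𝔪 and take x = at: then e ∉ 𝔪, and t can be divided out
after multiplication by e (`toLocModule_surjective`). -/

theorem CenterRing.ext_smul {B : Subring (H →L[L] H)} {z w : CenterRing B}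
    (h : ∀ f : H, z • f = w • f) : z = w :=
  Subtype.ext (Subtype.ext (ContinuousLinearMap.ext h))

theorem CenterRing.continuous_smul {B : Subring (H →L[L] H)} (z : CenterRing B) :
    Continuous fun f : H => z • f := z.1.1.continuous

variable [CompleteSpace H]

/-- A pointwise limit of linear contractions is again a linear contraction, so it is continuous, and
pointwise closures contain their pointwise limits. -/
theorem exists_mem_pointwiseClosure_of_cauchySeq (B : Subring (H →L[L] H))
    (hB : ∀ φ ∈ pointwiseClosure B, ∀ f, ‖φ f‖ ≤ ‖f‖) (φ : ℕ → H →L[L] H)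
    (hφ : ∀ n, φ n ∈ pointwiseClosure B) (hc : ∀ f, CauchySeq fun n => φ n f) :
    ∃ ψ ∈ pointwiseClosure B, ∀ f, Tendsto (fun n => φ n f) atTop (𝓝 (ψ f)) := by
  choose g hg using fun f => cauchySeq_tendsto_of_complete (hc f)
  have hlim : Tendsto (fun n => (φ n : H → H)) atTop (𝓝 g) := tendsto_pi_nhds.2 hg
  let l : H →ₗ[L] H := linearMapOfTendsto g (fun n => (φ n : H →ₗ[L] H)) hlim
  have hl : ∀ f, ‖l f‖ ≤ 1 * ‖f‖ := fun f => by
    rw [one_mul]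
    exact le_of_tendsto (hg f).norm (Eventually.of_forall fun n => hB _ (hφ n) f)
  refine ⟨l.mkContinuous 1 hl, ?_, hg⟩
  change g ∈ closure _
  exact isClosed_closure.mem_of_tendsto hlim (Eventually.of_forall fun n => hφ n)

/-- Commutation with a fixed continuous operator survives pointwise limits, so limits of central
elements stay central. -/
theorem CenterRing.exists_tendsto (B : Subring (H →L[L] H))
    (hB : ∀ φ ∈ pointwiseClosure B, ∀ f, ‖φ f‖ ≤ ‖f‖) (z : ℕ → CenterRing (pointwiseClosure B))
    (hc : ∀ f : H, CauchySeq fun n => z n • f) :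
    ∃ w : CenterRing (pointwiseClosure B), ∀ f : H, Tendsto (fun n => z n • f) atTop (𝓝 (w • f)) := by
  obtain ⟨ψ, hψ, hlim⟩ := exists_mem_pointwiseClosure_of_cauchySeq B hB (fun n => (z n).1.1)
    (fun n => (z n).1.2) hc
  refine ⟨⟨⟨ψ, hψ⟩, Subring.mem_center_iff.2 fun b => Subtype.ext (ContinuousLinearMap.ext
    fun f => ?_)⟩, hlim⟩
  refine tendsto_nhds_unique ((b.1.continuous.tendsto _).comp (hlim f)) ?_
  refine (hlim (b.1 f)).congr fun n => ?_
  have h := Subring.mem_center_iff.1 (z n).2 b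
  exact (DFunLike.congr_fun (congrArg Subtype.val h) f).symm

/-- A single near-return of the orbit propagates: applying the contraction, j - i becomes an
ε-period of the orbit from i on, and the ultrametric inequality prevents errors from accumulating.
Factorials are eventually congruent modulo any period. The shift r = 1 will produce an inverse. -/
theorem cauchySeq_pow_factorial {E : Type*} [NormedAddCommGroup E] [IsUltrametricDist E]
    {t : E → E} (ht : ∀ f g, ‖t f - t g‖ ≤ ‖f - g‖) {f : E}
    (hrec : ∀ ε > 0, ∃ i j, i < j ∧ ‖t^[i] f - t^[j] f‖ ≤ ε) (r : ℕ) :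
    (∀ ε > 0, ∃ d > 0, ∃ i, ∀ n ≥ i, ∀ k, ‖t^[n + d * k] f - t^[n] f‖ ≤ ε) ∧
    CauchySeq fun n : ℕ => t^[n.factorial - r] f := by
  have hit : ∀ k f g, ‖t^[k] f - t^[k] g‖ ≤ ‖f - g‖ := fun k => by
    induction k with
    | zero => simp
    | succ k ih =>
      intro f g
      rw [Function.iterate_succ_apply', Function.iterate_succ_apply']
      exact (ht _ _).trans (ih f g)
  have hper : ∀ ε > 0, ∃ d > 0, ∃ i, ∀ n ≥ i, ∀ k, ‖t^[n + d * k] f - t^[n] f‖ ≤ ε := by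
    intro ε hε
    obtain ⟨i, j, hij, h⟩ := hrec ε hε
    have hstep : ∀ n ≥ i, ‖t^[n + (j - i)] f - t^[n] f‖ ≤ ε := by
      intro n hn
      have h1 := hit (n - i) (t^[j] f) (t^[i] f)
      rw [← Function.iterate_add_apply, ← Function.iterate_add_apply] at h1
      rw [norm_sub_rev] at h
      refine le_trans ?_ (h1.trans h)
      rw [show n + (j - i) = n - i + j by omega, show n - i + i = n by omega]
    refine ⟨j - i, by omega, i, fun n hn k => ?_⟩
    induction k with
    | zero => simp [hε.le]
    | succ k ih =>
      rw [← sub_add_sub_cancel _ (t^[n + (j - i) * k] f)]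
      refine (IsUltrametricDist.norm_add_le_max _ _).trans (max_le ?_ ih)
      rw [mul_add, mul_one, ← add_assoc]
      exact hstep _ (by omega)
  refine ⟨hper, Metric.cauchySeq_iff'.2 fun ε hε => ?_⟩
  obtain ⟨d, hd, i, h⟩ := hper (ε / 2) (half_pos hε)
  -- From here on both factorials are divisible by d, and the exponent is still at least i after r
  -- has been subtracted.
  refine ⟨i + d + r, fun n hn => ?_⟩
  obtain ⟨q, hq⟩ : d ∣ n.factorial - (i + d + r).factorial :=
    Nat.dvd_sub (Nat.dvd_factorial hd (by omega)) (Nat.dvd_factorial hd (by omega))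
  have h1 := Nat.self_le_factorial (i + d + r)
  have h2 := Nat.factorial_le hn
  rw [dist_eq_norm, show n.factorial - r = (i + d + r).factorial - r + d * q by omega]
  exact (h _ (by omega) q).trans_lt (half_lt_self hε)

variable [IsUltrametricDist H]

/-- A Fitting decomposition: e = lim x^(n!) cuts out the part where x is invertible, with inverse u
= lim x^(n!-1). On the complement the powers of x tend to 0, so 1 - x is inverted there by the
geometric series w = ∑ x^k (1 - e). -/
theorem CenterRing.exists_idempotent (B : Subring (H →L[L] H))
    (hB : ∀ φ ∈ pointwiseClosure B, ∀ f, ‖φ f‖ ≤ ‖f‖) (x : CenterRing (pointwiseClosure B))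
    (hrec : ∀ (f : H), ∀ ε > 0, ∃ i j : ℕ, i < j ∧ ‖x ^ i • f - x ^ j • f‖ ≤ ε) :
    ∃ e u w : CenterRing (pointwiseClosure B), x * u = e ∧ e * e = e ∧ e + (1 - x) * w = 1 := by
  have hcon : ∀ (z : CenterRing (pointwiseClosure B)) (f : H), ‖z • f‖ ≤ ‖f‖ :=
    fun z f => hB _ z.1.2 f
  have ht : ∀ f g : H, ‖x • f - x • g‖ ≤ ‖f - g‖ := fun f g => by
    rw [← smul_sub]; exact hcon _ _
  have hpow : ∀ (n : ℕ) (f : H), (fun f : H => x • f)^[n] f = x ^ n • f := fun n f => by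
    rw [smul_iterate]
  have key := fun (f : H) (r : ℕ) => cauchySeq_pow_factorial ht (f := f)
    (by simpa only [hpow] using hrec f) r
  simp only [hpow] at key
  obtain ⟨e, he⟩ := CenterRing.exists_tendsto B hB (fun n => x ^ (n.factorial - 0))
    (fun f => (key f 0).2)
  obtain ⟨u, hu⟩ := CenterRing.exists_tendsto B hB (fun n => x ^ (n.factorial - 1))
    (fun f => (key f 1).2)
  simp only [Nat.sub_zero] at he
  have hxu : x * u = e := by
    refine CenterRing.ext_smul fun f => ?_
    refine tendsto_nhds_unique ?_ (he f)
    rw [mul_smul]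
    refine (((CenterRing.continuous_smul x).tendsto _).comp (hu f)).congr fun n => ?_
    have h := Nat.factorial_pos n
    rw [Function.comp_apply, ← mul_smul, ← pow_succ', Nat.sub_add_cancel h]
  have hee : e * e = e := by
    refine CenterRing.ext_smul fun f => ?_
    rw [mul_smul]
    refine tendsto_nhds_unique (he (e • f)) ?_
    refine Metric.tendsto_atTop.2 fun ε hε => ?_
    obtain ⟨d, hd, i, h⟩ := (key f 0).1 (ε / 2) (half_pos hε)
    refine ⟨d, fun n hn => ?_⟩
    rw [dist_eq_norm]
    refine lt_of_le_of_lt ?_ (half_lt_self hε)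
    have hl : Tendsto (fun m : ℕ => x ^ n.factorial • x ^ m.factorial • f - x ^ m.factorial • f) atTop
        (𝓝 (x ^ n.factorial • e • f - e • f)) :=
      (((CenterRing.continuous_smul _).tendsto _).comp (he f)).sub (he f)
    refine le_of_tendsto hl.norm ((eventually_ge_atTop i).mono fun m hm => ?_)
    obtain ⟨q, hq⟩ := Nat.dvd_factorial hd hn
    rw [← mul_smul, ← pow_add, hq, add_comm]
    exact h _ (hm.trans (Nat.self_le_factorial m)) q
  -- Along factorial exponents the limit is (e - e²)f = 0; contractivity extends this to all
  -- exponents.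
  have hnil : ∀ f : H, Tendsto (fun n => x ^ n • (1 - e) • f) atTop (𝓝 0) := by
    intro f
    have h0 : Tendsto (fun n : ℕ => x ^ n.factorial • (1 - e) • f) atTop (𝓝 0) := by
      have := he ((1 - e) • f)
      rwa [← mul_smul, mul_sub, mul_one, hee, sub_self, zero_smul] at this
    refine Metric.tendsto_atTop.2 fun ε hε => ?_
    obtain ⟨N, hN⟩ := Metric.tendsto_atTop.1 h0 ε hε
    refine ⟨N.factorial, fun n hn => lt_of_le_of_lt ?_ (hN N le_rfl)⟩
    rw [dist_zero_right, dist_zero_right, ← Nat.sub_add_cancel hn, pow_add, mul_smul]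
    exact hcon _ _
  have hgeom : ∀ f : H, CauchySeq fun n => (∑ k ∈ Finset.range n, x ^ k * (1 - e)) • f := by
    intro f
    refine Metric.cauchySeq_iff'.2 fun ε hε => ?_
    obtain ⟨N, hN⟩ := Metric.tendsto_atTop.1 (hnil f) ε hε
    refine ⟨N, fun n hn => lt_of_le_of_lt ?_ (hN N le_rfl)⟩
    rw [dist_zero_right, dist_eq_norm]
    induction n, hn using Nat.le_induction with
    | base => simp
    | succ n hn ih =>
      rw [Finset.sum_range_succ, add_smul, add_sub_right_comm]
      refine (IsUltrametricDist.norm_add_le_max _ _).trans (max_le ih ?_)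
      rw [mul_smul, ← Nat.sub_add_cancel hn, pow_add, mul_smul]
      exact hcon _ _
  obtain ⟨w, hw⟩ := CenterRing.exists_tendsto B hB _ hgeom
  refine ⟨e, u, w, hxu, hee, ?_⟩
  have : (1 - x) * w = 1 - e := by
    refine CenterRing.ext_smul fun f => ?_
    rw [mul_smul]
    refine tendsto_nhds_unique (((CenterRing.continuous_smul _).tendsto _).comp (hw f)) ?_
    have h1 : Tendsto (fun n => (1 - e) • f - x ^ n • (1 - e) • f) atTop (𝓝 ((1 - e) • f - 0)) :=
      tendsto_const_nhds.sub (hnil f)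
    rw [sub_zero] at h1
    refine h1.congr fun n => ?_
    rw [Function.comp_apply, ← mul_smul, ← mul_smul, ← sub_smul, ← Finset.sum_mul, ← mul_assoc,
      mul_neg_geom_sum, sub_mul, one_mul]
  rw [this, add_sub_cancel]

/-- For t ∉ m take a with at ≡ 1 modulo m and the Fitting idempotent e of x = at. The relation e +
(1 - x)w = 1 forces e ∉ m, and xu = e makes e f divisible by e t. Every denominator can therefore be
absorbed into the vector. -/
theorem toLocModule_surjective (B : Subring (H →L[L] H))
    (hB : ∀ φ ∈ pointwiseClosure B, ∀ f, ‖φ f‖ ≤ ‖f‖)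
    (hrec : ∀ (x : CenterRing (pointwiseClosure B)) (f : H), ∀ ε > 0, ∃ i j : ℕ,
      i < j ∧ ‖x ^ i • f - x ^ j • f‖ ≤ ε)
    (m : Ideal (CenterRing (pointwiseClosure B))) [m.IsMaximal] :
    Function.Surjective (toLocModule m) := by
  have hdiv : ∀ t ∉ m, ∀ f : H, ∃ s ∉ m, ∃ f' : H, s • f = (s * t) • f' := by
    intro t ht f
    obtain ⟨a, i, hi, hai⟩ := Ideal.IsMaximal.exists_inv ‹m.IsMaximal› ht
    obtain ⟨e, u, w, hu, hee, hw⟩ := CenterRing.exists_idempotent B hB (a * t) (hrec _)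
    refine ⟨e, fun he => ?_, (a * u) • f, ?_⟩
    · refine Ideal.IsMaximal.ne_top ‹_› ((Ideal.eq_top_iff_one m).2 ?_)
      rw [← hw]
      refine add_mem he (Ideal.mul_mem_right _ _ ?_)
      rwa [← hai, add_sub_cancel_left]
    · rw [← mul_smul, show e * t * (a * u) = e * (a * t * u) by ring, hu, hee]
  intro x
  change H ⊗[CenterRing (pointwiseClosure B)] Localization.AtPrime m at x
  induction x using TensorProduct.induction_on with
  | zero => exact ⟨0, TensorProduct.zero_tmul _ _⟩
  | add x y hx hy =>
    obtain ⟨f, rfl⟩ := hx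
    obtain ⟨g, rfl⟩ := hy
    exact ⟨f + g, TensorProduct.add_tmul _ _ _⟩
  | tmul f y =>
    induction y using Localization.induction_on with
    | H y =>
    obtain ⟨r, t⟩ := y
    obtain ⟨s, hs, f', hf'⟩ := hdiv t.1 t.2 (r • f)
    refine ⟨f', ?_⟩
    -- The fraction r/t is rewritten as sr/(st): the scalar sr crosses to f, where srf = stf', and
    -- st returns to cancel the denominator.
    have h1 : (Localization.mk r t : Localization.AtPrime m) =
        (s * r) • Localization.mk 1 ((⟨s, hs⟩ : m.primeCompl) * t) := by
      rw [Localization.smul_mk, Localization.mk_eq_mk_iff, Localization.r_iff_exists]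
      exact ⟨1, by simp [mul_comm, mul_left_comm]⟩
    have h2 : (s * (t : CenterRing (pointwiseClosure B))) •
        (Localization.mk 1 ((⟨s, hs⟩ : m.primeCompl) * t) : Localization.AtPrime m) = 1 := by
      rw [Localization.smul_mk, smul_eq_mul, mul_one]
      exact Localization.mk_self ((⟨s, hs⟩ : m.primeCompl) * t)
    change f' ⊗ₜ[CenterRing (pointwiseClosure B)] (1 : Localization.AtPrime m) = f ⊗ₜ _
    rw [h1, ← TensorProduct.smul_tmul, mul_smul, hf', TensorProduct.smul_tmul, h2]

end Contractions

/-! ### Algebraic vectors -/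

section AlgebraicVectors

variable {Γ L V W : Type*} [Group Γ] [Field L] [AddCommGroup V] [Module L V]
  [AddCommGroup W] [Module L W]

/-- Finite-dimensionality is immediate, since the orbit lies in the span of the y i. Stability of A
under right translation transfers regular coefficients from x to the other vectors of its orbit. -/
theorem isAlgebraicVector_of_expansion {A : Subalgebra L (Γ → L)}
    (hA : ∀ a ∈ A, ∀ g, (fun k => a (k * g)) ∈ A) {ρ : Representation L Γ V} {x : V}
    {ι : Type*} [Finite ι] (c : ι → Γ → L) (hc : ∀ i, c i ∈ A) (y : ι → V)
    (h : ∀ g, ρ g x = ∑ᶠ i, c i g • y i) : IsAlgebraicVector A ρ x := by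
  cases nonempty_fintype ι
  simp only [finsum_eq_sum_of_fintype] at h
  have hle : Submodule.span L (Set.range fun g => ρ g x) ≤ Submodule.span L (Set.range y) := by
    rw [Submodule.span_le]
    rintro _ ⟨g, rfl⟩
    change ρ g x ∈ _
    rw [h g]
    exact Submodule.sum_mem _ fun i _ => Submodule.smul_mem _ _ (Submodule.subset_span ⟨i, rfl⟩)
  have : FiniteDimensional L (Submodule.span L (Set.range y)) :=
    FiniteDimensional.span_of_finite L (Set.finite_range y)
  refine ⟨Submodule.finiteDimensional_of_le hle, ?_⟩
  rintro ⟨w, hw⟩ l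
  -- Extending the functional to V lets the span induction take place in V instead of in the
  -- subrepresentation.
  obtain ⟨l', hl'⟩ := l.exists_extend
  have hl : ∀ v : (cyclicSubrep ρ x).toSubmodule, l v = l' v.1 :=
    fun v => (LinearMap.congr_fun hl' v).symm
  have key : ∀ w ∈ Submodule.span L (Set.range fun g => ρ g x), (fun g => l' (ρ g w)) ∈ A := by
    intro w hw
    induction hw using Submodule.span_induction with
    | mem w hw =>
      obtain ⟨k, rfl⟩ := hw
      have : (fun g => l' (ρ g (ρ k x))) = ∑ i, l' (y i) • fun g => c i (g * k) := by
        funext g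
        have : ρ g (ρ k x) = ρ (g * k) x := by rw [map_mul]; rfl
        rw [this, h, map_sum]
        simp [mul_comm]
      rw [this]
      exact Subalgebra.sum_mem _ fun i _ => A.smul_mem (hA _ (hc i) k) _
    | zero => simp only [map_zero]; exact A.zero_mem
    | add v w _ _ hv hw =>
      have : (fun g => l' (ρ g (v + w))) = (fun g => l' (ρ g v)) + fun g => l' (ρ g w) := by
        funext g; simp
      rw [this]; exact A.add_mem hv hw
    | smul a v _ hv =>
      have : (fun g => l' (ρ g (a • v))) = a • fun g => l' (ρ g v) := by
        funext g; simp
      rw [this]; exact A.smul_mem hv a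
  have := key w hw
  convert this using 2 with g
  exact hl _

/-- The map q restricts to a surjection of cyclic subrepresentations, and matrix coefficients of the
image are matrix coefficients of the source. -/
theorem IsAlgebraicVector.map {A : Subalgebra L (Γ → L)} {ρ : Representation L Γ V}
    {σ : Representation L Γ W} (q : V →ₗ[L] W) (hq : ∀ g v, q (ρ g v) = σ g (q v)) {x : V}
    (hx : IsAlgebraicVector A ρ x) : IsAlgebraicVector A σ (q x) := by
  obtain ⟨hfin, hcoef⟩ := hx
  have hmap : (Submodule.span L (Set.range fun g => ρ g x)).map q =
      Submodule.span L (Set.range fun g => σ g (q x)) := by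
    rw [Submodule.map_span, ← Set.range_comp]
    congr 2
    funext g
    exact hq g x
  let q' : (cyclicSubrep ρ x).toSubmodule →ₗ[L] (cyclicSubrep σ (q x)).toSubmodule :=
    q.restrict fun v hv => by
      change q v ∈ Submodule.span L (Set.range fun g => σ g (q x))
      rw [← hmap]
      exact Submodule.mem_map_of_mem hv
  have hq' : Function.Surjective q' := by
    rintro ⟨w, hw⟩
    change w ∈ Submodule.span L (Set.range fun g => σ g (q x)) at hw
    rw [← hmap] at hw
    obtain ⟨v, hv, rfl⟩ := hw
    exact ⟨⟨v, hv⟩, rfl⟩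
  have hfin' : FiniteDimensional L (cyclicSubrep ρ x).toSubmodule := hfin
  refine ⟨Module.Finite.of_surjective q' hq', fun w l => ?_⟩
  obtain ⟨v, rfl⟩ := hq' w
  convert hcoef v (l.comp q') using 2 with g
  rw [LinearMap.comp_apply]
  congr 1
  exact Subtype.ext (hq g v.1).symm

end AlgebraicVectors

/-! ### A `p`-adic Stone–Weierstrass theorem -/

section StoneWeierstrass

variable {p : ℕ} [Fact p.Prime] {X L : Type*} [TopologicalSpace X] [CompactSpace X]
  [NormedField L] [NormedAlgebra ℚ_[p] L] [CompleteSpace L]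

theorem isUltrametricDist_of_padic (p : ℕ) [Fact p.Prime] (L : Type*) [NormedField L]
    [NormedAlgebra ℚ_[p] L] : IsUltrametricDist L := by
  refine IsUltrametricDist.isUltrametricDist_of_forall_norm_natCast_le_one fun n => ?_
  rw [← map_natCast (algebraMap ℚ_[p] L), norm_algebraMap']
  exact_mod_cast Padic.norm_int_le_one (n : ℤ)

/-- By Mahler's theorem φ is a uniform limit of combinations of binomial polynomials, and binom(ξ,
n) is a polynomial in s over L because n! is invertible in L. -/
theorem comp_mem_topologicalClosure (S : Subalgebra L C(X, L)) (ξ : C(X, ℤ_[p])) (s : C(X, L))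
    (hs : s ∈ S) (hξ : ∀ x, s x = algebraMap ℚ_[p] L (ξ x)) (φ : C(ℤ_[p], L)) :
    φ.comp ξ ∈ S.topologicalClosure := by
  have : IsUltrametricDist L := isUltrametricDist_of_padic p L
  -- Mahler expansions require the target to be a ℤ_p-module; the structure comes through ℚ_p.
  let _ : Module ℤ_[p] L := Module.compHom L (algebraMap ℤ_[p] ℚ_[p])
  have hsmul : ∀ (a : ℤ_[p]) (b : L), a • b = algebraMap ℚ_[p] L a * b :=
    fun a b => Algebra.smul_def (a : ℚ_[p]) b
  have : IsBoundedSMul ℤ_[p] L := IsBoundedSMul.of_norm_smul_le fun a b => by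
    rw [hsmul, norm_mul, norm_algebraMap']
    rfl
  have : CharZero L := charZero_of_injective_algebraMap (algebraMap ℚ_[p] L).injective
  have hterm : ∀ (a : L) (n : ℕ), (PadicInt.mahlerTerm a n : C(ℤ_[p], L)).comp ξ ∈ S := by
    intro a n
    have h1 : (PadicInt.mahlerTerm a n : C(ℤ_[p], L)).comp ξ =
        (a * (n.factorial : L)⁻¹) • Polynomial.aeval s (descPochhammer ℤ n) := by
      ext x
      let κ : ℤ_[p] →+* L := (algebraMap ℚ_[p] L).comp (algebraMap ℤ_[p] ℚ_[p])
      have h2 : κ ((descPochhammer ℤ n).smeval (ξ x)) = n.factorial * κ (Ring.choose (ξ x) n) := by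
        rw [Ring.descPochhammer_eq_factorial_smul_choose, nsmul_eq_mul, map_mul, map_natCast]
      have h3 : (Polynomial.aeval s (descPochhammer ℤ n)) x =
          κ ((descPochhammer ℤ n).smeval (ξ x)) := by
        rw [← Polynomial.aeval_eq_smeval]
        have h4 := Polynomial.hom_eval₂ (descPochhammer ℤ n) (algebraMap ℤ C(X, L))
          (ContinuousMap.evalAlgHom L L x : C(X, L) →ₐ[L] L).toRingHom s
        have h5 := Polynomial.hom_eval₂ (descPochhammer ℤ n) (algebraMap ℤ ℤ_[p]) κ (ξ x)
        rw [Polynomial.aeval_def, Polynomial.aeval_def]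
        refine h4.trans (Eq.trans ?_ h5.symm)
        congr 1
        · exact RingHom.ext_int _ _
        · exact hξ x
      rw [ContinuousMap.comp_apply, PadicInt.mahlerTerm_apply, hsmul, mahler_apply,
        ContinuousMap.smul_apply, h3, h2, smul_eq_mul]
      have : (n.factorial : L) ≠ 0 := Nat.cast_ne_zero.2 n.factorial_ne_zero
      rw [mul_assoc, inv_mul_cancel_left₀ this, mul_comm]
      rfl
    rw [h1]
    refine S.smul_mem ?_ _
    rw [Polynomial.aeval_eq_sum_range]
    exact S.sum_mem fun i _ => S.toSubmodule.smul_of_tower_mem _ (S.pow_mem hs i)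
  have h1 := (PadicInt.hasSum_mahler φ).map (ContinuousMap.compRightAlgHom L L ξ)
    (ContinuousMap.continuous_precomp ξ)
  refine isClosed_closure.mem_of_tendsto h1 (Eventually.of_forall fun t => subset_closure ?_)
  exact S.sum_mem fun n _ => hterm _ n

/-- Compactness bounds ξ, so p^k ξ is ℤ_p-valued for some k. Composing it with the indicator
function of a clopen ball gives the idempotent. -/
theorem exists_idempotent_separating (S : Subalgebra L C(X, L)) {x y : X} (ξ : C(X, ℚ_[p]))
    (s : C(X, L)) (hs : s ∈ S) (hξ : ∀ x, s x = algebraMap ℚ_[p] L (ξ x)) (hxy : ξ x ≠ ξ y) :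
    ∃ e ∈ S.topologicalClosure, (∀ z, e z = 0 ∨ e z = 1) ∧ e x = 1 ∧ e y = 0 := by
  obtain ⟨k, hk⟩ : ∃ k : ℕ, ∀ z, ‖(p : ℚ_[p]) ^ k * ξ z‖ ≤ 1 := by
    have hp : ‖(p : ℚ_[p])‖ < 1 := Padic.norm_p_lt_one
    have h0 : Tendsto (fun k : ℕ => ‖(p : ℚ_[p])‖ ^ k * ‖ξ‖) atTop (𝓝 (0 * ‖ξ‖)) :=
      (tendsto_pow_atTop_nhds_zero_of_lt_one (norm_nonneg _) hp).mul_const _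
    rw [zero_mul] at h0
    obtain ⟨k, hk⟩ := (h0.eventually (ge_mem_nhds one_pos)).exists
    refine ⟨k, fun z => le_trans ?_ hk⟩
    rw [norm_mul, norm_pow]
    exact mul_le_mul_of_nonneg_left (ξ.norm_coe_le_norm z) (by positivity)
  let η : C(X, ℤ_[p]) := ⟨fun z => ⟨(p : ℚ_[p]) ^ k * ξ z, hk z⟩,
    (continuous_const.mul ξ.continuous).subtype_mk _⟩
  have hη : η x ≠ η y := fun h => by
    have h' := congrArg Subtype.val h
    have hp0 : (p : ℚ_[p]) ≠ 0 := Nat.cast_ne_zero.2 (Fact.out : p.Prime).ne_zero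
    exact hxy (mul_left_cancel₀ (pow_ne_zero k hp0) h')
  let U : Set ℤ_[p] := Metric.ball (η x) ‖η x - η y‖
  have hU : IsClopen U := IsUltrametricDist.isClopen_ball _ _
  let φ : C(ℤ_[p], L) := ⟨U.indicator 1, hU.continuous_indicator continuous_one⟩
  refine ⟨φ.comp η, comp_mem_topologicalClosure S η (((p : L) ^ k) • s) (S.smul_mem hs _)
    (fun z => ?_) φ, fun z => ?_, ?_, ?_⟩
  · change (p : L) ^ k * s z = algebraMap ℚ_[p] L ((p : ℚ_[p]) ^ k * ξ z)
    rw [hξ, map_mul, map_pow, map_natCast]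
  · by_cases h : η z ∈ U
    · exact Or.inr (Set.indicator_of_mem h _)
    · exact Or.inl (Set.indicator_of_notMem h _)
  · exact Set.indicator_of_mem (Metric.mem_ball_self (norm_pos_iff.2 (sub_ne_zero.2 hη))) _
  · refine Set.indicator_of_notMem (fun h => ?_) _
    rw [Metric.mem_ball, dist_eq_norm, norm_sub_rev] at h
    exact lt_irrefl _ h

/-- The closure is an algebra with idempotents separating points. Finite products of these localize
near a point; the disjoint union e + (1 - e)e' then glues local constant approximations of f, with
error controlled by a maximum. -/
theorem topologicalClosure_eq_top_of_padic (S : Subalgebra L C(X, L))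
    (hS : ∀ x y : X, x ≠ y → ∃ ξ : C(X, ℚ_[p]), ∃ s ∈ S,
      (∀ z, s z = algebraMap ℚ_[p] L (ξ z)) ∧ ξ x ≠ ξ y) :
    S.topologicalClosure = ⊤ := by
  have : IsUltrametricDist L := isUltrametricDist_of_padic p L
  have hopen : ∀ (e : C(X, L)) (z : X) (a : L), (∀ z, e z = 0 ∨ e z = 1) → e z = a →
      {y | e y = a} ∈ 𝓝 z := by
    intro e z a he hz
    have h1 : {y | ‖e y - a‖ < 1} ∈ 𝓝 z :=
      (isOpen_lt (e.continuous.sub continuous_const).norm continuous_const).mem_nhds (by simp [hz])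
    refine mem_of_superset h1 fun y hy => ?_
    simp only [Set.mem_ofPred_eq] at hy ⊢
    rw [← hz] at hy ⊢
    rcases he y with h | h <;> rcases he z with h' | h' <;> rw [h, h'] at hy ⊢ <;> simp at hy
  -- The set where f is far from f x is compact, so a finite product of separating idempotents
  -- vanishes on it and keeps the value 1 at x.
  have hloc : ∀ (f : C(X, L)) (ε : ℝ), 0 < ε → ∀ x, ∃ e ∈ S.topologicalClosure,
      (∀ z, e z = 0 ∨ e z = 1) ∧ e x = 1 ∧ ∀ y, e y = 1 → ‖f y - f x‖ < ε := by
    intro f ε hε x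
    have hK : IsCompact {y | ε ≤ ‖f y - f x‖} :=
      (isClosed_le continuous_const (f.continuous.sub continuous_const).norm).isCompact
    obtain ⟨e, he, h01, hx, h0⟩ := hK.induction_on (p := fun s => ∃ e ∈ S.topologicalClosure,
        (∀ z, e z = 0 ∨ e z = 1) ∧ e x = 1 ∧ ∀ y ∈ s, e y = 0)
      ⟨1, one_mem _, by simp, rfl, by simp⟩
      (fun s t hst ⟨e, he, h1, h2, h3⟩ => ⟨e, he, h1, h2, fun y hy => h3 y (hst hy)⟩)
      (by
        rintro s t ⟨e, he, h1, h2, h3⟩ ⟨e', he', h1', h2', h3'⟩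
        refine ⟨e * e', mul_mem he he', fun z => ?_, by simp [h2, h2'], ?_⟩
        · rcases h1 z with h | h <;> rcases h1' z with h' | h' <;> simp [h, h']
        · rintro y (hy | hy)
          · simp [h3 y hy]
          · simp [h3' y hy])
      (by
        intro y hy
        have hxy : x ≠ y := by
          rintro rfl
          simp only [Set.mem_ofPred_eq, sub_self, norm_zero] at hy
          exact absurd hε (not_lt.2 hy)
        obtain ⟨ξ, s, hs, hξ, hne⟩ := hS x y hxy
        obtain ⟨e, he, h01, h1, h0⟩ := exists_idempotent_separating S ξ s hs hξ hne
        exact ⟨_, mem_nhdsWithin_of_mem_nhds (hopen e y 0 h01 h0), e, he, h01, h1, fun z hz => hz⟩)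
    refine ⟨e, he, h01, hx, fun y hy => ?_⟩
    by_contra hcon
    exact one_ne_zero (hy.symm.trans (h0 y (not_lt.1 hcon)))
  refine eq_top_iff.2 fun f _ => ?_
  change f ∈ closure (S : Set C(X, L))
  rw [← closure_closure, ← Subalgebra.topologicalClosure_coe]
  refine Metric.mem_closure_iff.2 fun ε hε => ?_
  -- The invariant compares g with e f on all of X, not only on s; this is what makes the gluing of
  -- two pieces possible.
  obtain ⟨e, he, g, hg, h01, h1, hfg⟩ := isCompact_univ.induction_on (p := fun s : Set X =>
      ∃ e ∈ S.topologicalClosure, ∃ g ∈ S.topologicalClosure, (∀ z, e z = 0 ∨ e z = 1) ∧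
        (∀ z ∈ s, e z = 1) ∧ ∀ z, ‖g z - e z * f z‖ ≤ ε / 2)
    ⟨0, zero_mem _, 0, zero_mem _, by simp, by simp, by simp [(half_pos hε).le]⟩
    (fun s t hst ⟨e, he, g, hg, h1, h2, h3⟩ => ⟨e, he, g, hg, h1, fun z hz => h2 z (hst hz), h3⟩)
    (by
      rintro s t ⟨e, he, g, hg, h1, h2, h3⟩ ⟨e', he', g', hg', h1', h2', h3'⟩
      refine ⟨e + (1 - e) * e', add_mem he (mul_mem (sub_mem (one_mem _) he) he'),
        g + (1 - e) * g', add_mem hg (mul_mem (sub_mem (one_mem _) he) hg'), fun z => ?_, ?_,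
        fun z => ?_⟩
      · rcases h1 z with h | h <;> rcases h1' z with h' | h' <;> simp [h, h']
      · rintro z (hz | hz)
        · simp [h2 z hz]
        · simp [h2' z hz]
      · rcases h1 z with h | h
        · have := (IsUltrametricDist.norm_add_le_max (g z - e z * f z) (g' z - e' z * f z)).trans
            (max_le (h3 z) (h3' z))
          refine le_of_eq_of_le (congrArg norm ?_) this
          simp [h]; ring
        · refine le_of_eq_of_le (congrArg norm ?_) (h3 z)
          simp [h])
    (by
      intro x _
      obtain ⟨e, he, h01, hx, hclose⟩ := hloc f (ε / 2) (half_pos hε) x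
      refine ⟨_, mem_nhdsWithin_of_mem_nhds (hopen e x 1 h01 hx), e, he, f x • e,
        Subalgebra.smul_mem _ he _, h01, fun z hz => hz, fun z => ?_⟩
      rcases h01 z with h | h
      · simp [h, (half_pos hε).le]
      · rw [ContinuousMap.smul_apply, h, smul_eq_mul, mul_one, one_mul, norm_sub_rev]
        exact (hclose z h).le)
  refine ⟨g, hg, lt_of_le_of_lt ?_ (half_lt_self hε)⟩
  rw [dist_comm, dist_eq_norm, ContinuousMap.norm_le _ (half_pos hε).le]
  intro z
  have := hfg z
  rwa [h1 z (Set.mem_univ z), one_mul] at this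

end StoneWeierstrass

/-! ### The local fields `F_v` -/

section LocalField

variable {F : Type*} [Field F] [NumberField F] (v : HeightOneSpectrum (𝓞 F))

theorem mem_integers_iff_norm_le_one {v : HeightOneSpectrum (𝓞 F)} {x : v.adicCompletion F} :
    x ∈ v.adicCompletionIntegers F ↔ ‖x‖ ≤ 1 :=
  (Valued.toNormedField.norm_le_one_iff (L := v.adicCompletion F)).symm

theorem norm_algebraMap_lt_one_iff (a : F) :
    ‖algebraMap F (v.adicCompletion F) a‖ < 1 ↔ v.valuation F a < 1 := by
  rw [Valued.toNormedField.norm_lt_one_iff]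
  exact iff_of_eq (congrArg (· < 1) (v.valuedAdicCompletion_eq_valuation' a))

theorem norm_algebraMap_le_one_iff (a : F) :
    ‖algebraMap F (v.adicCompletion F) a‖ ≤ 1 ↔ v.valuation F a ≤ 1 := by
  rw [Valued.toNormedField.norm_le_one_iff]
  exact iff_of_eq (congrArg (· ≤ 1) (v.valuedAdicCompletion_eq_valuation' a))

theorem norm_integer_le_one (a : 𝓞 F) : ‖algebraMap F (v.adicCompletion F) a‖ ≤ 1 :=
  (norm_algebraMap_le_one_iff v _).2 (v.valuation_le_one a)

theorem norm_integer_lt_one_iff (a : 𝓞 F) :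
    ‖algebraMap F (v.adicCompletion F) a‖ < 1 ↔ a ∈ v.asIdeal := by
  rw [norm_algebraMap_lt_one_iff, ← v.valuation_lt_one_iff_mem (K := F)]

theorem norm_natCast_le_one (n : ℕ) : ‖(n : v.adicCompletion F)‖ ≤ 1 := by
  simpa using norm_integer_le_one v n

theorem norm_natCast_lt_one_iff (n : ℕ) :
    ‖(n : v.adicCompletion F)‖ < 1 ↔ (n : 𝓞 F) ∈ v.asIdeal := by
  simpa using norm_integer_lt_one_iff v n

theorem exists_norm_sub_algebraMap_lt (x : v.adicCompletion F) {ε : ℝ} (hε : 0 < ε) :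
    ∃ a : F, ‖x - algebraMap F (v.adicCompletion F) a‖ < ε := by
  obtain ⟨a, ha⟩ := Metric.denseRange_iff.1 (v.denseRange_algebraMap F) x ε hε
  exact ⟨a, by rwa [← dist_eq_norm]⟩

theorem adicCompletion_isUltrametricDist : IsUltrametricDist (v.adicCompletion F) :=
  IsUltrametricDist.isUltrametricDist_of_forall_norm_natCast_le_one (norm_natCast_le_one v)

theorem norm_sub_le_max_of_ultrametric {E : Type*} [SeminormedAddCommGroup E] [IsUltrametricDist E]
    (x y : E) : ‖x - y‖ ≤ max ‖x‖ ‖y‖ := by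
  simpa [sub_eq_add_neg] using IsUltrametricDist.norm_add_le_max x (-y)

/-- This gives surjectivity of 𝓞 F onto the residue field: approximate x by an element of F, which
is then v-integral, and that element by an algebraic integer. -/
theorem exists_integer_norm_sub_lt_one {x : v.adicCompletion F} (hx : ‖x‖ ≤ 1) :
    ∃ a : 𝓞 F, ‖x - algebraMap F (v.adicCompletion F) a‖ < 1 := by
  have := adicCompletion_isUltrametricDist v
  obtain ⟨a, ha⟩ := exists_norm_sub_algebraMap_lt v x one_pos
  have hav : ‖algebraMap F (v.adicCompletion F) a‖ ≤ 1 := by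
    have := norm_sub_le_max_of_ultrametric x (x - algebraMap F (v.adicCompletion F) a)
    rw [sub_sub_cancel] at this
    exact this.trans (max_le hx ha.le)
  obtain ⟨b, hb⟩ := v.exists_valuation_sub_lt_of_integer
    ((norm_algebraMap_le_one_iff v a).1 hav) 1
  rw [Units.val_one, ← norm_algebraMap_lt_one_iff, map_sub] at hb
  refine ⟨b, ?_⟩
  rw [← sub_sub_sub_cancel_right _ _ (algebraMap F (v.adicCompletion F) a)]
  exact (norm_sub_le_max_of_ultrametric _ _).trans_lt (max_lt ha hb)

theorem isCompact_adicCompletionIntegers :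
    IsCompact (v.adicCompletionIntegers F : Set (v.adicCompletion F)) := by
  have hdvr : IsDiscreteValuationRing (Valued.integer (v.adicCompletion F)) :=
    inferInstanceAs (IsDiscreteValuationRing (v.adicCompletionIntegers F))
  have hcomp : CompleteSpace (Valued.integer (v.adicCompletion F)) :=
    (Valued.isClosed_integer (v.adicCompletion F)).completeSpace_coe
  have hmax : ∀ x : Valued.integer (v.adicCompletion F), ‖(x : v.adicCompletion F)‖ < 1 →
      x ∈ IsLocalRing.maximalIdeal (Valued.integer (v.adicCompletion F)) := by
    intro x hx
    rw [IsLocalRing.mem_maximalIdeal, mem_nonunits_iff,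
      (Valuation.integer.integers (Valued.v (R := v.adicCompletion F))).isUnit_iff_valuation_eq_one]
    rw [Valued.toNormedField.norm_lt_one_iff] at hx
    exact hx.ne
  have hfin : Finite (Valued.ResidueField (v.adicCompletion F)) := by
    have hq : Finite (𝓞 F ⧸ v.asIdeal) := v.asIdeal.finiteQuotientOfFreeOfNeBot v.ne_bot
    let i : 𝓞 F →+* Valued.integer (v.adicCompletion F) :=
      (algebraMap (𝓞 F) (v.adicCompletionIntegers F))
    let f : 𝓞 F →+* Valued.ResidueField (v.adicCompletion F) :=
      (IsLocalRing.residue (Valued.integer (v.adicCompletion F))).comp i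
    refine Finite.of_surjective (Ideal.Quotient.lift v.asIdeal f fun a ha => ?_) ?_
    · exact (IsLocalRing.residue_eq_zero_iff _).2 (hmax _ ((norm_integer_lt_one_iff v a).2 ha))
    · refine Ideal.Quotient.lift_surjective_of_surjective _ _ fun y => ?_
      obtain ⟨x, rfl⟩ := IsLocalRing.residue_surjective y
      obtain ⟨a, ha⟩ := exists_integer_norm_sub_lt_one v (mem_integers_iff_norm_le_one.1 x.2)
      refine ⟨a, ?_⟩
      change IsLocalRing.residue _ (i a) = _
      rw [← sub_eq_zero, ← map_sub, IsLocalRing.residue_eq_zero_iff]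
      refine hmax _ ?_
      rw [← norm_neg]
      refine lt_of_eq_of_lt (congrArg norm ?_) ha
      exact neg_sub _ _
  have := Valued.integer.compactSpace_iff_completeSpace_and_isDiscreteValuationRing_and_finite_residueField.2
    ⟨hcomp, hdvr, hfin⟩
  exact isCompact_iff_compactSpace.2 this

theorem adicCompletion_locallyCompactSpace : LocallyCompactSpace (v.adicCompletion F) := by
  refine (isCompact_adicCompletionIntegers v).locallyCompactSpace_of_mem_nhds_of_addGroup (x := 0) ?_
  refine mem_of_superset (Metric.closedBall_mem_nhds 0 one_pos) fun x hx => ?_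
  exact mem_integers_iff_norm_le_one.2 (by simpa using hx)

theorem natCast_adicCompletion_ne_zero {n : ℕ} (hn : n ≠ 0) : (n : v.adicCompletion F) ≠ 0 := by
  rw [← map_natCast (algebraMap F (v.adicCompletion F)), map_ne_zero]
  exact Nat.cast_ne_zero.2 hn

theorem exists_natCast_norm_lt_one : ∃ n : ℕ, n ≠ 0 ∧ ‖(n : v.adicCompletion F)‖ < 1 :=
  ⟨Ideal.absNorm v.asIdeal, Ideal.absNorm_eq_zero_iff.not.2 v.ne_bot,
    (norm_natCast_lt_one_iff v _).2 (Ideal.absNorm_mem _)⟩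

theorem exists_natCast_norm_lt {ε : ℝ} (hε : 0 < ε) :
    ∃ n : ℕ, n ≠ 0 ∧ ‖(n : v.adicCompletion F)‖ < ε := by
  obtain ⟨n, hn, h⟩ := exists_natCast_norm_lt_one v
  obtain ⟨k, hk⟩ := exists_pow_lt_of_lt_one hε h
  exact ⟨n ^ k, pow_ne_zero k hn, by rwa [Nat.cast_pow, norm_pow]⟩

/-- Denominators are taken to be natural numbers because one natural number makes sense at all
places at once. Boundedness of adelic families is always expressed in this way. -/
theorem exists_natCast_mul_norm_le_one (x : v.adicCompletion F) :
    ∃ n : ℕ, n ≠ 0 ∧ ‖(n : v.adicCompletion F) * x‖ ≤ 1 := by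
  obtain ⟨n, hn, h⟩ := exists_natCast_norm_lt v (ε := (‖x‖ + 1)⁻¹) (by positivity)
  refine ⟨n, hn, ?_⟩
  rw [norm_mul]
  have : ‖(n : v.adicCompletion F)‖ * ‖x‖ ≤ (‖x‖ + 1)⁻¹ * (‖x‖ + 1) :=
    mul_le_mul h.le (by linarith) (norm_nonneg _) (by positivity)
  rwa [inv_mul_cancel₀ (by positivity)] at this

/-- The field `F_v` with its `v`-adic absolute value. -/
noncomputable abbrev adicNontriviallyNormedField : NontriviallyNormedField (v.adicCompletion F) :=
  NontriviallyNormedField.ofNormNeOne (by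
    obtain ⟨a, ha, h0⟩ := Submodule.exists_mem_ne_zero_of_ne_bot v.ne_bot
    refine ⟨algebraMap F (v.adicCompletion F) a, ?_, ((norm_integer_lt_one_iff v a).2 ha).ne⟩
    rw [map_ne_zero]
    simpa using h0)

/-! ### The embedding of ℚ_p in F_v for v above p -/

section Padic

variable {p : ℕ} [Fact p.Prime]

/-- A p-integral rational has denominator prime to p, and such a denominator is a unit at every
place above p. -/
theorem norm_ratCast_le_one {v : HeightOneSpectrum (𝓞 F)} (hv : (p : 𝓞 F) ∈ v.asIdeal) {q : ℚ} (hq : ‖(q : ℚ_[p])‖ ≤ 1) :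
    ‖(q : v.adicCompletion F)‖ ≤ 1 := by
  have hden : ‖(q.den : v.adicCompletion F)‖ = 1 := by
    refine le_antisymm (norm_natCast_le_one v _) (not_lt.1 fun h => ?_)
    rw [norm_natCast_lt_one_iff] at h
    have hcop : Nat.Coprime p q.den := by
      rw [(Fact.out : p.Prime).coprime_iff_not_dvd, ← Padic.norm_natCast_lt_one_iff, not_lt]
      by_contra hlt
      rw [not_le] at hlt
      have hnum : ‖(q.num : ℚ_[p])‖ = 1 := by
        rw [Padic.norm_intCast_eq_one_iff]
        rw [Padic.norm_natCast_lt_one_iff] at hlt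
        exact (Int.isCoprime_iff_nat_coprime.2 q.reduced).of_isCoprime_of_dvd_right
          (Int.natCast_dvd_natCast.2 hlt)
      rw [Rat.cast_def, norm_div, hnum] at hq
      have h0 : 0 < ‖(q.den : ℚ_[p])‖ := norm_pos_iff.2 (Nat.cast_ne_zero.2 q.den_ne_zero)
      rw [div_le_one h0] at hq
      linarith
    -- Bézout: if the prime ideal contained both p and the denominator, it would contain 1.
    have h1 := Ideal.add_mem _ (v.asIdeal.mul_mem_right (p.gcdA q.den : 𝓞 F) hv)
      (v.asIdeal.mul_mem_right (p.gcdB q.den : 𝓞 F) h)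
    refine v.isPrime.ne_top ((Ideal.eq_top_iff_one _).2 ?_)
    convert h1
    have := Nat.gcd_eq_gcd_ab p q.den
    rw [hcop] at this
    exact_mod_cast congrArg (Int.cast : ℤ → 𝓞 F) this
  rw [Rat.cast_def, norm_div, hden, div_one, ← map_intCast (algebraMap F (v.adicCompletion F))]
  exact_mod_cast norm_integer_le_one v q.num

/-- Scaling by p^k turns p-adic smallness of a rational into v-adic smallness, so ℚ → F_v is
uniformly continuous for the p-adic topology and extends to ℚ_p. -/
theorem exists_continuous_padic_ringHom {v : HeightOneSpectrum (𝓞 F)} (hv : (p : 𝓞 F) ∈ v.asIdeal) :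
    ∃ φ : ℚ_[p] →+* v.adicCompletion F, Continuous φ := by
  have : CharZero (v.adicCompletion F) := algebraRat.charZero _
  let R : Subfield ℚ_[p] := (Rat.castHom ℚ_[p]).fieldRange
  let g : R ≃+* ℚ := (Rat.castHom ℚ_[p]).rangeRestrictFieldEquiv.symm
  let f : R →+* v.adicCompletion F := (Rat.castHom (v.adicCompletion F)).comp g.toRingHom
  have hg : ∀ x : R, ((g x : ℚ) : ℚ_[p]) = x := fun x =>
    congrArg Subtype.val ((Rat.castHom ℚ_[p]).rangeRestrictFieldEquiv.apply_symm_apply x)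
  have hf : UniformContinuous f := by
    refine uniformContinuous_of_continuousAt_zero f.toAddMonoidHom (Metric.tendsto_nhds.2 ?_)
    intro ε hε
    obtain ⟨k, hk⟩ := exists_pow_lt_of_lt_one hε ((norm_natCast_lt_one_iff v p).2 hv)
    have hp0 : (p : ℚ) ≠ 0 := Nat.cast_ne_zero.2 (Fact.out : p.Prime).ne_zero
    have hpos : (0 : ℝ) < ‖(p : ℚ_[p])‖ ^ k :=
      pow_pos (norm_pos_iff.2 (Nat.cast_ne_zero.2 (Fact.out : p.Prime).ne_zero)) k
    refine mem_of_superset (Metric.ball_mem_nhds 0 hpos) fun x hx => ?_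
    rw [mem_ball_zero_iff] at hx
    change dist (f x) (f 0) < ε
    rw [map_zero, dist_zero_right]
    change ‖((g x : ℚ) : v.adicCompletion F)‖ < ε
    have h1 : ‖((g x / p ^ k : ℚ) : v.adicCompletion F)‖ ≤ 1 := by
      refine norm_ratCast_le_one hv ?_
      push_cast
      rw [hg, norm_div, norm_pow]
      exact div_le_one_of_le₀ hx.le hpos.le
    have h2 : g x = p ^ k * (g x / p ^ k) := by field_simp
    rw [h2, Rat.cast_mul, norm_mul]
    push_cast at h1 ⊢
    rw [norm_pow]
    exact (mul_le_of_le_one_right (by positivity) h1).trans_lt hk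
  have hR : DenseRange (R.subtype : R → ℚ_[p]) := by
    refine (Padic.denseRange_ratCast (p := p)).mono ?_
    rintro _ ⟨q, rfl⟩
    exact ⟨⟨q, q, rfl⟩, rfl⟩
  refine ⟨IsDenseInducing.extendRingHom (i := R.subtype) (isUniformInducing_val _) hR hf, ?_⟩
  exact (uniformContinuous_uniformly_extend (isUniformInducing_val _) hR hf).continuous

end Padic

end LocalField

/-! ### Modules with the module topology -/

section ModuleTopology

variable {R M ι : Type*} [CommRing R] [TopologicalSpace R] [IsTopologicalRing R] [Finite ι]
  [AddCommGroup M] [Module R M] [TopologicalSpace M] [IsModuleTopology R M]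

/-- The coordinates with respect to a finite basis identify a free module with its module topology
with a power of the base ring. -/
noncomputable def basisHomeomorph (b : Module.Basis ι R M) : M ≃ₜ (ι → R) where
  toEquiv := b.equivFun.toEquiv
  continuous_toFun := IsModuleTopology.continuous_of_linearMap b.equivFun.toLinearMap
  continuous_invFun := by
    have := IsModuleTopology.toContinuousAdd R M
    exact IsModuleTopology.continuous_of_linearMap b.equivFun.symm.toLinearMap

end ModuleTopology

/-! ### Topological vector spaces over ℚ_p -/

section PadicModule

variable {p : ℕ} [Fact p.Prime] {E : Type*} [AddCommGroup E] [TopologicalSpace E]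
  [Module ℚ_[p] E] [ContinuousSMul ℚ_[p] E]

theorem exists_padic_coordinates [IsTopologicalAddGroup E] [T2Space E] [LocallyCompactSpace E] :
    ∃ (d : ℕ) (ε : Fin d → E) (ξ : Fin d → E →L[ℚ_[p]] ℚ_[p]), ∀ x, x = ∑ i, ξ i x • ε i := by
  have : FiniteDimensional ℚ_[p] E := FiniteDimensional.of_locallyCompactSpace ℚ_[p]
  let b := Module.finBasis ℚ_[p] E
  exact ⟨_, b, fun i => LinearMap.toContinuousLinearMap (b.coord i), fun x => (b.sum_repr x).symm⟩

/-- Additivity gives ℚ-linearity, and continuity upgrades it to ℚ_p-linearity by density. -/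
theorem map_padic_smul {L : Type*} [NormedField L] [NormedAlgebra ℚ_[p] L] (l : E →+ L)
    (hl : Continuous l) (a : ℚ_[p]) (x : E) : l (a • x) = algebraMap ℚ_[p] L a * l x := by
  have h1 : Continuous fun a : ℚ_[p] => l (a • x) := hl.comp (continuous_id.smul continuous_const)
  have h2 : Continuous fun a : ℚ_[p] => algebraMap ℚ_[p] L a * l x :=
    (continuous_algebraMap ℚ_[p] L).mul continuous_const
  have h3 : (fun a : ℚ_[p] => l (a • x)) ∘ ((↑) : ℚ → ℚ_[p]) =
      (fun a : ℚ_[p] => algebraMap ℚ_[p] L a * l x) ∘ ((↑) : ℚ → ℚ_[p]) := by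
    let _ : Module ℚ E := Module.compHom E (algebraMap ℚ ℚ_[p])
    have : CharZero L := charZero_of_injective_algebraMap (algebraMap ℚ_[p] L).injective
    funext q
    have := map_rat_smul l q x
    simp only [Function.comp_apply]
    refine Eq.trans ?_ (this.trans ?_)
    · rfl
    · rw [map_ratCast, Rat.smul_def]
  exact congrFun ((Padic.denseRange_ratCast (p := p)).equalizer h1 h2 h3) a

end PadicModule

/-! ### Inverses in the unitary group -/

section Inverse

variable {F K D : Type*} [Field F] [Field K] [Algebra F K] [Ring D] [Algebra F D]
  [Algebra K D] {s : InvolutionSecondKind F K D}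

theorem starBase_mul_self {R : Type*} [CommRing R] [Algebra F R] (g : U s R) :
    starBase s R ((g : (R ⊗[F] D)ˣ) : R ⊗[F] D) * ((g : (R ⊗[F] D)ˣ) : R ⊗[F] D) = 1 := by
  have h : ((g : (R ⊗[F] D)ˣ) : R ⊗[F] D) * starBase s R ((g : (R ⊗[F] D)ˣ) : R ⊗[F] D) = 1 := g.2
  rw [← Units.inv_eq_of_mul_eq_one_right h, Units.inv_mul]

theorem coe_inv_eq_starBase {R : Type*} [CommRing R] [Algebra F R] (g : U s R) :
    (((g⁻¹ : U s R) : (R ⊗[F] D)ˣ) : R ⊗[F] D) =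
      starBase s R ((g : (R ⊗[F] D)ˣ) : R ⊗[F] D) := by
  have h : ((g : (R ⊗[F] D)ˣ) : R ⊗[F] D) * starBase s R ((g : (R ⊗[F] D)ˣ) : R ⊗[F] D) = 1 := g.2
  exact Units.inv_eq_of_mul_eq_one_right h

end Inverse

/-! ### Coordinates and local norms -/

section Norms

variable {F K D ι : Type*} [Field F] [Field K] [Algebra F K] [Ring D] [Algebra F D]
  [Algebra K D] (s : InvolutionSecondKind F K D) [Fintype ι] (b : Module.Basis ι F D)

/-- The coordinates on `R ⊗ D` attached to a basis of `D`. -/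
noncomputable def coords (R : Type*) [CommRing R] [Algebra F R] : R ⊗[F] D ≃ₗ[R] (ι → R) :=
  (Algebra.TensorProduct.basis R b).equivFun

section

variable {R : Type*} [CommRing R] [Algebra F R]

theorem coords_tmul (r : R) (d : D) (i : ι) :
    coords b R (r ⊗ₜ d) i = r * algebraMap F R (b.repr d i) := by
  simp [coords, Algebra.TensorProduct.basis_repr_tmul]

theorem sum_coords_smul (x : R ⊗[F] D) : ∑ i, coords b R x i • ((1 : R) ⊗ₜ[F] b i) = x := by
  have := (Algebra.TensorProduct.basis R b).sum_equivFun x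
  simp only [Algebra.TensorProduct.basis_apply] at this
  exact this

theorem coords_map {R' : Type*} [CommRing R'] [Algebra F R'] (φ : R →ₐ[F] R') (x : R ⊗[F] D)
    (i : ι) : coords b R' (Algebra.TensorProduct.map φ (AlgHom.id F D) x) i =
      φ (coords b R x i) := by
  induction x using TensorProduct.induction_on with
  | zero => simp
  | add x y hx hy => simp [hx, hy]
  | tmul r d => simp [coords_tmul]

end

variable [NumberField F] (v : HeightOneSpectrum (𝓞 F))

/-- The maximum of the absolute values of the coordinates of an element of `F_v ⊗ D`. -/
noncomputable def locNorm (x : v.adicCompletion F ⊗[F] D) : ℝ := ‖coords b (v.adicCompletion F) x‖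

theorem locNorm_nonneg (x : v.adicCompletion F ⊗[F] D) : 0 ≤ locNorm b v x := norm_nonneg _

theorem norm_coords_le (x : v.adicCompletion F ⊗[F] D) (i : ι) :
    ‖coords b (v.adicCompletion F) x i‖ ≤ locNorm b v x := norm_le_pi_norm _ i

theorem locNorm_le_iff {x : v.adicCompletion F ⊗[F] D} {r : ℝ} (hr : 0 ≤ r) :
    locNorm b v x ≤ r ↔ ∀ i, ‖coords b (v.adicCompletion F) x i‖ ≤ r := pi_norm_le_iff_of_nonneg hr

theorem locNorm_zero : locNorm b v 0 = 0 := by simp [locNorm]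

theorem locNorm_smul (a : v.adicCompletion F) (x : v.adicCompletion F ⊗[F] D) :
    locNorm b v (a • x) = ‖a‖ * locNorm b v x := by
  rw [locNorm, map_smul, norm_smul, locNorm]

theorem locNorm_add_le (x y : v.adicCompletion F ⊗[F] D) :
    locNorm b v (x + y) ≤ max (locNorm b v x) (locNorm b v y) := by
  have := adicCompletion_isUltrametricDist v
  rw [locNorm, map_add]
  exact IsUltrametricDist.norm_add_le_max _ _

theorem locNorm_sub_le (x y : v.adicCompletion F ⊗[F] D) :
    locNorm b v (x - y) ≤ max (locNorm b v x) (locNorm b v y) := by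
  have := adicCompletion_isUltrametricDist v
  rw [locNorm, map_sub]
  exact norm_sub_le_max_of_ultrametric _ _

theorem locNorm_neg (x : v.adicCompletion F ⊗[F] D) : locNorm b v (-x) = locNorm b v x := by
  rw [locNorm, map_neg, norm_neg, locNorm]

theorem locNorm_sum_le {κ : Type*} (t : Finset κ) (x : κ → v.adicCompletion F ⊗[F] D) {r : ℝ}
    (hr : 0 ≤ r) (h : ∀ k ∈ t, locNorm b v (x k) ≤ r) : locNorm b v (∑ k ∈ t, x k) ≤ r := by
  classical
  induction t using Finset.induction_on with
  | empty => simpa [locNorm_zero] using hr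
  | insert k t hk ih =>
    rw [Finset.sum_insert hk]
    exact (locNorm_add_le b v _ _).trans (max_le (h k (Finset.mem_insert_self _ _))
      (ih fun j hj => h j (Finset.mem_insert_of_mem hj)))

theorem exists_natCast_mul_mem_integers (a : F) : ∃ n : ℕ, n ≠ 0 ∧ ∃ c : 𝓞 F, (n : F) * a = c := by
  have hint : IsAlgebraic ℤ a :=
    (IsFractionRing.isAlgebraic_iff ℤ ℚ F).2 (Algebra.IsAlgebraic.isAlgebraic (R := ℚ) a)
  obtain ⟨y, hy, h⟩ := hint.exists_integral_multiple
  have hn : IsIntegral ℤ ((y.natAbs : F) * a) := by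
    rw [zsmul_eq_mul] at h
    rcases Int.natAbs_eq y with hy' | hy'
    · rw [hy'] at h
      simpa only [Int.cast_natCast] using h
    · rw [hy'] at h
      push_cast at h
      rw [neg_mul] at h
      simpa using h.neg
  exact ⟨y.natAbs, by simpa using hy, ⟨_, hn⟩, rfl⟩

/-- The coordinates of d lie in F and have one common denominator, so n is independent of v. -/
theorem exists_natCast_mul_locNorm_le (d : D) :
    ∃ n : ℕ, n ≠ 0 ∧ ∀ v : HeightOneSpectrum (𝓞 F),
      ‖(n : v.adicCompletion F)‖ * locNorm b v (1 ⊗ₜ d) ≤ 1 := by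
  classical
  choose n hn c hc using fun i => exists_natCast_mul_mem_integers (b.repr d i)
  refine ⟨∏ i, n i, Finset.prod_ne_zero_iff.2 fun i _ => hn i, fun v => ?_⟩
  rw [← locNorm_smul, locNorm_le_iff b v zero_le_one]
  intro i
  rw [map_smul, Pi.smul_apply, smul_eq_mul, coords_tmul, one_mul,
    ← Finset.prod_erase_mul _ _ (Finset.mem_univ i), Nat.cast_mul, mul_assoc, norm_mul,
    ← map_natCast (algebraMap F (v.adicCompletion F)) (n i), ← map_mul, hc]
  exact mul_le_one₀ (norm_natCast_le_one v _) (norm_nonneg _) (norm_integer_le_one v _)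

theorem exists_natCast_mul_locNorm_le_of_finite {κ : Type*} [Finite κ] (d : κ → D) :
    ∃ n : ℕ, n ≠ 0 ∧ ∀ (v : HeightOneSpectrum (𝓞 F)) (k : κ),
      ‖(n : v.adicCompletion F)‖ * locNorm b v (1 ⊗ₜ d k) ≤ 1 := by
  classical
  cases nonempty_fintype κ
  choose n hn h using fun k => exists_natCast_mul_locNorm_le b (d k)
  refine ⟨∏ k, n k, Finset.prod_ne_zero_iff.2 fun k _ => hn k, fun v k => ?_⟩
  rw [← Finset.prod_erase_mul _ _ (Finset.mem_univ k), Nat.cast_mul, norm_mul, mul_assoc]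
  exact mul_le_one₀ (norm_natCast_le_one v _) (mul_nonneg (norm_nonneg _) (locNorm_nonneg b v _))
    (h k v)

/-- The number n is a common denominator of the structure constants of D; it makes all the local
norms submultiplicative up to one global factor. -/
theorem exists_locNorm_mul_le : ∃ n : ℕ, n ≠ 0 ∧ ∀ (v : HeightOneSpectrum (𝓞 F))
    (x y : v.adicCompletion F ⊗[F] D),
      ‖(n : v.adicCompletion F)‖ * locNorm b v (x * y) ≤ locNorm b v x * locNorm b v y := by
  obtain ⟨n, hn, h⟩ := exists_natCast_mul_locNorm_le_of_finite b fun k : ι × ι => b k.1 * b k.2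
  refine ⟨n, hn, fun v x y => ?_⟩
  have hxy : x * y = ∑ i, ∑ j, (coords b _ x i * coords b _ y j) •
      ((1 : v.adicCompletion F) ⊗ₜ[F] (b i * b j)) := by
    conv_lhs => rw [← sum_coords_smul b x, ← sum_coords_smul b y]
    rw [Finset.sum_mul_sum]
    refine Finset.sum_congr rfl fun i _ => Finset.sum_congr rfl fun j _ => ?_
    rw [smul_mul_smul_comm, Algebra.TensorProduct.tmul_mul_tmul, one_mul]
  have h0 := mul_nonneg (locNorm_nonneg b v x) (locNorm_nonneg b v y)
  rw [← locNorm_smul, hxy, Finset.smul_sum]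
  refine locNorm_sum_le b v _ _ h0 fun i _ => ?_
  rw [Finset.smul_sum]
  refine locNorm_sum_le b v _ _ h0 fun j _ => ?_
  rw [smul_comm, locNorm_smul, locNorm_smul, norm_mul]
  refine (mul_le_of_le_one_right (by positivity) (h v (i, j))).trans ?_
  exact mul_le_mul (norm_coords_le b v x i) (norm_coords_le b v y j) (norm_nonneg _)
    (locNorm_nonneg b v x)

/-- Here n clears the denominators of the matrix of the involution. -/
theorem exists_locNorm_starBase_le : ∃ n : ℕ, n ≠ 0 ∧ ∀ (v : HeightOneSpectrum (𝓞 F))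
    (x : v.adicCompletion F ⊗[F] D),
      ‖(n : v.adicCompletion F)‖ * locNorm b v (starBase s _ x) ≤ locNorm b v x := by
  obtain ⟨n, hn, h⟩ := exists_natCast_mul_locNorm_le_of_finite b fun i => s.toLinearMap (b i)
  refine ⟨n, hn, fun v x => ?_⟩
  have hx : starBase s _ x = ∑ i, coords b _ x i •
      ((1 : v.adicCompletion F) ⊗ₜ[F] s.toLinearMap (b i)) := by
    conv_lhs => rw [← sum_coords_smul b x, map_sum]
    refine Finset.sum_congr rfl fun i _ => ?_
    rw [map_smul, starBase_tmul]
  rw [← locNorm_smul, hx, Finset.smul_sum]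
  refine locNorm_sum_le b v _ _ (locNorm_nonneg b v x) fun i _ => ?_
  rw [smul_comm, locNorm_smul, locNorm_smul]
  exact (mul_le_of_le_one_right (norm_nonneg _) (h v i)).trans (norm_coords_le b v x i)

theorem mem_integers_of_forall_norm_le_one {a : F}
    (h : ∀ v : HeightOneSpectrum (𝓞 F), ‖algebraMap F (v.adicCompletion F) a‖ ≤ 1) :
    ∃ c : 𝓞 F, a = c := by
  obtain ⟨c, hc⟩ := HeightOneSpectrum.mem_integers_of_valuation_le_one F a fun v =>
    (norm_algebraMap_le_one_iff v a).1 (h v)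
  exact ⟨c, hc.symm⟩

end Norms

/-! ### Approximation -/

section Approximation

variable {F : Type*} [Field F] [NumberField F] (v : HeightOneSpectrum (𝓞 F))

variable {v} in
theorem norm_le_of_mul_mem_span {n : ℕ} {c x : 𝓞 F} (hc : c ∉ v.asIdeal)
    (h : c * x ∈ Ideal.span {(n : 𝓞 F)}) :
    ‖algebraMap F (v.adicCompletion F) x‖ ≤ ‖(n : v.adicCompletion F)‖ := by
  obtain ⟨d, hd⟩ := Ideal.mem_span_singleton'.1 h
  have hc1 : ‖algebraMap F (v.adicCompletion F) c‖ = 1 :=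
    le_antisymm (norm_integer_le_one v c) (not_lt.1 fun h => hc ((norm_integer_lt_one_iff v c).1 h))
  have h := congrArg (fun x : 𝓞 F => ‖algebraMap F (v.adicCompletion F) x‖) hd
  simp only [map_mul, norm_mul, hc1, one_mul, map_natCast] at h
  rw [← h]
  exact mul_le_of_le_one_left (norm_nonneg _) (norm_integer_le_one v d)

/-- Chinese remainder theorem: write (n) = v^a J with J prime to v, and take α ∈ J with α ≡ 1 modulo
v^a. -/
theorem exists_integer_close_to_one {n : ℕ} (hn : n ≠ 0) : ∃ α : 𝓞 F,
    ‖algebraMap F (v.adicCompletion F) (1 - α : 𝓞 F)‖ ≤ ‖(n : v.adicCompletion F)‖ ∧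
    ∀ w : HeightOneSpectrum (𝓞 F), w ≠ v →
      ‖algebraMap F (w.adicCompletion F) α‖ ≤ ‖(n : w.adicCompletion F)‖ := by
  have hI : Ideal.span {(n : 𝓞 F)} ≠ 0 := by
    rw [Ne, Ideal.zero_eq_bot, Ideal.span_singleton_eq_bot]
    exact Nat.cast_ne_zero.2 hn
  obtain ⟨a, J, hJ, hIJ⟩ := WfDvdMonoid.max_power_factor hI v.irreducible
  have hJv : ¬ J ≤ v.asIdeal := fun h => hJ (Ideal.dvd_iff_le.2 h)
  have hcop : IsCoprime (v.asIdeal ^ a) J := by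
    refine IsCoprime.pow_left (Ideal.isCoprime_iff_sup_eq.2 ?_)
    exact v.isMaximal.1.2 _ (lt_of_le_of_ne le_sup_left fun h => hJv (h ▸ le_sup_right))
  obtain ⟨β, hβ, α, hα, hsum⟩ := Submodule.mem_sup.1
    ((Ideal.eq_top_iff_one _).1 (Ideal.isCoprime_iff_sup_eq.1 hcop))
  refine ⟨α, ?_, fun w hw => ?_⟩
  -- Multiplying by an element c of J outside v gives divisibility by n without changing the v-adic
  -- absolute value.
  · obtain ⟨c, hc, hcv⟩ := SetLike.not_le_iff_exists.1 hJv
    refine norm_le_of_mul_mem_span hcv ?_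
    rw [← hsum, add_sub_cancel_right, hIJ, mul_comm c]
    exact Ideal.mul_mem_mul hβ hc
  · obtain ⟨c, hc, hcw⟩ : ∃ c ∈ v.asIdeal, c ∉ w.asIdeal := by
      by_contra! h
      exact hw (HeightOneSpectrum.ext (v.isMaximal.eq_of_le w.isPrime.ne_top h)).symm
    refine norm_le_of_mul_mem_span (c := c ^ a) (fun h => hcw (w.isPrime.mem_of_pow_mem a h)) ?_
    rw [hIJ]
    exact Ideal.mul_mem_mul (Ideal.pow_mem_pow hc a) hα

/-- Strong approximation for the additive group, at one place: a global approximation a of y is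
multiplied by an integer close to 1 at v and small elsewhere. The level nm absorbs the denominator m
of a. -/
theorem exists_approx (y : v.adicCompletion F) {n : ℕ} (hn : n ≠ 0) : ∃ a : F,
    ‖y - algebraMap F (v.adicCompletion F) a‖ ≤ ‖(n : v.adicCompletion F)‖ ∧
    ∀ w : HeightOneSpectrum (𝓞 F), w ≠ v →
      ‖algebraMap F (w.adicCompletion F) a‖ ≤ ‖(n : w.adicCompletion F)‖ := by
  have := adicCompletion_isUltrametricDist v
  obtain ⟨a, ha⟩ := exists_norm_sub_algebraMap_lt v y
    (norm_pos_iff.2 (natCast_adicCompletion_ne_zero v hn))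
  obtain ⟨m, hm, c, hc⟩ := exists_natCast_mul_mem_integers a
  obtain ⟨α, hα, hαw⟩ := exists_integer_close_to_one v (mul_ne_zero hn hm)
  have key : ∀ w : HeightOneSpectrum (𝓞 F), ‖((n * m : ℕ) : w.adicCompletion F)‖ *
      ‖algebraMap F (w.adicCompletion F) a‖ ≤ ‖(n : w.adicCompletion F)‖ := fun w => by
    rw [Nat.cast_mul, norm_mul, mul_assoc, ← norm_mul,
      ← map_natCast (algebraMap F (w.adicCompletion F)) m, ← map_mul, hc]
    exact mul_le_of_le_one_right (norm_nonneg _) (norm_integer_le_one w c)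
  refine ⟨α * a, ?_, fun w hw => ?_⟩
  · have h : y - algebraMap F (v.adicCompletion F) (α * a) =
        (y - algebraMap F (v.adicCompletion F) a) +
          algebraMap F (v.adicCompletion F) (1 - α : 𝓞 F) * algebraMap F (v.adicCompletion F) a := by
      have h1 : ((1 - α : 𝓞 F) : F) = 1 - (α : F) := by simp
      rw [h1, map_sub, map_one, map_mul]
      ring
    rw [h]
    refine (IsUltrametricDist.norm_add_le_max _ _).trans (max_le ha.le ?_)
    rw [norm_mul]
    exact (mul_le_mul_of_nonneg_right hα (norm_nonneg _)).trans (key v)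
  · rw [map_mul, norm_mul]
    exact (mul_le_mul_of_nonneg_right (hαw w hw) (norm_nonneg _)).trans (key w)

end Approximation

/-! ### Counting points of integral lattices -/

section Counting

/-- Let H be the image of G in (ℤ/m²)^κ. Its order times its index is m^(2|κ|), so one of the two is
at most m^|κ|. If it is the index, reduce modulo H. If it is the order, send x to the character of H
given by pairing with x through B: points with the same character differ by an element of the dual
of G, which k carries into G. This replaces a determinant computation. -/
theorem exists_map_card_le_of_dual.{u} {κ : Type u} [Fintype κ] {m : ℕ} (hm : m ≠ 0) (B : κ → κ → ℤ) {k : ℕ}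
    (G : AddSubgroup (κ → ℤ)) (hG : ∀ z : κ → ℤ, ((m ^ 2 : ℕ) : ℤ) • z ∈ G)
    (hdual : ∀ x : κ → ℤ, (∀ g ∈ G, ((m ^ 2 : ℕ) : ℤ) ∣ ∑ j, (∑ i, x i * B i j) * g j) → k • x ∈ G) :
    ∃ (Q : Type u) (_ : Fintype Q) (π : (κ → ℤ) → Q), Fintype.card Q ≤ m ^ Fintype.card κ ∧
      ∀ x y, π x = π y → k • (x - y) ∈ G := by
  classical
  set q := m ^ 2 with hq
  have : NeZero q := ⟨pow_ne_zero 2 hm⟩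
  let r : (κ → ℤ) →+ (κ → ZMod q) := (Int.castAddHom (ZMod q)).compLeft κ
  have hr : ∀ z i, r z i = (z i : ZMod q) := fun z i => rfl
  let H : AddSubgroup (κ → ZMod q) := G.map r
  have hmem : ∀ z, r z ∈ H → z ∈ G := by
    rintro z ⟨g, hg, hgz⟩
    have h : ∀ i, (q : ℤ) ∣ z i - g i := fun i => by
      rw [← ZMod.intCast_zmod_eq_zero_iff_dvd, Int.cast_sub, sub_eq_zero]
      exact (congrFun hgz i).symm
    choose d hd using h
    have hz : z = (q : ℤ) • d + g := by
      funext i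
      simp [← hd i]
    rw [hz]
    exact add_mem (hG d) hg
  have hcard : Nat.card H * H.index = m ^ Fintype.card κ * m ^ Fintype.card κ := by
    rw [H.card_mul_index, Nat.card_eq_fintype_card, Fintype.card_fun, ZMod.card, hq, ← mul_pow,
      sq]
  rcases le_or_gt H.index (m ^ Fintype.card κ) with hle | hlt
  · refine ⟨(κ → ZMod q) ⧸ H, inferInstance, fun x => QuotientAddGroup.mk (r x), ?_, ?_⟩
    · rwa [← Nat.card_eq_fintype_card]
    · intro x y hxy
      refine nsmul_mem (hmem _ ?_) k
      rw [← neg_sub, neg_sub, sub_eq_neg_add, map_add, map_neg]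
      exact QuotientAddGroup.eq.1 hxy.symm
  · have hle : Nat.card H ≤ m ^ Fintype.card κ := by
      by_contra! h
      exact absurd hcard (Nat.mul_lt_mul'' h hlt).ne'
    let χ : (κ → ℤ) → AddChar H ℂ := fun x =>
      (ZMod.stdAddChar (N := q)).compAddMonoidHom
        { toFun := fun g => ∑ j, (∑ i, (x i : ZMod q) * (B i j : ZMod q)) * g.1 j
          map_zero' := by simp
          map_add' := fun g h => by simp [mul_add, Finset.sum_add_distrib] }
    refine ⟨AddChar H ℂ, Fintype.ofFinite _, χ, ?_, ?_⟩
    · refine le_trans ?_ hle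
      rw [← Nat.card_eq_fintype_card]
      simp [Nat.card_eq_fintype_card]
    · intro x y hxy
      refine hdual _ fun g hg => ?_
      have h := DFunLike.congr_fun hxy (⟨r g, g, hg, rfl⟩ : H)
      have h' := ZMod.injective_stdAddChar h
      simp only [AddMonoidHom.coe_mk, ZeroHom.coe_mk, hr] at h'
      rw [← ZMod.intCast_zmod_eq_zero_iff_dvd]
      push_cast
      rw [← sub_eq_zero] at h'
      rw [← h', ← Finset.sum_sub_distrib]
      refine Finset.sum_congr rfl fun j _ => ?_
      rw [← sub_mul, ← Finset.sum_sub_distrib]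
      simp [sub_mul]

variable {κ : Type*} [Fintype κ]

/-- Pigeonhole: a box of side mR has (mR)^|κ| points but they fall into at most m^|κ| classes, so
some class has at least R^|κ| of them. Subtracting one member of that class and multiplying by k
lands in G. -/
theorem exists_finset_of_dual {m : ℕ} (hm : m ≠ 0) (B : κ → κ → ℤ) {k : ℕ} (hk : k ≠ 0)
    (G : AddSubgroup (κ → ℤ)) (hG : ∀ z : κ → ℤ, ((m ^ 2 : ℕ) : ℤ) • z ∈ G)
    (hdual : ∀ x : κ → ℤ, (∀ g ∈ G, ((m ^ 2 : ℕ) : ℤ) ∣ ∑ j, (∑ i, x i * B i j) * g j) → k • x ∈ G)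
    {R : ℕ} (hR : R ≠ 0) :
    ∃ P : Finset (κ → ℤ), R ^ Fintype.card κ ≤ P.card ∧
      ∀ x ∈ P, x ∈ G ∧ ∀ i, |x i| ≤ (k * (m * R) : ℕ) := by
  classical
  obtain ⟨Q, _, π, hcard, hπ⟩ := exists_map_card_le_of_dual hm B G hG hdual
  let box : Finset (κ → ℤ) := Fintype.piFinset fun _ => Finset.Ico 0 ((m * R : ℕ) : ℤ)
  have hbox : box.card = m ^ Fintype.card κ * R ^ Fintype.card κ := by
    rw [Fintype.card_piFinset, Finset.prod_const, Finset.card_univ, Int.card_Ico, sub_zero,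
      Int.toNat_natCast, mul_pow]
  have hne : (Finset.univ : Finset Q).Nonempty := ⟨π 0, Finset.mem_univ _⟩
  obtain ⟨y, -, hy⟩ := Finset.exists_le_card_fiber_of_mul_le_card_of_maps_to
    (s := box) (t := Finset.univ) (f := π) (n := R ^ Fintype.card κ)
    (fun _ _ => Finset.mem_univ _) hne (by
      rw [hbox, Finset.card_univ]; exact Nat.mul_le_mul_right _ hcard)
  obtain ⟨z₀, hz₀⟩ : (box.filter fun x => π x = y).Nonempty :=
    Finset.card_pos.1 (lt_of_lt_of_le (by positivity) hy)
  rw [Finset.mem_filter] at hz₀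
  refine ⟨(box.filter fun x => π x = y).image fun z => k • (z - z₀), ?_, ?_⟩
  · rw [Finset.card_image_of_injective]
    · exact hy
    · intro a b hab
      have := smul_right_injective (κ → ℤ) hk hab
      exact sub_left_injective this
  · intro x hx
    obtain ⟨z, hz, rfl⟩ := Finset.mem_image.1 hx
    rw [Finset.mem_filter] at hz
    refine ⟨hπ _ _ (hz.2.trans hz₀.2.symm), fun i => ?_⟩
    have h1 := Finset.mem_Ico.1 (Fintype.mem_piFinset.1 hz.1 i)
    have h2 := Finset.mem_Ico.1 (Fintype.mem_piFinset.1 hz₀.1 i)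
    rw [Pi.smul_apply, Pi.sub_apply, nsmul_eq_mul, abs_mul, Nat.abs_cast, Nat.cast_mul k]
    refine mul_le_mul_of_nonneg_left ?_ (by positivity)
    rw [abs_le]
    constructor <;> omega

/-- Let i₀ be a coordinate where |c| is maximal. Two points of the hyperplane whose other
coordinates agree to within ε/N also agree to within ε at i₀, contrary to the gap. So rounding the
other N - 1 coordinates to multiples of ε/N is injective on P. -/
theorem card_le_of_hyperplane (P : Finset (κ → ℚ)) {A ε : ℚ} (hε : 0 < ε)
    (hA : ∀ x ∈ P, ∀ i, |x i| ≤ A) (hgap : ∀ x ∈ P, ∀ y ∈ P, x ≠ y → ∃ i, ε ≤ |x i - y i|)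
    {c : κ → ℚ} (hc : c ≠ 0) (hP : ∀ x ∈ P, ∑ i, c i * x i = 0) :
    P.card ≤ (2 * ⌈A * Fintype.card κ / ε⌉₊ + 1) ^ (Fintype.card κ - 1) := by
  classical
  set N := Fintype.card κ
  set t := ⌈A * N / ε⌉₊
  obtain ⟨j, hj⟩ := Function.ne_iff.1 hc
  obtain ⟨i₀, -, hi₀⟩ := Finset.exists_max_image Finset.univ (fun i => |c i|) ⟨j, Finset.mem_univ j⟩
  have hc₀ : 0 < |c i₀| := lt_of_lt_of_le (abs_pos.2 hj) (hi₀ j (Finset.mem_univ j))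
  have hN : (0 : ℚ) < N := Nat.cast_pos.2 (Fintype.card_pos_iff.2 ⟨j⟩)
  let φ : (κ → ℚ) → ({i // i ≠ i₀} → ℤ) := fun x i => ⌊x i.1 * N / ε⌋
  have hinj : Set.InjOn φ P := by
    intro x hx y hy hxy
    by_contra hne
    have hlt : ∀ i, i ≠ i₀ → |x i - y i| < ε / N := fun i hi => by
      have h := Int.abs_sub_lt_one_of_floor_eq_floor (congrFun hxy ⟨i, hi⟩)
      rw [← sub_div, ← sub_mul, abs_div, abs_mul, abs_of_pos hε, abs_of_pos hN,
        div_lt_one hε] at h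
      rwa [lt_div_iff₀ hN]
    have h0 : c i₀ * (x i₀ - y i₀) = - ∑ i ∈ Finset.univ.erase i₀, c i * (x i - y i) := by
      have h : ∑ i, c i * (x i - y i) = 0 := by
        simp only [mul_sub, Finset.sum_sub_distrib, hP x hx, hP y hy, sub_zero]
      rw [← Finset.add_sum_erase _ _ (Finset.mem_univ i₀)] at h
      exact eq_neg_of_add_eq_zero_left h
    have hsum : |c i₀| * |x i₀ - y i₀| ≤ |c i₀| * ((N - 1) * (ε / N)) := by
      rw [← abs_mul, h0, abs_neg]
      refine (Finset.abs_sum_le_sum_abs _ _).trans ?_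
      calc ∑ i ∈ Finset.univ.erase i₀, |c i * (x i - y i)|
          ≤ ∑ i ∈ Finset.univ.erase i₀, |c i₀| * (ε / N) := by
            refine Finset.sum_le_sum fun i hi => ?_
            rw [abs_mul]
            exact mul_le_mul (hi₀ i (Finset.mem_univ i)) (hlt i (Finset.ne_of_mem_erase hi)).le
              (abs_nonneg _) (abs_nonneg _)
        _ = |c i₀| * ((N - 1) * (ε / N)) := by
            rw [Finset.sum_const, Finset.card_erase_of_mem (Finset.mem_univ i₀), Finset.card_univ,
              nsmul_eq_mul, Nat.cast_sub (Fintype.card_pos_iff.2 ⟨j⟩), Nat.cast_one]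
            ring
    have hi₀' : |x i₀ - y i₀| < ε := by
      refine lt_of_le_of_lt (le_of_mul_le_mul_left hsum hc₀) ?_
      have h : (N : ℚ) * (ε / N) = ε := mul_div_cancel₀ _ hN.ne'
      have h' : 0 < ε / N := div_pos hε hN
      rw [sub_mul, h, one_mul]
      linarith
    obtain ⟨i, hi⟩ := hgap x hx y hy hne
    rcases eq_or_ne i i₀ with rfl | hne'
    · exact absurd hi (not_le.2 hi₀')
    · have h1 : (1 : ℚ) ≤ N := by exact_mod_cast Fintype.card_pos_iff.2 ⟨j⟩
      exact absurd (hi.trans_lt (hlt i hne')) (not_lt.2 (div_le_self hε.le h1))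
  calc P.card = (P.image φ).card := (Finset.card_image_of_injOn hinj).symm
    _ ≤ (Fintype.piFinset fun _ : {i // i ≠ i₀} => Finset.Icc (-(t : ℤ)) t).card := by
        refine Finset.card_le_card fun z hz => ?_
        obtain ⟨x, hx, rfl⟩ := Finset.mem_image.1 hz
        refine Fintype.mem_piFinset.2 fun i => ?_
        have h : |x i.1 * N / ε| ≤ t := by
          rw [abs_div, abs_mul, abs_of_pos hε, abs_of_pos hN]
          refine le_trans ?_ (Nat.le_ceil _)
          have := hA x hx i.1
          gcongr
        rw [abs_le] at h
        rw [Finset.mem_Icc]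
        constructor
        · rw [Int.le_floor]
          exact_mod_cast h.1
        · have := (Int.floor_le (x i.1 * N / ε)).trans h.2
          exact_mod_cast this
    _ = (2 * t + 1) ^ (N - 1) := by
        rw [Fintype.card_piFinset, Finset.prod_const, Finset.card_univ, Int.card_Icc]
        congr 1
        · omega
        · rw [Fintype.card_subtype_compl, Fintype.card_subtype_eq]

end Counting

/-! ### Duality for the trace forms -/

theorem exists_natCast_mul_norm_le_of_finite {F ι : Type*} [Field F] [NumberField F] [Finite ι]
    (a : ι → F) : ∃ n : ℕ, n ≠ 0 ∧ ∀ (v : HeightOneSpectrum (𝓞 F)) (i : ι),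
      ‖(n : v.adicCompletion F)‖ * ‖algebraMap F (v.adicCompletion F) (a i)‖ ≤ 1 := by
  classical
  cases nonempty_fintype ι
  choose n hn c hc using fun i => exists_natCast_mul_mem_integers (a i)
  refine ⟨∏ i, n i, Finset.prod_ne_zero_iff.2 fun i _ => hn i, fun v i => ?_⟩
  rw [← Finset.prod_erase_mul _ _ (Finset.mem_univ i), Nat.cast_mul, norm_mul, mul_assoc,
    ← norm_mul, ← map_natCast (algebraMap F (v.adicCompletion F)) (n i), ← map_mul, hc]
  exact mul_le_one₀ (norm_natCast_le_one v _) (norm_nonneg _) (norm_integer_le_one v _)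

/-- τ is the trace of the regular representation over F and b' the dual basis. The radical of the
trace form is a two-sided ideal; it does not contain 1, whose trace is the dimension, so simplicity
makes it zero. -/
theorem exists_dual_family {F D ι : Type*} [Field F] [CharZero F] [Ring D] [Algebra F D]
    [IsSimpleRing D] [Fintype ι] (b : Module.Basis ι F D) :
    ∃ (τ : D →ₗ[F] F) (b' : ι → D), ∀ d, ∑ j, τ (d * b j) • b' j = d := by
  classical
  have : Module.Finite F D := Module.Finite.of_basis b
  have : Module.Free F D := Module.Free.of_basis b
  let tr : D →ₗ[F] F := LinearMap.trace F D ∘ₗ (Algebra.lmul F D).toLinearMap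
  have htr : ∀ x, tr x = LinearMap.trace F D (Algebra.lmul F D x) := fun x => rfl
  have hcomm : ∀ x y : D, tr (x * y) = tr (y * x) := fun x y => by
    rw [htr, htr, map_mul (Algebra.lmul F D), map_mul (Algebra.lmul F D), LinearMap.trace_mul_comm]
  let B : LinearMap.BilinForm F D := (LinearMap.mul F D).compr₂ tr
  let I : TwoSidedIdeal D := TwoSidedIdeal.mk' {x | ∀ y, tr (x * y) = 0}
    (fun y => by simp) (fun hx hy z => by simp [add_mul, hx z, hy z])
    (fun hx z => by simpa using hx z)
    (fun {x y} hy z => by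
      change tr (x * y * z) = 0
      rw [mul_assoc, hcomm, mul_assoc]; exact hy _)
    (fun {x y} hx z => by
      change tr (x * y * z) = 0
      rw [mul_assoc]; exact hx _)
  have hI : ∀ x, x ∈ I ↔ ∀ y, tr (x * y) = 0 := fun x => by
    simp [I, TwoSidedIdeal.mem_mk']
  have hbot : I = ⊥ := by
    refine (eq_bot_or_eq_top I).resolve_right fun h => ?_
    have h1 : (1 : D) ∈ I := h ▸ trivial
    have h2 := (hI 1).1 h1 1
    rw [mul_one, htr, map_one, LinearMap.trace_one] at h2
    exact Module.finrank_pos.ne' (Nat.cast_eq_zero.1 h2)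
  have hzero : ∀ x, (∀ y, tr (x * y) = 0) → x = 0 := fun x hx => by
    have : x ∈ I := (hI x).2 hx
    rw [hbot] at this
    exact (TwoSidedIdeal.mem_bot D).1 this
  have hnd : B.Nondegenerate :=
    ⟨fun x hx => hzero x hx, fun x hx => hzero x fun y => by rw [hcomm]; exact hx y⟩
  refine ⟨tr, B.dualBasis hnd b, fun d => ?_⟩
  conv_rhs => rw [← (B.dualBasis hnd b).sum_repr d]
  refine Finset.sum_congr rfl fun j _ => ?_
  rw [LinearMap.BilinForm.dualBasis_repr_apply]
  rfl

/-- The inverse different has bounded denominators: k clears those of the basis dual to an integral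
basis. -/
theorem exists_natCast_mul_mem_integers_of_trace (F : Type*) [Field F] [NumberField F] :
    ∃ k : ℕ, k ≠ 0 ∧ ∀ z : F, (∀ a : 𝓞 F, ∃ n : ℤ, Algebra.trace ℚ F (a * z) = n) →
      ∃ c : 𝓞 F, (k : F) * z = c := by
  classical
  obtain ⟨τ, θ', hθ⟩ : ∃ (τ : F →ₗ[ℚ] ℚ) (θ' : Module.Free.ChooseBasisIndex ℤ (𝓞 F) → F),
      τ = Algebra.trace ℚ F ∧ ∀ z, ∑ j, τ (z * integralBasis F j) • θ' j = z := by
    refine ⟨Algebra.trace ℚ F, (Algebra.traceForm ℚ F).dualBasis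
      (traceForm_nondegenerate ℚ F) (integralBasis F), rfl, fun d => ?_⟩
    conv_rhs => rw [← ((Algebra.traceForm ℚ F).dualBasis
      (traceForm_nondegenerate ℚ F) (integralBasis F)).sum_repr d]
    refine Finset.sum_congr rfl fun j _ => ?_
    rw [LinearMap.BilinForm.dualBasis_repr_apply, Algebra.traceForm_apply]
  obtain ⟨rfl, hθ⟩ := hθ
  choose n hn c hc using fun j => exists_natCast_mul_mem_integers (θ' j)
  refine ⟨∏ j, n j, Finset.prod_ne_zero_iff.2 fun j _ => hn j, fun z hz => ?_⟩
  choose t ht using fun j => hz (RingOfIntegers.basis F j)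
  refine ⟨∑ j, (t j : 𝓞 F) * ((∏ i ∈ Finset.univ.erase j, n i : ℕ) * c j), ?_⟩
  conv_lhs => rw [← hθ z, Finset.mul_sum]
  push_cast
  refine Finset.sum_congr rfl fun j _ => ?_
  have h : Algebra.trace ℚ F (z * integralBasis F j) = t j := by
    rw [mul_comm, integralBasis_apply]
    exact ht j
  have h' : (n j : F) * θ' j = algebraMap (𝓞 F) F (c j) := hc j
  have h'' : algebraMap (𝓞 F) F (t j : 𝓞 F) = t j := map_intCast _ _
  rw [h, ← Finset.prod_erase_mul _ _ (Finset.mem_univ j), Rat.smul_def]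
  push_cast
  linear_combination ((∏ i ∈ Finset.univ.erase j, (n i : F)) * t j) * h' -
    ((∏ i ∈ Finset.univ.erase j, (n i : F)) * algebraMap (𝓞 F) F (c j)) * h''

/-! ### Bounded families and the lattices attached to them -/

section Lattice

variable {F K D ι : Type*} [Field F] [NumberField F] [Field K] [Algebra F K] [Ring D] [Algebra F D]
  [Algebra K D] {s : InvolutionSecondKind F K D} [Fintype ι] {b : Module.Basis ι F D}

variable (b) in
/-- A family of elements of the `F_v ⊗ D` whose coordinates have a common denominator. -/
def IsBoundedFamily (x : ∀ v : HeightOneSpectrum (𝓞 F), v.adicCompletion F ⊗[F] D) : Prop :=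
  ∃ m : ℕ, m ≠ 0 ∧ ∀ v, ‖(m : v.adicCompletion F)‖ * locNorm b v (x v) ≤ 1

theorem isBoundedFamily_tmul (d : D) : IsBoundedFamily b fun _ => 1 ⊗ₜ d :=
  exists_natCast_mul_locNorm_le b d

theorem IsBoundedFamily.mul {x y : ∀ v : HeightOneSpectrum (𝓞 F), v.adicCompletion F ⊗[F] D}
    (hx : IsBoundedFamily b x) (hy : IsBoundedFamily b y) :
    IsBoundedFamily b fun v => x v * y v := by
  obtain ⟨m, hm, hx⟩ := hx
  obtain ⟨n, hn, hy⟩ := hy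
  obtain ⟨κ, hκ, h⟩ := exists_locNorm_mul_le b
  refine ⟨m * n * κ, mul_ne_zero (mul_ne_zero hm hn) hκ, fun v => ?_⟩
  rw [Nat.cast_mul, Nat.cast_mul, norm_mul, norm_mul, mul_assoc]
  calc _ ≤ ‖(m : v.adicCompletion F)‖ * ‖(n : v.adicCompletion F)‖ *
        (locNorm b v (x v) * locNorm b v (y v)) :=
        mul_le_mul_of_nonneg_left (h v _ _) (by positivity)
    _ = (‖(m : v.adicCompletion F)‖ * locNorm b v (x v)) *
        (‖(n : v.adicCompletion F)‖ * locNorm b v (y v)) := by ring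
    _ ≤ 1 := mul_le_one₀ (hx v) (mul_nonneg (norm_nonneg _) (locNorm_nonneg b v _)) (hy v)

theorem IsBoundedFamily.star {x : ∀ v : HeightOneSpectrum (𝓞 F), v.adicCompletion F ⊗[F] D}
    (hx : IsBoundedFamily b x) : IsBoundedFamily b fun v => starBase s _ (x v) := by
  obtain ⟨m, hm, hx⟩ := hx
  obtain ⟨κ, hκ, h⟩ := exists_locNorm_starBase_le s b
  refine ⟨m * κ, mul_ne_zero hm hκ, fun v => ?_⟩
  rw [Nat.cast_mul, norm_mul, mul_assoc]
  exact (mul_le_mul_of_nonneg_left (h v _) (norm_nonneg _)).trans (hx v)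

variable (b) in
/-- The elements of `D` that are integral at every place with respect to the translate by `γ` of the
standard lattice. -/
def latticeOf (γ : ∀ v : HeightOneSpectrum (𝓞 F), U s (v.adicCompletion F)) : AddSubgroup D where
  carrier := {x | ∀ v, locNorm b v (starBase s _ ((γ v : (v.adicCompletion F ⊗[F] D)ˣ) :
    v.adicCompletion F ⊗[F] D) * (1 ⊗ₜ x)) ≤ 1}
  zero_mem' v := by simp [locNorm_zero]
  add_mem' hx hy v := by
    rw [TensorProduct.tmul_add, mul_add]
    exact (locNorm_add_le b v _ _).trans (max_le (hx v) (hy v))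
  neg_mem' hx v := by
    rw [TensorProduct.tmul_neg, mul_neg, locNorm_neg]
    exact hx v

theorem one_tmul_smul (v : HeightOneSpectrum (𝓞 F)) (a : F) (x : D) :
    (1 : v.adicCompletion F) ⊗ₜ[F] (a • x) =
      algebraMap F (v.adicCompletion F) a • ((1 : v.adicCompletion F) ⊗ₜ[F] x) := by
  rw [TensorProduct.smul_tmul', smul_eq_mul, mul_one, ← TensorProduct.smul_tmul,
    Algebra.smul_def, mul_one]

theorem locNorm_one_tmul_smul (v : HeightOneSpectrum (𝓞 F)) (a : F) (x : D) :
    locNorm b v (1 ⊗ₜ (a • x)) =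
      ‖algebraMap F (v.adicCompletion F) a‖ * locNorm b v (1 ⊗ₜ x) := by
  rw [one_tmul_smul, locNorm_smul]

variable {γ : ∀ v : HeightOneSpectrum (𝓞 F), U s (v.adicCompletion F)}

theorem integer_smul_mem_latticeOf (a : 𝓞 F) {x : D} (hx : x ∈ latticeOf b γ) :
    (a : F) • x ∈ latticeOf b γ := fun v => by
  rw [one_tmul_smul, mul_smul_comm, locNorm_smul]
  exact mul_le_one₀ (norm_integer_le_one v a) (locNorm_nonneg b v _) (hx v)

/-- A bounded translate of the standard lattice is sandwiched between its m-th multiple and its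
m⁻¹-th multiple. The factors of m account for γ, for γ⋆ = γ⁻¹ and for multiplication in D. The first
inclusion is stated place by place, for use with approximation. -/
theorem exists_natCast_smul_mem_latticeOf
    (hγ : IsBoundedFamily b fun v => ((γ v : (v.adicCompletion F ⊗[F] D)ˣ) :
      v.adicCompletion F ⊗[F] D)) :
    ∃ m : ℕ, m ≠ 0 ∧
      (∀ (v : HeightOneSpectrum (𝓞 F)) (y : v.adicCompletion F ⊗[F] D),
        locNorm b v y ≤ ‖(m : v.adicCompletion F)‖ →
        locNorm b v (starBase s _ ((γ v : (v.adicCompletion F ⊗[F] D)ˣ) :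
          v.adicCompletion F ⊗[F] D) * y) ≤ 1) ∧
      ∀ x ∈ latticeOf b γ, ∀ v, locNorm b v (1 ⊗ₜ[F] ((m : F) • x)) ≤ 1 := by
  obtain ⟨m₁, hm₁, h₁⟩ := hγ
  obtain ⟨m₂, hm₂, h₂⟩ := IsBoundedFamily.star (s := s) ⟨m₁, hm₁, h₁⟩
  obtain ⟨κ, hκ, h⟩ := exists_locNorm_mul_le b
  refine ⟨m₁ * m₂ * κ, mul_ne_zero (mul_ne_zero hm₁ hm₂) hκ, fun v y hy => ?_, fun x hx v => ?_⟩
  · have hpos : 0 < ‖(κ : v.adicCompletion F)‖ :=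
      norm_pos_iff.2 (natCast_adicCompletion_ne_zero v hκ)
    refine le_of_mul_le_mul_left ?_ hpos
    rw [mul_one]
    refine (h v _ _).trans ((mul_le_mul_of_nonneg_left hy (locNorm_nonneg b v _)).trans ?_)
    rw [Nat.cast_mul, Nat.cast_mul, norm_mul, norm_mul]
    calc _ = ‖(κ : v.adicCompletion F)‖ * (‖(m₁ : v.adicCompletion F)‖ *
          (‖(m₂ : v.adicCompletion F)‖ * locNorm b v (starBase s _
            ((γ v : (v.adicCompletion F ⊗[F] D)ˣ) : v.adicCompletion F ⊗[F] D)))) := by ring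
      _ ≤ ‖(κ : v.adicCompletion F)‖ * 1 := by
          refine mul_le_mul_of_nonneg_left ?_ hpos.le
          exact mul_le_one₀ (norm_natCast_le_one v _)
            (mul_nonneg (norm_nonneg _) (locNorm_nonneg b v _)) (h₂ v)
      _ = _ := mul_one _
  · have hx' : (1 : v.adicCompletion F) ⊗ₜ[F] x = ((γ v : (v.adicCompletion F ⊗[F] D)ˣ) :
        v.adicCompletion F ⊗[F] D) * (starBase s _ ((γ v : (v.adicCompletion F ⊗[F] D)ˣ) :
          v.adicCompletion F ⊗[F] D) * (1 ⊗ₜ[F] x)) := by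
      have hg : ((γ v : (v.adicCompletion F ⊗[F] D)ˣ) : v.adicCompletion F ⊗[F] D) *
        starBase s _ ((γ v : (v.adicCompletion F ⊗[F] D)ˣ) : v.adicCompletion F ⊗[F] D) = 1 :=
        (γ v).2
      rw [← mul_assoc, hg, one_mul]
    rw [locNorm_one_tmul_smul, map_natCast, hx', Nat.cast_mul, Nat.cast_mul, norm_mul, norm_mul,
      mul_assoc]
    refine (mul_le_mul_of_nonneg_left (h v _ _) (by positivity)).trans ?_
    have h3 := hx v
    calc _ ≤ ‖(m₁ : v.adicCompletion F)‖ * 1 * (locNorm b v ((γ v : (v.adicCompletion F ⊗[F] D)ˣ) :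
          v.adicCompletion F ⊗[F] D) * 1) := by
          have h4 := locNorm_nonneg b v ((γ v : (v.adicCompletion F ⊗[F] D)ˣ) :
            v.adicCompletion F ⊗[F] D)
          have := norm_natCast_le_one v m₂
          gcongr
          exact mul_nonneg h4 (locNorm_nonneg b v _)
      _ ≤ 1 := by rw [mul_one, mul_one]; exact h₁ v

/-- As gg⋆ = 1, the form x⋆y is unchanged when both arguments are multiplied by g⋆. All bounds that
are uniform in γ rest on this. -/
theorem starBase_mul_eq (x y : D) (v : HeightOneSpectrum (𝓞 F)) (g : U s (v.adicCompletion F)) :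
    (1 : v.adicCompletion F) ⊗ₜ[F] (s.toLinearMap x * y) =
      starBase s _ (starBase s _ ((g : (v.adicCompletion F ⊗[F] D)ˣ) :
        v.adicCompletion F ⊗[F] D) * (1 ⊗ₜ x)) *
      (starBase s _ ((g : (v.adicCompletion F ⊗[F] D)ˣ) :
        v.adicCompletion F ⊗[F] D) * (1 ⊗ₜ y)) := by
  have hg : ((g : (v.adicCompletion F ⊗[F] D)ˣ) : v.adicCompletion F ⊗[F] D) *
    starBase s _ ((g : (v.adicCompletion F ⊗[F] D)ˣ) : v.adicCompletion F ⊗[F] D) = 1 := g.2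
  rw [starBase_mul, starBase_starBase, starBase_tmul, mul_assoc, ← mul_assoc _ _ (1 ⊗ₜ[F] y), hg,
    one_mul, Algebra.TensorProduct.tmul_mul_tmul, one_mul]

variable (s b) in
-- At each place the form may be computed on the integral elements γ⋆x and γ⋆y, so κ involves only
-- the structure constants of the product and of the involution, and not γ.
theorem exists_natCast_smul_star_mul_integral : ∃ κ : ℕ, κ ≠ 0 ∧
    ∀ (γ : ∀ v : HeightOneSpectrum (𝓞 F), U s (v.adicCompletion F)),
      ∀ x ∈ latticeOf b γ, ∀ y ∈ latticeOf b γ, ∀ v,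
        locNorm b v (1 ⊗ₜ[F] ((κ : F) • (s.toLinearMap x * y))) ≤ 1 := by
  obtain ⟨κ₁, hκ₁, h₁⟩ := exists_locNorm_mul_le b
  obtain ⟨κ₂, hκ₂, h₂⟩ := exists_locNorm_starBase_le s b
  refine ⟨κ₂ * κ₁, mul_ne_zero hκ₂ hκ₁, fun γ x hx y hy v => ?_⟩
  rw [locNorm_one_tmul_smul, map_natCast, starBase_mul_eq x y v (γ v), Nat.cast_mul, norm_mul,
    mul_assoc]
  refine (mul_le_mul_of_nonneg_left (h₁ v _ _) (norm_nonneg _)).trans ?_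
  rw [← mul_assoc]
  exact mul_le_one₀ ((h₂ v _).trans (hx v)) (locNorm_nonneg b v _) (hy v)

/-- Strong approximation in each coordinate: Λ_γ is dense in its local completion at v. At level nm,
γ⋆ times the error is still integral at v, and the approximating vector satisfies the lattice
condition at the other places. -/
theorem exists_mem_latticeOf_close
    (hγ : IsBoundedFamily b fun v => ((γ v : (v.adicCompletion F ⊗[F] D)ˣ) :
      v.adicCompletion F ⊗[F] D))
    (v : HeightOneSpectrum (𝓞 F)) {z : v.adicCompletion F ⊗[F] D} (hz : locNorm b v z ≤ 1)
    {n : ℕ} (hn : n ≠ 0) : ∃ x ∈ latticeOf b γ,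
      locNorm b v (((γ v : (v.adicCompletion F ⊗[F] D)ˣ) : v.adicCompletion F ⊗[F] D) * z -
        1 ⊗ₜ x) ≤ ‖(n : v.adicCompletion F)‖ := by
  obtain ⟨m, hm, h, -⟩ := exists_natCast_smul_mem_latticeOf hγ
  set y := ((γ v : (v.adicCompletion F ⊗[F] D)ˣ) : v.adicCompletion F ⊗[F] D) * z with hy
  choose a ha haw using fun i => exists_approx v (coords b _ y i) (mul_ne_zero hn hm)
  have hco : ∀ (w : HeightOneSpectrum (𝓞 F)) i,
      coords b (w.adicCompletion F) (1 ⊗ₜ[F] ∑ j, a j • b j) i = algebraMap F _ (a i) := by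
    intro w i
    rw [coords_tmul, one_mul, Module.Basis.repr_sum_self]
  have hle : ∀ w : HeightOneSpectrum (𝓞 F), ‖((n * m : ℕ) : w.adicCompletion F)‖ ≤
      ‖(m : w.adicCompletion F)‖ := fun w => by
    rw [Nat.cast_mul, norm_mul]
    exact mul_le_of_le_one_left (norm_nonneg _) (norm_natCast_le_one w n)
  have hclose : locNorm b v (y - 1 ⊗ₜ[F] ∑ j, a j • b j) ≤ ‖((n * m : ℕ) : v.adicCompletion F)‖ := by
    rw [locNorm_le_iff b v (norm_nonneg _)]
    intro i
    rw [map_sub, Pi.sub_apply, hco]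
    exact ha i
  refine ⟨∑ j, a j • b j, fun w => ?_, hclose.trans ?_⟩
  · rcases eq_or_ne w v with rfl | hw
    · have h1 : starBase s _ ((γ w : (w.adicCompletion F ⊗[F] D)ˣ) : w.adicCompletion F ⊗[F] D) *
          (1 ⊗ₜ[F] ∑ j, a j • b j) = z - starBase s _ ((γ w : (w.adicCompletion F ⊗[F] D)ˣ) :
          w.adicCompletion F ⊗[F] D) * (y - 1 ⊗ₜ[F] ∑ j, a j • b j) := by
        rw [mul_sub, hy, ← mul_assoc, starBase_mul_self, one_mul, sub_sub_cancel]
      rw [h1]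
      exact (locNorm_sub_le b w _ _).trans (max_le hz (h w _ (hclose.trans (hle w))))
    · refine h w _ (((locNorm_le_iff b w (norm_nonneg _)).2 fun i => ?_).trans (hle w))
      rw [hco]
      exact haw i w hw
  · rw [Nat.cast_mul, norm_mul]
    exact mul_le_of_le_one_right (norm_nonneg _) (norm_natCast_le_one v m)

variable (s) in
-- Self-duality of Λ_γ up to a factor independent of γ. Since Λ_γ is an 𝓞 F-module, integral traces
-- make k₁c·τ(x⋆y) integral; by local density the same bound holds against γz for every integral z
-- at v. Testing z = b j and expanding in the dual family bounds (γ⋆x)⋆, hence γ⋆x.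
theorem exists_natCast_smul_mem_of_trace {τ : D →ₗ[F] F} {b' : ι → D}
    (hτ : ∀ d, ∑ j, τ (d * b j) • b' j = d) {c : ℕ} (hc : c ≠ 0) : ∃ k : ℕ, k ≠ 0 ∧
      ∀ γ : ∀ v : HeightOneSpectrum (𝓞 F), U s (v.adicCompletion F),
        (IsBoundedFamily b fun v => ((γ v : (v.adicCompletion F ⊗[F] D)ˣ) :
          v.adicCompletion F ⊗[F] D)) →
        ∀ x : D, (∀ y ∈ latticeOf b γ, ∃ n : ℤ,
          (c : ℚ) * Algebra.trace ℚ F (τ (s.toLinearMap x * y)) = n) →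
        (k : F) • x ∈ latticeOf b γ := by
  obtain ⟨k₁, hk₁, h₁⟩ := exists_natCast_mul_mem_integers_of_trace F
  obtain ⟨k₂, hk₂, h₂⟩ := exists_natCast_mul_locNorm_le_of_finite b b'
  obtain ⟨k₃, hk₃, h₃⟩ := exists_locNorm_starBase_le s b
  refine ⟨k₁ * c * k₂ * k₃, by positivity, fun γ hγ x hx v => ?_⟩
  have := adicCompletion_isUltrametricDist v
  let τv : v.adicCompletion F ⊗[F] D →ₗ[v.adicCompletion F] v.adicCompletion F :=
    (TensorProduct.AlgebraTensorModule.rid F (v.adicCompletion F) (v.adicCompletion F)).toLinearMap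
      ∘ₗ τ.baseChange (v.adicCompletion F)
  have hτv : ∀ r d, τv (r ⊗ₜ d) = r * algebraMap F _ (τ d) := fun r d => by
    rw [mul_comm, ← Algebra.smul_def]; rfl
  have hdual : ∀ u : v.adicCompletion F ⊗[F] D,
      ∑ j, τv (u * (1 ⊗ₜ b j)) • ((1 : v.adicCompletion F) ⊗ₜ[F] b' j) = u := by
    intro u
    induction u using TensorProduct.induction_on with
    | zero => simp
    | add x y hx hy => simp only [add_mul, map_add, add_smul, Finset.sum_add_distrib, hx, hy]
    | tmul r d =>
      conv_rhs => rw [← hτ d, TensorProduct.tmul_sum]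
      refine Finset.sum_congr rfl fun j _ => ?_
      rw [Algebra.TensorProduct.tmul_mul_tmul, hτv, mul_one, TensorProduct.smul_tmul',
        smul_eq_mul, mul_one, mul_comm, ← Algebra.smul_def, TensorProduct.smul_tmul]
  set g := ((γ v : (v.adicCompletion F ⊗[F] D)ˣ) : v.adicCompletion F ⊗[F] D) with hg
  set w := starBase s _ g * ((1 : v.adicCompletion F) ⊗ₜ[F] x) with hw
  have hbound : ∀ z, locNorm b v z ≤ 1 →
      ‖((k₁ * c : ℕ) : v.adicCompletion F)‖ * ‖τv (starBase s _ w * z)‖ ≤ 1 := by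
    intro z hz
    -- The precision n depends on x, which is harmless: it serves only to make the error term
    -- integral and does not enter k.
    obtain ⟨n, hn, h⟩ := exists_natCast_mul_norm_le_of_finite
      fun i => τ (s.toLinearMap x * b i)
    obtain ⟨y, hy, hyz⟩ := exists_mem_latticeOf_close hγ v hz hn
    have h5 : starBase s _ w * z = (1 ⊗ₜ[F] (s.toLinearMap x * y)) +
        (1 ⊗ₜ[F] s.toLinearMap x) * (g * z - 1 ⊗ₜ y) := by
      rw [hw, starBase_mul, starBase_starBase, starBase_tmul, mul_sub, mul_assoc,
        Algebra.TensorProduct.tmul_mul_tmul, one_mul, add_sub_cancel]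
    rw [h5, ← norm_mul, map_add, mul_add]
    refine (IsUltrametricDist.norm_add_le_max _ _).trans (max_le ?_ ?_)
    · obtain ⟨d, hd⟩ := h₁ ((c : F) * τ (s.toLinearMap x * y)) fun a => by
        obtain ⟨N, hN⟩ := hx _ (integer_smul_mem_latticeOf a hy)
        refine ⟨N, ?_⟩
        rw [← hN, mul_smul_comm, map_smul, smul_eq_mul, mul_left_comm, ← nsmul_eq_mul, map_nsmul,
          nsmul_eq_mul]
      rw [hτv, one_mul, ← map_natCast (algebraMap F (v.adicCompletion F)), ← map_mul, Nat.cast_mul,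
        mul_assoc, hd]
      exact norm_integer_le_one v d
    · rw [norm_mul]
      refine mul_le_one₀ (norm_natCast_le_one v _) (norm_nonneg _) ?_
      conv_lhs => rw [← sum_coords_smul b (g * z - 1 ⊗ₜ y), Finset.mul_sum, map_sum]
      refine IsUltrametricDist.norm_sum_le_of_forall_le_of_nonneg zero_le_one fun i _ => ?_
      rw [mul_smul_comm, map_smul, Algebra.TensorProduct.tmul_mul_tmul, hτv, one_mul, one_mul,
        smul_eq_mul, norm_mul]
      exact (mul_le_mul_of_nonneg_right ((norm_coords_le b v _ i).trans hyz)
        (norm_nonneg _)).trans (h v i)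
  have hu : ‖((k₁ * c * k₂ : ℕ) : v.adicCompletion F)‖ * locNorm b v (starBase s _ w) ≤ 1 := by
    rw [← locNorm_smul, ← hdual (starBase s _ w), Finset.smul_sum]
    refine locNorm_sum_le b v _ _ zero_le_one fun j _ => ?_
    rw [locNorm_smul, locNorm_smul, Nat.cast_mul, norm_mul]
    have hbj : locNorm b v (1 ⊗ₜ b j) ≤ 1 := by
      rw [locNorm_le_iff b v zero_le_one]
      intro i
      rw [coords_tmul, one_mul, Module.Basis.repr_self]
      rcases eq_or_ne j i with rfl | hij
      · simp
      · simp [Finsupp.single_eq_of_ne hij.symm]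
    calc _ = (‖((k₁ * c : ℕ) : v.adicCompletion F)‖ * ‖τv (starBase s _ w * (1 ⊗ₜ b j))‖) *
          (‖(k₂ : v.adicCompletion F)‖ * locNorm b v (1 ⊗ₜ b' j)) := by ring
      _ ≤ 1 := mul_le_one₀ (hbound _ hbj)
        (mul_nonneg (norm_nonneg _) (locNorm_nonneg b v _)) (h₂ v j)
  rw [one_tmul_smul, mul_smul_comm, locNorm_smul, map_natCast, Nat.cast_mul _ k₃, norm_mul,
    mul_assoc]
  refine (mul_le_mul_of_nonneg_left ?_ (norm_nonneg _)).trans hu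
  have h6 := h₃ v (starBase s _ w)
  rwa [starBase_starBase] at h6

end Lattice

/-! ### Rational coordinates -/

section RatCoords

variable {F D ι : Type*} [Field F] [NumberField F] [Ring D] [Algebra F D] (b : Module.Basis ι F D)

/-- The index set of the basis of `D` over `ℚ` attached to a basis of `D` over `F`. -/
abbrev RatIndex (F ι : Type*) [Field F] [NumberField F] : Type _ :=
  ι × Module.Free.ChooseBasisIndex ℤ (𝓞 F)

/-- The basis of `D` over `ℚ` attached to a basis of `D` over `F`. -/
noncomputable def ratBasis (l : RatIndex F ι) : D := integralBasis F l.2 • b l.1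

/-- The coordinates with respect to `ratBasis`. -/
noncomputable def ratCoords : D →+ (RatIndex F ι → ℚ) where
  toFun x l := (integralBasis F).repr (b.repr x l.1) l.2
  map_zero' := by funext l; simp
  map_add' x y := by funext l; simp

theorem ratCoords_apply (x : D) (l : RatIndex F ι) :
    ratCoords b x l = (integralBasis F).repr (b.repr x l.1) l.2 := rfl

theorem ratCoords_smul (q : ℚ) (x : D) : ratCoords b ((q : F) • x) = q • ratCoords b x := by
  funext l
  rw [ratCoords_apply, map_smul, Finsupp.smul_apply, smul_eq_mul, ← Rat.smul_def, map_smul]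
  rfl

theorem ratCoords_natCast_smul (n : ℕ) (x : D) :
    ratCoords b ((n : F) • x) = (n : ℚ) • ratCoords b x := by
  rw [← ratCoords_smul, Rat.cast_natCast]

variable [Fintype ι]

theorem sum_ratCoords (x : D) : ∑ l, (ratCoords b x l : F) • ratBasis b l = x := by
  rw [Fintype.sum_prod_type]
  conv_rhs => rw [← b.sum_repr x]
  refine Finset.sum_congr rfl fun i _ => ?_
  conv_rhs => rw [← (integralBasis F).sum_repr (b.repr x i), Finset.sum_smul]
  refine Finset.sum_congr rfl fun k _ => ?_
  rw [ratBasis, smul_smul, Rat.smul_def]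
  rfl

theorem ratCoords_sum (q : RatIndex F ι → ℚ) :
    ratCoords b (∑ l, (q l : F) • ratBasis b l) = q := by
  classical
  have h : ∀ l, ratCoords b (ratBasis b l) = Pi.single l 1 := fun l => by
    funext l'
    rw [ratCoords_apply, ratBasis, map_smul, Module.Basis.repr_self, Finsupp.smul_apply,
      smul_eq_mul]
    by_cases h1 : l.1 = l'.1
    · rw [h1, Finsupp.single_eq_same, mul_one, Module.Basis.repr_self]
      by_cases h2 : l.2 = l'.2
      · rw [h2, Finsupp.single_eq_same, Prod.ext h1 h2, Pi.single_eq_same]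
      · rw [Finsupp.single_eq_of_ne (Ne.symm h2), Pi.single_eq_of_ne]
        rintro rfl
        exact h2 rfl
    · rw [Finsupp.single_eq_of_ne (Ne.symm h1), mul_zero, map_zero, Finsupp.zero_apply,
        Pi.single_eq_of_ne]
      rintro rfl
      exact h1 rfl
  rw [map_sum]
  simp only [ratCoords_smul, h]
  funext l
  simp [Finset.sum_apply, Pi.single_apply]

theorem ratCoords_injective : Function.Injective (ratCoords b) := fun x y h => by
  rw [← sum_ratCoords b x, h, sum_ratCoords]

theorem locNorm_le_one_of_ratCoords {x : D} (h : ∀ l, ∃ z : ℤ, ratCoords b x l = z)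
    (v : HeightOneSpectrum (𝓞 F)) : locNorm b v (1 ⊗ₜ x) ≤ 1 := by
  choose z hz using h
  rw [locNorm_le_iff b v zero_le_one]
  intro i
  rw [coords_tmul, one_mul]
  have h1 : b.repr x i = algebraMap (𝓞 F) F
      (∑ k, (z (i, k) : 𝓞 F) * RingOfIntegers.basis F k) := by
    conv_lhs => rw [← (integralBasis F).sum_repr (b.repr x i)]
    rw [map_sum]
    refine Finset.sum_congr rfl fun k _ => ?_
    have h2 : (integralBasis F).repr (b.repr x i) k = z (i, k) := hz (i, k)
    rw [h2, map_mul, integralBasis_apply, Rat.smul_def, map_intCast, Rat.cast_intCast]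
  rw [h1]
  exact norm_integer_le_one v _

theorem exists_ratCoords_eq_intCast {x : D}
    (h : ∀ v : HeightOneSpectrum (𝓞 F), locNorm b v (1 ⊗ₜ x) ≤ 1) (l : RatIndex F ι) :
    ∃ z : ℤ, ratCoords b x l = z := by
  obtain ⟨c, hc⟩ := mem_integers_of_forall_norm_le_one (a := b.repr x l.1) fun v => by
    have := norm_coords_le b v (1 ⊗ₜ x) l.1
    rw [coords_tmul, one_mul] at this
    exact this.trans (h v)
  refine ⟨(RingOfIntegers.basis F).repr c l.2, ?_⟩
  rw [ratCoords_apply, hc]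
  exact integralBasis_repr_apply F c l.2

/-- Bilinear maps are bounded in rational coordinates. -/
theorem exists_ratCoords_mul_le {K : Type*} [Field K] [Algebra F K] [Algebra K D]
    (s : InvolutionSecondKind F K D) :
    ∃ C : ℕ, ∀ (x y : D) (r t : ℚ), (∀ l, |ratCoords b x l| ≤ r) → (∀ l, |ratCoords b y l| ≤ t) →
      ∀ l, |ratCoords b (s.toLinearMap x * y) l| ≤ C * (r * t) := by
  obtain ⟨C, hC⟩ : ∃ C : ℕ, ∀ l, ∑ i, ∑ j,
      |ratCoords b (s.toLinearMap (ratBasis b i) * ratBasis b j) l| ≤ (C : ℚ) := by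
    obtain ⟨C, hC⟩ := exists_nat_ge (∑ l, ∑ i, ∑ j,
      |ratCoords b (s.toLinearMap (ratBasis b i) * ratBasis b j) l|)
    refine ⟨C, fun l => le_trans ?_ hC⟩
    exact Finset.single_le_sum (f := fun l => ∑ i, ∑ j,
      |ratCoords b (s.toLinearMap (ratBasis b i) * ratBasis b j) l|)
      (fun l _ => by positivity) (Finset.mem_univ l)
  refine ⟨C, fun x y r t hx hy l => ?_⟩
  have hxy : s.toLinearMap x * y = ∑ i, ∑ j, ((ratCoords b x i * ratCoords b y j : ℚ) : F) •
      (s.toLinearMap (ratBasis b i) * ratBasis b j) := by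
    conv_lhs => rw [← sum_ratCoords b x, ← sum_ratCoords b y, map_sum, Finset.sum_mul_sum]
    refine Finset.sum_congr rfl fun i _ => Finset.sum_congr rfl fun j _ => ?_
    rw [map_smul, smul_mul_smul_comm, Rat.cast_mul]
  have hr : 0 ≤ r := (abs_nonneg _).trans (hx l)
  have ht : 0 ≤ t := (abs_nonneg _).trans (hy l)
  rw [hxy, map_sum, Finset.sum_apply]
  refine (Finset.abs_sum_le_sum_abs _ _).trans ?_
  refine le_trans ?_ (mul_le_mul_of_nonneg_right (hC l) (mul_nonneg hr ht))
  rw [Finset.sum_mul]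
  refine Finset.sum_le_sum fun i _ => ?_
  rw [map_sum, Finset.sum_apply, Finset.sum_mul]
  refine (Finset.abs_sum_le_sum_abs _ _).trans (Finset.sum_le_sum fun j _ => ?_)
  rw [ratCoords_smul, Pi.smul_apply, smul_eq_mul, abs_mul, abs_mul, mul_comm]
  exact mul_le_mul_of_nonneg_left (mul_le_mul (hx i) (hy j) (abs_nonneg _) hr) (abs_nonneg _)

end RatCoords

/-! ### Unitary elements from Gram matrices -/

section Gram

variable {F K D : Type*} [Field F] [Field K] [Algebra F K] [Ring D] [Algebra F D]
  [Algebra K D] (s : InvolutionSecondKind F K D)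

theorem map_one_involution : s.toLinearMap 1 = 1 := by
  have h := s.map_mul_rev (s.toLinearMap 1) 1
  have h2 : s.toLinearMap (s.toLinearMap 1) = 1 := s.involutive 1
  change s.toLinearMap (s.toLinearMap 1 * 1) = s.toLinearMap 1 * s.toLinearMap (s.toLinearMap 1)
    at h
  rw [mul_one, h2, mul_one] at h
  exact h.symm

/-- Two right `D`-module maps with the same Gram matrix differ by an element of the unitary group. -/
theorem exists_unitary_of_gram (haniso : ∀ x : D, s.toLinearMap x * x = 0 → x = 0)
    {κ : Type*} [Fintype κ] {e e' a : κ → D}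
    (hgram : ∀ i j, s.toLinearMap (e i) * e j = s.toLinearMap (e' i) * e' j)
    (ha : ∑ j, e' j * a j = 1) :
    s.toLinearMap (∑ j, e j * a j) * (∑ j, e j * a j) = 1 ∧
      ∀ k, (∑ j, e j * a j) * e' k = e k := by
  classical
  have hform : ∀ (f : κ → D) (x : κ → D), s.toLinearMap (∑ j, f j * x j) * (∑ j, f j * x j) =
      ∑ i, ∑ j, s.toLinearMap (x i) * (s.toLinearMap (f i) * f j) * x j := fun f x => by
    rw [map_sum, Finset.sum_mul_sum]
    refine Finset.sum_congr rfl fun i _ => Finset.sum_congr rfl fun j _ => ?_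
    have := s.map_mul_rev (f i) (x i)
    change s.toLinearMap (f i * x i) = _ at this
    rw [this]
    simp only [mul_assoc]
    rfl
  have hone := map_one_involution s
  have hcongr : ∀ x : κ → D, s.toLinearMap (∑ j, e j * x j) * (∑ j, e j * x j) =
      s.toLinearMap (∑ j, e' j * x j) * (∑ j, e' j * x j) := fun x => by
    rw [hform, hform]
    simp only [hgram]
  refine ⟨by rw [hcongr, ha, hone, one_mul], fun k => ?_⟩
  -- The vector with entries a_j e'_k - δ_jk is a relation among the e'_j. Equal Gram matrices make
  -- its combination of the e_j isotropic, and anisotropy kills it.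
  have h0 : ∑ j, e' j * (a j * e' k - if j = k then 1 else 0) = 0 := by
    simp only [mul_sub, Finset.sum_sub_distrib, ← mul_assoc, ← Finset.sum_mul, ha, one_mul,
      mul_ite, mul_one, mul_zero, Finset.sum_ite_eq', Finset.mem_univ, if_true, sub_self]
  have h1 := haniso _ ((hcongr fun j => a j * e' k - if j = k then 1 else 0).trans
    (by rw [h0, mul_zero]))
  simp only [mul_sub, Finset.sum_sub_distrib, ← mul_assoc, ← Finset.sum_mul,
      mul_ite, mul_one, mul_zero, Finset.sum_ite_eq', Finset.mem_univ, if_true] at h1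
  exact sub_eq_zero.1 h1

/-- The element of `U(F)` attached to a unitary element of `D`. -/
theorem exists_unitaryGroup_coe_eq [IsDedekindFiniteMonoid D] {δ : D}
    (hδ : s.toLinearMap δ * δ = 1) :
    ∃ g : U s F, ((g : (F ⊗[F] D)ˣ) : F ⊗[F] D) = 1 ⊗ₜ δ := by
  have h : δ * s.toLinearMap δ = 1 := mul_eq_one_symm hδ
  refine ⟨⟨⟨1 ⊗ₜ δ, 1 ⊗ₜ s.toLinearMap δ, ?_, ?_⟩, ?_⟩, rfl⟩
  · rw [Algebra.TensorProduct.tmul_mul_tmul, h, one_mul, Algebra.TensorProduct.one_def]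
  · rw [Algebra.TensorProduct.tmul_mul_tmul, hδ, one_mul, Algebra.TensorProduct.one_def]
  · change (1 : F) ⊗ₜ[F] δ * starBase s F (1 ⊗ₜ δ) = 1
    rw [starBase_tmul, Algebra.TensorProduct.tmul_mul_tmul, h, one_mul,
      Algebra.TensorProduct.one_def]

end Gram

/-! ### Bounded vectors in the lattices attached to bounded families -/

section Span

variable {F K D ι : Type*} [Field F] [NumberField F] [Field K] [Algebra F K] [Ring D] [Algebra F D]
  [Algebra K D] (s : InvolutionSecondKind F K D) [Fintype ι] (b : Module.Basis ι F D)

/-- For nonzero x in Λ_γ, κx⋆x is integral, and nonzero by anisotropy, while its coordinates are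
quadratic in those of x. If all coordinates of x were below ε = 1/(κC + 1), those of κx⋆x would be
integers of absolute value less than 1. -/
theorem exists_gap (haniso : ∀ x : D, s.toLinearMap x * x = 0 → x = 0) :
    ∃ ε : ℚ, 0 < ε ∧ ∀ (γ : ∀ v : HeightOneSpectrum (𝓞 F), U s (v.adicCompletion F)),
      ∀ x ∈ latticeOf b γ, x ≠ 0 → ∃ l, ε ≤ |ratCoords b x l| := by
  obtain ⟨κ, hκ, h⟩ := exists_natCast_smul_star_mul_integral s b
  obtain ⟨C, hC⟩ := exists_ratCoords_mul_le b s
  refine ⟨1 / (κ * C + 1), by positivity, fun γ x hx hx0 => ?_⟩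
  by_contra! hlt
  refine hx0 (haniso x (ratCoords_injective b ?_))
  funext l
  rw [map_zero, Pi.zero_apply]
  obtain ⟨z, hz⟩ := exists_ratCoords_eq_intCast b (h γ x hx x hx) l
  rw [ratCoords_natCast_smul, Pi.smul_apply, smul_eq_mul] at hz
  have hle := hC x x _ _ (fun l => (hlt l).le) (fun l => (hlt l).le) l
  have hlt1 : |(z : ℚ)| < 1 := by
    rw [← hz, abs_mul, Nat.abs_cast]
    refine lt_of_le_of_lt (mul_le_mul_of_nonneg_left hle (Nat.cast_nonneg _)) ?_
    have h0 : (0 : ℚ) < κ * C + 1 := by positivity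
    rw [div_mul_div_comm, one_mul, ← mul_assoc, mul_one_div, div_lt_one (by positivity)]
    nlinarith [show (0 : ℚ) ≤ κ * C by positivity]
  have hz0 : z = 0 := by
    rw [← Int.cast_abs] at hlt1
    exact Int.abs_lt_one_iff.1 (by exact_mod_cast hlt1)
  rw [hz0, Int.cast_zero] at hz
  exact (mul_eq_zero.1 hz).resolve_left (Nat.cast_ne_zero.2 hκ)

/-- Otherwise the bounded vectors lie in a rational hyperplane. Self-duality up to k yields at least
R^N vectors of Λ_γ of size at most kR, whereas the gap allows at most ((2t + 1)R)^(N-1) of them in a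
hyperplane. This is contradictory once R > (2t + 1)^(N-1), and none of these constants involves γ.
-/
theorem exists_span_bounded_eq_top [IsSimpleRing D]
    (haniso : ∀ x : D, s.toLinearMap x * x = 0 → x = 0) :
    ∃ A : ℚ, ∀ (γ : ∀ v : HeightOneSpectrum (𝓞 F), U s (v.adicCompletion F)),
      (IsBoundedFamily b fun v => ((γ v : (v.adicCompletion F ⊗[F] D)ˣ) :
        v.adicCompletion F ⊗[F] D)) →
      Submodule.span F {x | x ∈ latticeOf b γ ∧ ∀ l, |ratCoords b x l| ≤ A} = ⊤ := by
  classical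
  obtain ⟨ε, hε, hgap⟩ := exists_gap s b haniso
  obtain ⟨τ, b', hτ⟩ := exists_dual_family b
  -- The integer c clears the denominators of the matrix of the trace form.
  obtain ⟨c, hc, B, hB⟩ : ∃ c : ℕ, c ≠ 0 ∧ ∃ B : RatIndex F ι → RatIndex F ι → ℤ, ∀ i j,
      (c : ℚ) * Algebra.trace ℚ F (τ (s.toLinearMap (ratBasis b i) * ratBasis b j)) = B i j := by
    let q : RatIndex F ι → RatIndex F ι → ℚ := fun i j =>
      Algebra.trace ℚ F (τ (s.toLinearMap (ratBasis b i) * ratBasis b j))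
    refine ⟨∏ i, ∏ j, (q i j).den, Finset.prod_ne_zero_iff.2 fun i _ =>
      Finset.prod_ne_zero_iff.2 fun j _ => (q i j).den_ne_zero, ?_⟩
    have h : ∀ i j, ∃ z : ℤ, ((∏ i, ∏ j, (q i j).den : ℕ) : ℚ) * q i j = z := fun i j => by
      obtain ⟨d, hd⟩ : (q i j).den ∣ ∏ i, ∏ j, (q i j).den :=
        (Finset.dvd_prod_of_mem _ (Finset.mem_univ j)).trans
          (Finset.dvd_prod_of_mem (fun i => ∏ j, (q i j).den) (Finset.mem_univ i))
      refine ⟨d * (q i j).num, ?_⟩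
      rw [hd, Nat.cast_mul, mul_right_comm, mul_comm _ (q i j), Rat.mul_den_eq_num]
      push_cast
      ring
    choose B hB using h
    exact ⟨B, hB⟩
  obtain ⟨k, hk, hdual⟩ := exists_natCast_smul_mem_of_trace s hτ hc
  set N := Fintype.card (RatIndex F ι) with hN
  have : Nontrivial D := inferInstance
  have : Nonempty ι := b.index_nonempty
  have : Nonempty (Module.Free.ChooseBasisIndex ℤ (𝓞 F)) := (integralBasis F).index_nonempty
  have hNpos : 0 < N := Fintype.card_pos
  set t := ⌈(k * N : ℚ) / ε⌉₊ with ht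
  set R := (2 * t + 1) ^ (N - 1) + 1 with hR
  refine ⟨k * R, fun γ hγ => ?_⟩
  obtain ⟨m, hm, hm₁, hm₂⟩ := exists_natCast_smul_mem_latticeOf hγ
  have hm0 : (m : ℚ) ≠ 0 := Nat.cast_ne_zero.2 hm
  -- Vectors of Λ_γ have rational coordinates in m⁻¹ℤ, so Λ_γ corresponds through f to a subgroup of
  -- ℤ^N; this subgroup contains m²ℤ^N.
  let f : (RatIndex F ι → ℤ) →+ D :=
    { toFun := fun z => ∑ l, (((z l : ℚ) / m : ℚ) : F) • ratBasis b l
      map_zero' := by simp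
      map_add' := fun x y => by
        rw [← Finset.sum_add_distrib]
        refine Finset.sum_congr rfl fun l _ => ?_
        rw [← add_smul, ← Rat.cast_add, ← add_div, Pi.add_apply, Int.cast_add] }
  have hf : ∀ z l, ratCoords b (f z) l = z l / m := fun z l => by
    change ratCoords b (∑ l, (((z l : ℚ) / m : ℚ) : F) • ratBasis b l) l = _
    rw [ratCoords_sum]
  have hf' : ∀ (x : D) (z : RatIndex F ι → ℤ), (∀ l, ratCoords b x l = z l / m) → x = f z :=
    fun x z h => ratCoords_injective b (funext fun l => (h l).trans (hf z l).symm)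
  have hG : ∀ z : RatIndex F ι → ℤ, ((m ^ 2 : ℕ) : ℤ) • z ∈ (latticeOf b γ).comap f := by
    intro z v
    refine hm₁ v _ ?_
    have h : f (((m ^ 2 : ℕ) : ℤ) • z) = (m : F) • ∑ l, ((z l : ℚ) : F) • ratBasis b l := by
      refine (hf' _ _ fun l => ?_).symm
      rw [ratCoords_natCast_smul, ratCoords_sum, Pi.smul_apply, smul_eq_mul, Pi.smul_apply,
        smul_eq_mul]
      push_cast
      field_simp
    rw [h, locNorm_one_tmul_smul, map_natCast]
    refine mul_le_of_le_one_right (norm_nonneg _) (locNorm_le_one_of_ratCoords b (fun l => ⟨z l, ?_⟩) v)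
    rw [ratCoords_sum]
  have hpair : ∀ x g : RatIndex F ι → ℤ,
      (c : ℚ) * Algebra.trace ℚ F (τ (s.toLinearMap (f x) * f g)) =
        ((∑ j, (∑ i, x i * B i j) * g j : ℤ) : ℚ) / ((m ^ 2 : ℕ) : ℚ) := by
    intro x g
    have h : s.toLinearMap (f x) * f g = ∑ j, ∑ i, (((x i / m) * (g j / m) : ℚ) : F) •
        (s.toLinearMap (ratBasis b i) * ratBasis b j) := by
      change s.toLinearMap (∑ l, (((x l : ℚ) / m : ℚ) : F) • ratBasis b l) *
        (∑ l, (((g l : ℚ) / m : ℚ) : F) • ratBasis b l) = _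
      rw [map_sum, Finset.sum_mul_sum, Finset.sum_comm]
      refine Finset.sum_congr rfl fun i _ => Finset.sum_congr rfl fun j _ => ?_
      rw [map_smul, smul_mul_smul_comm, Rat.cast_mul]
    rw [h, map_sum, map_sum, Finset.mul_sum, Int.cast_sum, Finset.sum_div]
    refine Finset.sum_congr rfl fun j _ => ?_
    rw [map_sum, map_sum, Finset.mul_sum, Int.cast_mul, Int.cast_sum, Finset.sum_mul,
      Finset.sum_div]
    refine Finset.sum_congr rfl fun i _ => ?_
    rw [map_smul, smul_eq_mul, ← Rat.smul_def, map_smul, smul_eq_mul, mul_left_comm, hB]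
    push_cast
    field_simp
  obtain ⟨P, hPcard, hP⟩ := exists_finset_of_dual hm B hk ((latticeOf b γ).comap f) hG
    (fun x hx => by
      rw [AddSubgroup.mem_comap, map_nsmul, ← Nat.cast_smul_eq_nsmul F]
      refine hdual γ hγ _ fun y hy => ?_
      choose g hg using exists_ratCoords_eq_intCast b (hm₂ y hy)
      have hyg : y = f g := hf' y g fun l => by
        have := hg l
        rw [ratCoords_natCast_smul, Pi.smul_apply, smul_eq_mul] at this
        rw [← this, mul_div_cancel_left₀ _ hm0]
      obtain ⟨n, hn⟩ := hx g (by rwa [AddSubgroup.mem_comap, ← hyg])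
      refine ⟨n, ?_⟩
      rw [hyg, hpair, hn, Int.cast_mul, Int.cast_natCast, mul_div_cancel_left₀]
      exact_mod_cast pow_ne_zero 2 hm) (R := R) (Nat.succ_ne_zero _)
  by_contra hne
  obtain ⟨ℓ, hℓ0, hℓ⟩ := Submodule.exists_le_ker_of_lt_top _ (lt_top_iff_ne_top.2 hne)
  obtain ⟨d, hd⟩ : ∃ d, ℓ d = 1 := by
    obtain ⟨d, hd⟩ := DFunLike.ne_iff.1 hℓ0
    exact ⟨(ℓ d)⁻¹ • d, by rw [map_smul, smul_eq_mul, inv_mul_cancel₀ hd]⟩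
  -- The trace turns the F-linear functional ℓ into a rational one, nonzero because its value at d
  -- is [F : ℚ].
  let w : RatIndex F ι → ℚ := fun l => Algebra.trace ℚ F (ℓ (ratBasis b l))
  have hw : ∀ x, ∑ l, w l * ratCoords b x l = Algebra.trace ℚ F (ℓ x) := fun x => by
    conv_rhs => rw [← sum_ratCoords b x, map_sum, map_sum]
    refine Finset.sum_congr rfl fun l _ => ?_
    rw [map_smul, smul_eq_mul, ← Rat.smul_def, map_smul, smul_eq_mul, mul_comm]
  have hw0 : w ≠ 0 := fun h => by
    have h1 := hw d
    rw [h, hd, ← map_one (algebraMap ℚ F), Algebra.trace_algebraMap] at h1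
    simp only [Pi.zero_apply, zero_mul, Finset.sum_const_zero, nsmul_eq_mul,
      mul_one] at h1
    exact (Module.finrank_pos (R := ℚ) (M := F)).ne' (Nat.cast_eq_zero.1 h1.symm)
  have hinj : Function.Injective fun (z : RatIndex F ι → ℤ) l => (z l : ℚ) / m := fun x y hxy =>
    funext fun l => by
      have := congrFun hxy l
      exact Int.cast_injective ((div_left_inj' hm0).1 this)
  have hbd : ∀ z ∈ P, ∀ l, |(z l : ℚ) / m| ≤ k * R := fun z hz l => by
    rw [abs_div, Nat.abs_cast, div_le_iff₀ (by positivity)]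
    have := (hP z hz).2 l
    have h2 : ((|z l| : ℤ) : ℚ) ≤ ((k * (m * R) : ℕ) : ℤ) := by exact_mod_cast this
    rw [Int.cast_abs] at h2
    refine h2.trans (le_of_eq ?_)
    push_cast
    ring
  have hcard := card_le_of_hyperplane (P.image fun z l => (z l : ℚ) / m) (A := k * R) hε
    (fun x hx l => by
      obtain ⟨z, hz, rfl⟩ := Finset.mem_image.1 hx
      exact hbd z hz l)
    (fun x hx y hy hxy => by
      obtain ⟨z, hz, rfl⟩ := Finset.mem_image.1 hx
      obtain ⟨z', hz', rfl⟩ := Finset.mem_image.1 hy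
      obtain ⟨l, hl⟩ := hgap γ (f z - f z') (sub_mem (hP z hz).1 (hP z' hz').1) fun h => hxy (by
        funext l
        rw [← hf, ← hf, sub_eq_zero.1 h])
      refine ⟨l, ?_⟩
      rwa [map_sub, Pi.sub_apply, hf, hf] at hl) hw0
    (fun x hx => by
      obtain ⟨z, hz, rfl⟩ := Finset.mem_image.1 hx
      have h1 : ℓ (f z) = 0 := hℓ (Submodule.subset_span ⟨(hP z hz).1, fun l => by
        rw [hf]; exact hbd z hz l⟩)
      simp only [← hf]
      rw [hw, h1, map_zero])
  rw [Finset.card_image_of_injective _ hinj, ← hN] at hcard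
  have hceil : ⌈(k * R : ℚ) * N / ε⌉₊ ≤ t * R := by
    refine Nat.ceil_le.2 ?_
    have h1 : (k * R : ℚ) * N / ε = (k * N / ε) * R := by ring
    rw [h1, Nat.cast_mul]
    exact mul_le_mul_of_nonneg_right (Nat.le_ceil _) (Nat.cast_nonneg _)
  have hfinal : R ^ N < R ^ N := by
    calc R ^ N ≤ P.card := hPcard
      _ ≤ (2 * ⌈(k * R : ℚ) * N / ε⌉₊ + 1) ^ (N - 1) := hcard
      _ ≤ ((2 * t + 1) * R) ^ (N - 1) := by
          refine Nat.pow_le_pow_left ?_ _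
          have : 1 ≤ R := Nat.succ_le_of_lt (Nat.succ_pos _)
          nlinarith
      _ = (2 * t + 1) ^ (N - 1) * R ^ (N - 1) := mul_pow _ _ _
      _ < R * R ^ (N - 1) := Nat.mul_lt_mul_of_pos_right (Nat.lt_succ_self _) (by positivity)
      _ = R ^ N := by rw [← pow_succ', Nat.sub_add_cancel hNpos]
  exact lt_irrefl _ hfinal

/-- Bounded families in the local unitary groups fall into finitely many classes up to `U(F)` and
bounded families whose bound depends on the class only. -/
theorem exists_finite_classes [IsSimpleRing D]
    (haniso : ∀ x : D, s.toLinearMap x * x = 0 → x = 0) :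
    ∃ (r : ℕ) (cls : (∀ v : HeightOneSpectrum (𝓞 F), U s (v.adicCompletion F)) → Fin r),
      ∀ γ' : ∀ v : HeightOneSpectrum (𝓞 F), U s (v.adicCompletion F),
        (IsBoundedFamily b fun v => ((γ' v : (v.adicCompletion F ⊗[F] D)ˣ) :
          v.adicCompletion F ⊗[F] D)) → ∃ m : ℕ, m ≠ 0 ∧
        ∀ γ : ∀ v : HeightOneSpectrum (𝓞 F), U s (v.adicCompletion F),
          (IsBoundedFamily b fun v => ((γ v : (v.adicCompletion F ⊗[F] D)ˣ) :
            v.adicCompletion F ⊗[F] D)) → cls γ = cls γ' →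
          ∃ δ : U s F, ∀ v, ‖(m : v.adicCompletion F)‖ * locNorm b v
            ((((γ v)⁻¹ * U.map s (Algebra.ofId F (v.adicCompletion F)) δ * γ' v :
              U s (v.adicCompletion F)) : (v.adicCompletion F ⊗[F] D)ˣ) :
              v.adicCompletion F ⊗[F] D) ≤ 1 := by
  classical
  have : Module.Finite F D := Module.Finite.of_basis b
  have : IsArtinianRing D := IsArtinianRing.of_finite F D
  obtain ⟨A, hA⟩ := exists_span_bounded_eq_top s b haniso
  obtain ⟨κ, hκ, hκint⟩ := exists_natCast_smul_star_mul_integral s b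
  obtain ⟨C, hC⟩ := exists_ratCoords_mul_le b s
  have hex : ∀ γ : ∀ v : HeightOneSpectrum (𝓞 F), U s (v.adicCompletion F),
      ∃ e : ι → D, (IsBoundedFamily b fun v => ((γ v : (v.adicCompletion F ⊗[F] D)ˣ) :
        v.adicCompletion F ⊗[F] D)) → (∀ i, e i ∈ latticeOf b γ) ∧
        (∀ i l, |ratCoords b (e i) l| ≤ A) ∧ Submodule.span F (Set.range e) = ⊤ := by
    intro γ
    by_cases hγ : IsBoundedFamily b fun v => ((γ v : (v.adicCompletion F ⊗[F] D)ˣ) :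
        v.adicCompletion F ⊗[F] D)
    · let bb := Module.Basis.ofSpan (hA γ hγ).ge
      obtain ⟨σ⟩ : Nonempty (ι ≃ _) := ⟨b.indexEquiv bb⟩
      refine ⟨fun i => bb (σ i), fun _ => ?_⟩
      have hmem : ∀ i, bb (σ i) ∈ {x | x ∈ latticeOf b γ ∧ ∀ l, |ratCoords b x l| ≤ A} :=
        fun i => Module.Basis.ofSpan_subset (hA γ hγ).ge ⟨σ i, rfl⟩
      refine ⟨fun i => (hmem i).1, fun i => (hmem i).2, ?_⟩
      rw [← bb.span_eq]
      congr 1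
      exact σ.surjective.range_comp bb
    · exact ⟨0, fun h => absurd h hγ⟩
  choose e he using hex
  let M : ℕ := ⌈κ * (C * (A * A))⌉₊
  let I : Finset ℤ := Finset.Icc (-(M : ℤ)) M
  -- The class records the Gram matrix κe_i⋆e_j in rational coordinates. The default `none` never
  -- occurs for a bounded family, whose entries are integers of absolute value at most M.
  let cls : (∀ v : HeightOneSpectrum (𝓞 F), U s (v.adicCompletion F)) →
      ι → ι → RatIndex F ι → Option I := fun γ i j l =>
    if h : ∃ z : I, ratCoords b ((κ : F) • (s.toLinearMap (e γ i) * e γ j)) l = (z : ℤ) then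
      some h.choose else none
  obtain ⟨r, ⟨σ⟩⟩ := Finite.exists_equiv_fin (ι → ι → RatIndex F ι → Option I)
  refine ⟨r, fun γ => σ (cls γ), fun γ' hγ' => ?_⟩
  have hcls : ∀ γ : ∀ v : HeightOneSpectrum (𝓞 F), U s (v.adicCompletion F),
      (IsBoundedFamily b fun v => ((γ v : (v.adicCompletion F ⊗[F] D)ˣ) :
        v.adicCompletion F ⊗[F] D)) → ∀ i j l,
      ∃ h : ∃ z : I, ratCoords b ((κ : F) • (s.toLinearMap (e γ i) * e γ j)) l = (z : ℤ),
        cls γ i j l = some h.choose := by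
    intro γ hγ i j l
    obtain ⟨z, hz⟩ := exists_ratCoords_eq_intCast b
      (hκint γ _ ((he γ hγ).1 i) _ ((he γ hγ).1 j)) l
    have hzI : z ∈ I := by
      have h1 := hC _ _ A A ((he γ hγ).2.1 i) ((he γ hγ).2.1 j) l
      have h2 : |(z : ℚ)| ≤ M := by
        rw [← hz, ratCoords_natCast_smul, Pi.smul_apply, smul_eq_mul, abs_mul, Nat.abs_cast]
        exact (mul_le_mul_of_nonneg_left h1 (Nat.cast_nonneg _)).trans (Nat.le_ceil _)
      rw [abs_le] at h2
      exact Finset.mem_Icc.2 ⟨by exact_mod_cast h2.1, by exact_mod_cast h2.2⟩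
    have h : ∃ z : I, ratCoords b ((κ : F) • (s.toLinearMap (e γ i) * e γ j)) l = (z : ℤ) :=
      ⟨⟨z, hzI⟩, hz⟩
    exact ⟨h, dif_pos h⟩
  have hgram : ∀ γ : ∀ v : HeightOneSpectrum (𝓞 F), U s (v.adicCompletion F),
      (IsBoundedFamily b fun v => ((γ v : (v.adicCompletion F ⊗[F] D)ˣ) :
        v.adicCompletion F ⊗[F] D)) → cls γ = cls γ' → ∀ i j,
      s.toLinearMap (e γ i) * e γ j = s.toLinearMap (e γ' i) * e γ' j := by
    intro γ hγ hcl i j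
    refine smul_right_injective D (Nat.cast_ne_zero.2 hκ : (κ : F) ≠ 0)
      (ratCoords_injective b (funext fun l => ?_))
    obtain ⟨h, h1⟩ := hcls γ hγ i j l
    obtain ⟨h', h1'⟩ := hcls γ' hγ' i j l
    rw [h.choose_spec, h'.choose_spec]
    rw [hcl, h1'] at h1
    rw [Option.some_injective _ h1]
  -- These coefficients depend on γ' only; δ will be ∑ e_j a_j, which carries each e'_k to e_k.
  obtain ⟨a, ha⟩ : ∃ a : ι → D, ∑ j, e γ' j * a j = 1 := by
    have h1 : (1 : D) ∈ Submodule.span F (Set.range (e γ')) := by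
      rw [(he γ' hγ').2.2]; trivial
    obtain ⟨c, hc⟩ := (Submodule.mem_span_range_iff_exists_fun F).1 h1
    refine ⟨fun j => algebraMap F D (c j), ?_⟩
    rw [← hc]
    refine Finset.sum_congr rfl fun j _ => ?_
    rw [← Algebra.commutes, Algebra.smul_def]
  obtain ⟨κ₁, hκ₁, hmul⟩ := exists_locNorm_mul_le b
  obtain ⟨m, hm, hbd⟩ : ∃ m : ℕ, m ≠ 0 ∧ ∀ (j : ι) (v : HeightOneSpectrum (𝓞 F)),
      ‖(m : v.adicCompletion F)‖ * locNorm b v ((1 ⊗ₜ a j) *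
        ((γ' v : (v.adicCompletion F ⊗[F] D)ˣ) : v.adicCompletion F ⊗[F] D)) ≤ 1 := by
    choose m hm h using fun j => (isBoundedFamily_tmul (b := b) (a j)).mul hγ'
    refine ⟨∏ j, m j, Finset.prod_ne_zero_iff.2 fun j _ => hm j, fun j v => ?_⟩
    rw [← Finset.prod_erase_mul _ _ (Finset.mem_univ j), Nat.cast_mul, norm_mul, mul_assoc]
    exact mul_le_one₀ (norm_natCast_le_one v _) (mul_nonneg (norm_nonneg _) (locNorm_nonneg b v _))
      (h j v)
  refine ⟨m * κ₁, mul_ne_zero hm hκ₁, fun γ hγ hcl => ?_⟩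
  obtain ⟨hδ, hδe⟩ := exists_unitary_of_gram s haniso (hgram γ hγ (σ.injective hcl)) ha
  obtain ⟨δ, hδ'⟩ := exists_unitaryGroup_coe_eq s hδ
  refine ⟨δ, fun v => ?_⟩
  -- In γ⁻¹δγ' = ∑ (γ⋆e_j)(a_jγ') the first factor is integral because e_j ∈ Λ_γ, and the second is
  -- bounded in terms of γ' alone.
  have hcoe : ((((γ v)⁻¹ * U.map s (Algebra.ofId F (v.adicCompletion F)) δ * γ' v :
      U s (v.adicCompletion F)) : (v.adicCompletion F ⊗[F] D)ˣ) : v.adicCompletion F ⊗[F] D) =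
      ∑ j, (starBase s _ ((γ v : (v.adicCompletion F ⊗[F] D)ˣ) : v.adicCompletion F ⊗[F] D) *
        (1 ⊗ₜ e γ j)) * ((1 ⊗ₜ a j) * ((γ' v : (v.adicCompletion F ⊗[F] D)ˣ) :
          v.adicCompletion F ⊗[F] D)) := by
    have h1 : (((U.map s (Algebra.ofId F (v.adicCompletion F)) δ : U s (v.adicCompletion F)) :
        (v.adicCompletion F ⊗[F] D)ˣ) : v.adicCompletion F ⊗[F] D) =
        1 ⊗ₜ ∑ j, e γ j * a j := by
      change Algebra.TensorProduct.map _ _ ((δ : (F ⊗[F] D)ˣ) : F ⊗[F] D) = _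
      rw [hδ', Algebra.TensorProduct.map_tmul, map_one]
      rfl
    rw [Subgroup.coe_mul, Subgroup.coe_mul, Units.val_mul, Units.val_mul, h1, coe_inv_eq_starBase,
      TensorProduct.tmul_sum, Finset.mul_sum, Finset.sum_mul]
    refine Finset.sum_congr rfl fun j _ => ?_
    rw [← one_mul (1 : v.adicCompletion F), ← Algebra.TensorProduct.tmul_mul_tmul, one_mul]
    simp only [mul_assoc]
  rw [hcoe, ← locNorm_smul, Finset.smul_sum]
  refine locNorm_sum_le b v _ _ zero_le_one fun j _ => ?_
  rw [locNorm_smul, Nat.cast_mul, norm_mul, mul_assoc]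
  refine (mul_le_mul_of_nonneg_left (hmul v _ _) (norm_nonneg _)).trans ?_
  rw [mul_left_comm]
  exact mul_le_one₀ ((he γ hγ).1 j v) (mul_nonneg (norm_nonneg _) (locNorm_nonneg b v _)) (hbd j v)

end Span

/-! ### The unitary group over a topological ring -/

section Topological

variable {F K D ι R : Type*} [Field F] [Field K] [Algebra F K] [Ring D] [Algebra F D]
  [Algebra K D] (s : InvolutionSecondKind F K D) [Fintype ι] (b : Module.Basis ι F D)
  [CommRing R] [Algebra F R] [TopologicalSpace R] [IsTopologicalRing R]

theorem continuous_coords_unitaryGroup :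
    Continuous fun g : U s R => coords b R ((g : (R ⊗[F] D)ˣ) : R ⊗[F] D) := by
  let _ : TopologicalSpace (R ⊗[F] D) := moduleTopology R (R ⊗[F] D)
  have : IsModuleTopology R (R ⊗[F] D) := ⟨rfl⟩
  exact (IsModuleTopology.continuous_of_linearMap (coords b R).toLinearMap).comp
    continuous_induced_dom

end Topological

/-! ### Definite involutions -/

section Definite

variable {F K D : Type*} [Field F] [NumberField F] [Field K] [Algebra F K] [Ring D]
  [Algebra F D] [Algebra K D] {s : InvolutionSecondKind F K D}

theorem exists_bound_of_compactSpace {ι : Type*} [Fintype ι] (b : Module.Basis ι F D)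
    (hdef : CompactSpace (U s (InfiniteAdeleRing F))) :
    ∃ M : ℝ, ∀ (g : U s (InfiniteAdeleRing F)) (i : ι) (v : InfinitePlace F),
      ‖coords b (InfiniteAdeleRing F)
        ((g : (InfiniteAdeleRing F ⊗[F] D)ˣ) : InfiniteAdeleRing F ⊗[F] D) i v‖ ≤ M := by
  have h : ∀ (i : ι) (v : InfinitePlace F), ∃ M : ℝ, ∀ g : U s (InfiniteAdeleRing F),
      ‖coords b (InfiniteAdeleRing F)
        ((g : (InfiniteAdeleRing F ⊗[F] D)ˣ) : InfiniteAdeleRing F ⊗[F] D) i v‖ ≤ M := by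
    intro i v
    have hc : Continuous fun g : U s (InfiniteAdeleRing F) => coords b (InfiniteAdeleRing F)
        ((g : (InfiniteAdeleRing F ⊗[F] D)ˣ) : InfiniteAdeleRing F ⊗[F] D) i v :=
      (continuous_apply (A := fun v : InfinitePlace F => v.Completion) v).comp
        ((continuous_apply i).comp (continuous_coords_unitaryGroup s b))
    obtain ⟨M, hM⟩ := (isCompact_range hc).isBounded.exists_norm_le
    exact ⟨M, fun g => hM _ ⟨g, rfl⟩⟩
  choose M hM using h
  obtain ⟨B, hB⟩ := (Set.finite_range fun z : ι × InfinitePlace F => M z.1 z.2).bddAbove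
  exact ⟨B, fun g i v => (hM i v g).trans (hB ⟨(i, v), rfl⟩)⟩

/-- There is no unipotent one-parameter family in a compact unitary group. -/
theorem eq_zero_of_skew_of_sq_eq_zero [FiniteDimensional F D]
    (hdef : CompactSpace (U s (InfiniteAdeleRing F)))
    {N : D} (hN : s.toLinearMap N = -N) (hN2 : N * N = 0) : N = 0 := by
  have : IsArtinianRing D := IsArtinianRing.of_finite F D
  let b := Module.finBasis F D
  obtain ⟨M, hM⟩ := exists_bound_of_compactSpace b hdef
  by_contra h0
  obtain ⟨i, hi⟩ : ∃ i, b.repr N i ≠ 0 := by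
    by_contra! h
    exact h0 (b.repr.map_eq_zero_iff.1 (Finsupp.ext h))
  obtain ⟨v⟩ : Nonempty (InfinitePlace F) := inferInstance
  -- These are unitary because N is skew with square zero, and a coordinate where N is nonzero grows
  -- linearly in n at any infinite place.
  let g : ℕ → D := fun n => 1 + (n : F) • N
  have hone : s.toLinearMap 1 = 1 := map_one_involution s
  have hg : ∀ n, s.toLinearMap (g n) * g n = 1 := fun n => by
    simp only [g, map_add, map_smul, hone, hN]
    rw [add_mul, mul_add, mul_add, smul_mul_smul_comm, neg_mul, hN2]
    simp
  choose u hu using fun n => exists_unitaryGroup_coe_eq s (hg n)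
  have hval : ∀ n, coords b (InfiniteAdeleRing F)
      ((U.map s (Algebra.ofId F (InfiniteAdeleRing F)) (u n) :
        (InfiniteAdeleRing F ⊗[F] D)ˣ) : InfiniteAdeleRing F ⊗[F] D) i v =
      algebraMap F v.Completion (b.repr 1 i + n * b.repr N i) := fun n => by
    change coords b _ (Algebra.TensorProduct.map (Algebra.ofId F (InfiniteAdeleRing F))
      (AlgHom.id F D) ((u n : (F ⊗[F] D)ˣ) : F ⊗[F] D)) i v = _
    rw [coords_map, hu, coords_tmul, one_mul]
    simp [g]
  have hbd : ∀ n : ℕ, v (b.repr 1 i + n * b.repr N i) ≤ M := fun n => by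
    have h := hM (U.map s (Algebra.ofId F (InfiniteAdeleRing F)) (u n)) i v
    rw [hval] at h
    rwa [InfinitePlace.Completion.algebraMap_apply, InfinitePlace.Completion.norm_coe] at h
  have hpos : 0 < v (b.repr N i) := by
    rw [← InfinitePlace.norm_embedding_eq]
    simpa using hi
  obtain ⟨n, hn⟩ := exists_nat_gt ((M + v (b.repr 1 i)) / v (b.repr N i))
  rw [div_lt_iff₀ hpos] at hn
  refine absurd (hbd n) (not_le.2 ?_)
  have h1 : v ((n : F) * b.repr N i) = n * v (b.repr N i) := by
    rw [map_mul, ← InfinitePlace.norm_embedding_eq v (n : F), map_natCast, Complex.norm_natCast]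
  have h2 : v ((n : F) * b.repr N i) ≤ v (b.repr 1 i + n * b.repr N i) + v (b.repr 1 i) := by
    rw [← InfinitePlace.norm_embedding_eq, ← InfinitePlace.norm_embedding_eq,
      ← InfinitePlace.norm_embedding_eq]
    have := norm_sub_le (v.embedding (b.repr 1 i + n * b.repr N i)) (v.embedding (b.repr 1 i))
    rwa [← map_sub, add_sub_cancel_left] at this
  linarith

/-- A simple ring is prime: the z with xDz = 0 form a two-sided ideal. -/
theorem eq_zero_or_eq_zero_of_forall_mul_mul [IsSimpleRing D] {x y : D}
    (h : ∀ d, x * d * y = 0) : x = 0 ∨ y = 0 := by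
  let I : TwoSidedIdeal D := TwoSidedIdeal.mk' {z | ∀ d, x * d * z = 0}
    (fun d => by simp) (fun hx hy d => by simp [mul_add, hx d, hy d])
    (fun hx d => by simpa using hx d)
    (fun {z w} hw d => by
      change x * d * (z * w) = 0
      rw [← mul_assoc, mul_assoc x]; exact hw _)
    (fun {z w} hz d => by
      change x * d * (z * w) = 0
      rw [← mul_assoc, hz d, zero_mul])
  have hI : ∀ z, z ∈ I ↔ ∀ d, x * d * z = 0 := fun z => by
    simp [I, TwoSidedIdeal.mem_mk']
  rcases eq_bot_or_eq_top I with h' | h'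
  · right
    have : y ∈ I := (hI y).2 h
    rw [h'] at this
    exact (TwoSidedIdeal.mem_bot D).1 this
  · left
    have h1 : (1 : D) ∈ I := h' ▸ trivial
    simpa using (hI 1).1 h1 1

/-- The hermitian form `x⋆ y` of a definite unitary group is anisotropic. -/
theorem anisotropic_of_compactSpace [FiniteDimensional F D] [IsScalarTower F K D] [IsSimpleRing D]
    (hdef : CompactSpace (U s (InfiniteAdeleRing F))) (x : D)
    (hx : s.toLinearMap x * x = 0) : x = 0 := by
  have hmul : ∀ a c : D, s.toLinearMap (a * c) = s.toLinearMap c * s.toLinearMap a := s.map_mul_rev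
  have hinv : ∀ a : D, s.toLinearMap (s.toLinearMap a) = a := s.involutive
  obtain ⟨c, hc1, hc⟩ := s.second_kind
  have hc' : ∀ k : K, s.toLinearMap (algebraMap K D k) = algebraMap K D (c k) := hc
  -- The element xax⋆ is skew, and its square contains the factor x⋆x = 0.
  have hskew : ∀ a : D, s.toLinearMap a = -a → x * a * s.toLinearMap x = 0 := fun a ha => by
    refine eq_zero_of_skew_of_sq_eq_zero hdef ?_ ?_
    · rw [hmul, hmul, hinv, ha, ← mul_assoc, mul_neg, neg_mul]
    · rw [mul_assoc (x * a), ← mul_assoc (s.toLinearMap x), ← mul_assoc (s.toLinearMap x), hx]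
      simp
  obtain ⟨k, hk⟩ : ∃ k, c k ≠ k := by
    by_contra! h
    exact hc1 (AlgEquiv.ext h)
  have hcc : ∀ k, c (c k) = k := fun k => by
    have h := hinv (algebraMap K D k)
    rw [hc', hc'] at h
    exact (algebraMap K D).injective h
  -- Multiplication by the skew scalar t turns symmetric elements into skew ones, so the vanishing
  -- extends to symmetric elements and then to all of D.
  set t : K := k - c k with ht
  have ht0 : t ≠ 0 := sub_ne_zero.2 (Ne.symm hk)
  have hct : c t = -t := by rw [ht, map_sub, hcc, neg_sub]
  have hsym : ∀ a : D, s.toLinearMap a = a → x * a * s.toLinearMap x = 0 := fun a ha => by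
    have h := hskew (algebraMap K D t * a) (by
      rw [hmul, ha, hc', hct, map_neg, mul_neg, Algebra.commutes])
    rw [← mul_assoc, ← Algebra.commutes, mul_assoc, mul_assoc, ← Algebra.smul_def] at h
    rw [mul_assoc]
    exact (smul_eq_zero.1 h).resolve_left ht0
  have hall : ∀ d : D, x * d * s.toLinearMap x = 0 := fun d => by
    have h1 := hsym (d + s.toLinearMap d) (by rw [map_add, hinv, add_comm])
    have h2 := hskew (d - s.toLinearMap d) (by rw [map_sub, hinv, neg_sub])
    have h3 : (2 : F) • (x * d * s.toLinearMap x) = 0 := by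
      rw [← zero_add (0 : D)]
      nth_rewrite 1 [← h1]
      nth_rewrite 1 [← h2]
      rw [two_smul]
      noncomm_ring
    exact (smul_eq_zero.1 h3).resolve_left two_ne_zero
  rcases eq_zero_or_eq_zero_of_forall_mul_mul hall with h | h
  · exact h
  · rw [← hinv x, h, map_zero]

end Definite

/-! ### The topology of the unitary groups -/

section Topological

variable {F K D ι R : Type*} [Field F] [Field K] [Algebra F K] [Ring D] [Algebra F D]
  [Algebra K D] (s : InvolutionSecondKind F K D)
  [CommRing R] [Algebra F R] [TopologicalSpace R] [IsTopologicalRing R]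

theorem isTopologicalGroup_unitaryGroup [FiniteDimensional F D] : IsTopologicalGroup (U s R) := by
  let _ : TopologicalSpace (R ⊗[F] D) := moduleTopology R (R ⊗[F] D)
  have : IsModuleTopology R (R ⊗[F] D) := ⟨rfl⟩
  have : IsTopologicalRing (R ⊗[F] D) := IsModuleTopology.isTopologicalRing R _
  have hval : Continuous fun g : U s R => ((g : (R ⊗[F] D)ˣ) : R ⊗[F] D) := continuous_induced_dom
  have hstar : Continuous (starBase s R) := IsModuleTopology.continuous_of_linearMap _
  refine { continuous_mul := ?_, continuous_inv := ?_ }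
  · exact continuous_induced_rng.2 ((hval.comp continuous_fst).mul (hval.comp continuous_snd))
  · refine continuous_induced_rng.2 ((hstar.comp hval).congr fun g => ?_)
    exact (coe_inv_eq_starBase g).symm

variable [Fintype ι] (b : Module.Basis ι F D)

/-- The image in R ⊗ D is cut out by the closed conditions xx⋆ = 1 and x⋆x = 1, inverses being given
by the involution. -/
theorem isClosedEmbedding_coords [T2Space R] : IsClosedEmbedding fun g : U s R =>
    coords b R ((g : (R ⊗[F] D)ˣ) : R ⊗[F] D) := by
  let _ : TopologicalSpace (R ⊗[F] D) := moduleTopology R (R ⊗[F] D)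
  have : IsModuleTopology R (R ⊗[F] D) := ⟨rfl⟩
  have : Module.Finite R (R ⊗[F] D) :=
    Module.Finite.of_basis (Algebra.TensorProduct.basis R b)
  have : IsTopologicalRing (R ⊗[F] D) := IsModuleTopology.isTopologicalRing R _
  let e : R ⊗[F] D ≃ₜ (ι → R) := basisHomeomorph (Algebra.TensorProduct.basis R b)
  have : T2Space (R ⊗[F] D) := e.symm.t2Space
  have hstar : Continuous (starBase s R) := IsModuleTopology.continuous_of_linearMap _
  suffices h : IsClosedEmbedding fun g : U s R => ((g : (R ⊗[F] D)ˣ) : R ⊗[F] D) from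
    e.isClosedEmbedding.comp h
  refine ⟨⟨⟨rfl⟩, ?_⟩, ?_⟩
  · exact fun g h hgh => Subtype.ext (Units.ext hgh)
  · have hrange : (Set.range fun g : U s R => ((g : (R ⊗[F] D)ˣ) : R ⊗[F] D)) =
        {x | x * starBase s R x = 1} ∩ {x | starBase s R x * x = 1} := by
      ext x
      constructor
      · rintro ⟨g, rfl⟩
        exact ⟨g.2, starBase_mul_self g⟩
      · rintro ⟨h1, h2⟩
        exact ⟨⟨⟨x, starBase s R x, h1, h2⟩, h1⟩, rfl⟩
    rw [hrange]
    exact (isClosed_eq (continuous_id.mul hstar) continuous_const).inter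
      (isClosed_eq (hstar.mul continuous_id) continuous_const)

end Topological

/-- The element of `R ⊗ D` underlying an element of `U(R)`. -/
abbrev unitVal {F K D R : Type*} [Field F] [Field K] [Algebra F K] [Ring D] [Algebra F D]
    [Algebra K D] {s : InvolutionSecondKind F K D} [CommRing R] [Algebra F R] (g : U s R) :
    R ⊗[F] D :=
  ((g : (R ⊗[F] D)ˣ) : R ⊗[F] D)

/-! ### Bounded subsets of the adelic unitary group -/

section Adeles

variable {p : ℕ} {F : Type*} [Field F] [NumberField F]

instance fact_isOpen_adicCompletionIntegers : Fact (∀ v : PlaceAway p F,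
    IsOpen (v.1.adicCompletionIntegers F : Set (v.1.adicCompletion F))) :=
  ⟨fun _ => Valued.isOpen_valuationSubring _⟩

theorem isOpen_integralAdeles :
    IsOpen {x : AdeleAway p F | ∀ v, x v ∈ v.1.adicCompletionIntegers F} :=
  RestrictedProduct.isOpen_forall_mem fun _ => Valued.isOpen_valuationSubring _

theorem isCompact_integralAdeles :
    IsCompact {x : AdeleAway p F | ∀ v, x v ∈ v.1.adicCompletionIntegers F} := by
  have : ∀ v : PlaceAway p F, CompactSpace (v.1.adicCompletionIntegers F) := fun v =>
    isCompact_iff_compactSpace.1 (isCompact_adicCompletionIntegers v.1)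
  have h := isCompact_range (RestrictedProduct.isOpenEmbedding_structureMap
    (R := fun v : PlaceAway p F => v.1.adicCompletion F)
    (A := fun v => (v.1.adicCompletionIntegers F : Set (v.1.adicCompletion F)))
    fun _ => Valued.isOpen_valuationSubring _).continuous
  rwa [RestrictedProduct.range_structureMap] at h

theorem isCompact_adeles_of_mul {m : ℕ} (hm : m ≠ 0) :
    IsCompact {x : AdeleAway p F | ∀ v, ‖(m : v.1.adicCompletion F)‖ * ‖x v‖ ≤ 1} := by
  have h : {x : AdeleAway p F | ∀ v, ‖(m : v.1.adicCompletion F)‖ * ‖x v‖ ≤ 1} =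
      (fun x => algebraMap F (AdeleAway p F) (m : F)⁻¹ * x) ''
        {x : AdeleAway p F | ∀ v, x v ∈ v.1.adicCompletionIntegers F} := by
    have hval : ∀ (a : F) (x : AdeleAway p F) (v : PlaceAway p F),
        (algebraMap F (AdeleAway p F) a * x) v = algebraMap F (v.1.adicCompletion F) a * x v :=
      fun _ _ _ => rfl
    have hm' : (m : F) ≠ 0 := Nat.cast_ne_zero.2 hm
    ext x
    constructor
    · intro hx
      refine ⟨algebraMap F (AdeleAway p F) m * x, fun v => ?_, ?_⟩
      · rw [mem_integers_iff_norm_le_one, hval, norm_mul, map_natCast]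
        exact hx v
      · change algebraMap F (AdeleAway p F) (m : F)⁻¹ * (algebraMap F (AdeleAway p F) m * x) = x
        rw [← mul_assoc, ← map_mul, inv_mul_cancel₀ hm', map_one, one_mul]
    · rintro ⟨y, hy, rfl⟩ v
      rw [hval, ← norm_mul, ← mul_assoc, ← map_natCast (algebraMap F (v.1.adicCompletion F)),
        ← map_mul, mul_inv_cancel₀ hm', map_one, one_mul]
      exact mem_integers_iff_norm_le_one.1 (hy v)
  rw [h]
  exact isCompact_integralAdeles.image (continuous_const.mul continuous_id)

theorem isOpen_adeles_of_mul (m : ℕ) :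
    IsOpen {x : AdeleAway p F | ∀ v, ‖(m : v.1.adicCompletion F)‖ * ‖x v‖ ≤ 1} := by
  have h : {x : AdeleAway p F | ∀ v, ‖(m : v.1.adicCompletion F)‖ * ‖x v‖ ≤ 1} =
      (fun x => algebraMap F (AdeleAway p F) m * x) ⁻¹'
        {x : AdeleAway p F | ∀ v, x v ∈ v.1.adicCompletionIntegers F} := by
    ext x
    refine forall_congr' fun v => ?_
    rw [mem_integers_iff_norm_le_one]
    change _ ↔ ‖algebraMap F (v.1.adicCompletion F) m * x v‖ ≤ 1
    rw [norm_mul, map_natCast]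
  rw [h]
  exact isOpen_integralAdeles.preimage (continuous_const.mul continuous_id)

theorem exists_mul_norm_adele_le (x : AdeleAway p F) :
    ∃ m : ℕ, m ≠ 0 ∧ ∀ v, ‖(m : v.1.adicCompletion F)‖ * ‖x v‖ ≤ 1 := by
  classical
  have hfin : {v : PlaceAway p F | ¬ x v ∈ v.1.adicCompletionIntegers F}.Finite := x.2
  choose n hn h using fun v : PlaceAway p F => exists_natCast_mul_norm_le_one v.1 (x v)
  refine ⟨∏ v ∈ hfin.toFinset, n v, Finset.prod_ne_zero_iff.2 fun v _ => hn v, fun v => ?_⟩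
  by_cases hv : x v ∈ v.1.adicCompletionIntegers F
  · exact mul_le_one₀ (norm_natCast_le_one v.1 _) (norm_nonneg _)
      (mem_integers_iff_norm_le_one.1 hv)
  · rw [← Finset.prod_erase_mul _ _ (hfin.mem_toFinset.2 hv), Nat.cast_mul, norm_mul, mul_assoc]
    exact mul_le_one₀ (norm_natCast_le_one v.1 _) (by positivity)
      ((norm_mul _ _).symm.le.trans (h v))

end Adeles

/-! ### Families of local components -/

section Components

variable {p : ℕ} {F K D ι : Type*} [Field F] [NumberField F] [Field K] [Algebra F K] [Ring D]
  [Algebra F D] [Algebra K D] {s : InvolutionSecondKind F K D}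

open Classical in
/-- The component at `v` of an element of `G(𝔸_f)`. -/
noncomputable def compFull (v : HeightOneSpectrum (𝓞 F)) : Gf p s →* U s (v.adicCompletion F) :=
  if h : (p : 𝓞 F) ∈ v.asIdeal then
    (Pi.evalMonoidHom (fun v : PlaceAbove p F => U s (v.1.adicCompletion F)) ⟨v, h⟩).comp
      (MonoidHom.fst _ _)
  else (compAway p s ⟨v, h⟩).comp (MonoidHom.snd _ _)

theorem compFull_above (v : PlaceAbove p F) (g : Gf p s) : compFull v.1 g = g.1 v := by
  rw [compFull, dif_pos v.2]
  rfl

theorem compFull_away (v : PlaceAway p F) (g : Gf p s) :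
    compFull v.1 g = compAway p s v g.2 := by
  rw [compFull, dif_neg v.2]
  rfl

theorem compFull_diag (v : HeightOneSpectrum (𝓞 F)) (δ : U s F) :
    compFull v (diag p s δ) = U.map s (Algebra.ofId F (v.adicCompletion F)) δ := by
  by_cases h : (p : 𝓞 F) ∈ v.asIdeal
  · exact compFull_above ⟨v, h⟩ _
  · rw [compFull_away ⟨v, h⟩]
    refine Subtype.ext (Units.ext ?_)
    change Algebra.TensorProduct.map _ _ (Algebra.TensorProduct.map _ _
      ((δ : (F ⊗[F] D)ˣ) : F ⊗[F] D)) = Algebra.TensorProduct.map _ _ _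
    rw [← AlgHom.comp_apply, ← Algebra.TensorProduct.map_comp]
    congr 2

variable [Fintype ι] (b : Module.Basis ι F D)

theorem locNorm_compAway_le_iff (v : PlaceAway p F) (g : Gaway p s) (m : ℕ) :
    ‖(m : v.1.adicCompletion F)‖ * locNorm b v.1 (unitVal (compAway p s v g)) ≤ 1 ↔
      ∀ i, ‖(m : v.1.adicCompletion F)‖ *
        ‖coords b (AdeleAway p F) (unitVal g) i v‖ ≤ 1 := by
  rw [← locNorm_smul, locNorm_le_iff b v.1 zero_le_one]
  refine forall_congr' fun i => ?_
  rw [map_smul, Pi.smul_apply, smul_eq_mul, norm_mul]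
  have h : coords b (v.1.adicCompletion F) (unitVal (compAway p s v g)) i =
      coords b (AdeleAway p F) (unitVal g) i v :=
    coords_map b (evalAway p F v) _ i
  rw [h]

variable (p s) in
/-- The elements of `G(𝔸_f)` whose components have denominators dividing `m`. -/
def boundedSet (m : ℕ) : Set (Gf p s) :=
  {g | ∀ v, ‖(m : v.adicCompletion F)‖ *
    locNorm b v (unitVal (compFull v g)) ≤ 1}

theorem boundedSet_mono {m n : ℕ} (h : m ∣ n) : boundedSet p s b m ⊆ boundedSet p s b n := by
  obtain ⟨k, rfl⟩ := h
  intro g hg v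
  rw [Nat.cast_mul, norm_mul, mul_comm ‖(m : v.adicCompletion F)‖, mul_assoc]
  exact mul_le_one₀ (norm_natCast_le_one v k)
    (mul_nonneg (norm_nonneg _) (locNorm_nonneg b v _)) (hg v)

theorem mem_boundedSet_iff {m : ℕ} {g : Gf p s} : g ∈ boundedSet p s b m ↔
    (∀ v : PlaceAbove p F, ∀ i, ‖(m : v.1.adicCompletion F)‖ *
      ‖coords b (v.1.adicCompletion F) (unitVal (g.1 v)) i‖ ≤ 1) ∧
    ∀ i, ∀ v : PlaceAway p F, ‖(m : v.1.adicCompletion F)‖ *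
        ‖coords b (AdeleAway p F) (unitVal g.2) i v‖ ≤ 1 := by
  constructor
  · intro h
    refine ⟨fun v i => ?_, fun i v => ?_⟩
    · have := h v.1
      rw [compFull_above] at this
      exact (mul_le_mul_of_nonneg_left (norm_coords_le b v.1 _ i) (norm_nonneg _)).trans this
    · have := h v.1
      rw [compFull_away] at this
      exact (locNorm_compAway_le_iff b v g.2 m).1 this i
  · rintro ⟨h1, h2⟩ v
    by_cases hv : (p : 𝓞 F) ∈ v.asIdeal
    · rw [compFull_above ⟨v, hv⟩, ← locNorm_smul, locNorm_le_iff b v zero_le_one]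
      intro i
      rw [map_smul, Pi.smul_apply, smul_eq_mul, norm_mul]
      exact h1 ⟨v, hv⟩ i
    · rw [compFull_away ⟨v, hv⟩]
      exact (locNorm_compAway_le_iff b ⟨v, hv⟩ g.2 m).2 fun i => h2 i ⟨v, hv⟩

variable (p F) in
theorem finite_placeAbove [Fact p.Prime] : Finite (PlaceAbove p F) := by
  have hp : Ideal.span {(p : 𝓞 F)} ≠ 0 := by
    rw [Ne, Ideal.zero_eq_bot, Ideal.span_singleton_eq_bot]
    exact Nat.cast_ne_zero.2 (Fact.out : p.Prime).ne_zero
  refine (Set.Finite.subset (Ideal.finite_factors hp) fun v hv => ?_).to_subtype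
  exact Ideal.dvd_iff_le.2 ((Ideal.span_singleton_le_iff_mem _).2 hv)

theorem isCompact_local_of_mul (v : HeightOneSpectrum (𝓞 F)) {m : ℕ} (hm : m ≠ 0) :
    IsCompact {x : v.adicCompletion F | ‖(m : v.adicCompletion F)‖ * ‖x‖ ≤ 1} := by
  have hm' := natCast_adicCompletion_ne_zero v hm
  have h : {x : v.adicCompletion F | ‖(m : v.adicCompletion F)‖ * ‖x‖ ≤ 1} =
      (fun x => (m : v.adicCompletion F)⁻¹ * x) '' (v.adicCompletionIntegers F) := by
    ext x
    constructor
    · intro hx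
      refine ⟨m * x, ?_, inv_mul_cancel_left₀ hm' x⟩
      rw [SetLike.mem_coe, mem_integers_iff_norm_le_one, norm_mul]
      exact hx
    · rintro ⟨y, hy, rfl⟩
      change _ * ‖(m : v.adicCompletion F)⁻¹ * y‖ ≤ 1
      rw [← norm_mul, mul_inv_cancel_left₀ hm']
      exact mem_integers_iff_norm_le_one.1 hy
  rw [h]
  exact (isCompact_adicCompletionIntegers v).image (continuous_const.mul continuous_id)

theorem isOpen_local_of_mul (v : HeightOneSpectrum (𝓞 F)) (m : ℕ) :
    IsOpen {x : v.adicCompletion F | ‖(m : v.adicCompletion F)‖ * ‖x‖ ≤ 1} := by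
  have h : {x : v.adicCompletion F | ‖(m : v.adicCompletion F)‖ * ‖x‖ ≤ 1} =
      (fun x => (m : v.adicCompletion F) * x) ⁻¹' (v.adicCompletionIntegers F) := by
    ext x
    rw [Set.mem_preimage, SetLike.mem_coe, mem_integers_iff_norm_le_one, norm_mul]
    rfl
  rw [h]
  exact (Valued.isOpen_valuationSubring _).preimage (continuous_const.mul continuous_id)

/-- In coordinates this is the trace on a closed subset of a box whose sides are m⁻¹ times the local
rings of integers. -/
theorem isCompact_boundedSet {m : ℕ} (hm : m ≠ 0) : IsCompact (boundedSet p s b m) := by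
  have hp : IsCompact {g : Gp p s | ∀ v ∈ Set.univ, g v ∈ (fun g : U s (v.1.adicCompletion F) =>
      coords b (v.1.adicCompletion F) (unitVal g)) ⁻¹'
      {x | ∀ i ∈ Set.univ, x i ∈ {y | ‖(m : v.1.adicCompletion F)‖ * ‖y‖ ≤ 1}}} :=
    isCompact_univ_pi fun v => (isClosedEmbedding_coords s b).isCompact_preimage
      (isCompact_univ_pi fun i => isCompact_local_of_mul v.1 hm)
  have ha : IsCompact ((fun g : Gaway p s =>
      coords b (AdeleAway p F) (unitVal g)) ⁻¹'
      {x | ∀ i ∈ Set.univ, x i ∈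
        {y : AdeleAway p F | ∀ v, ‖(m : v.1.adicCompletion F)‖ * ‖y v‖ ≤ 1}}) :=
    (isClosedEmbedding_coords s b).isCompact_preimage
      (isCompact_univ_pi fun i => isCompact_adeles_of_mul hm)
  convert hp.prod ha using 1
  ext g
  rw [mem_boundedSet_iff]
  simp [Set.mem_prod]

theorem isOpen_boundedSet [Fact p.Prime] (m : ℕ) : IsOpen (boundedSet p s b m) := by
  have := finite_placeAbove p F
  have h : boundedSet p s b m = (⋂ (v : PlaceAbove p F) (i : ι),
      (fun g : Gf p s => coords b (v.1.adicCompletion F)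
        (unitVal (g.1 v)) i) ⁻¹'
          {y | ‖(m : v.1.adicCompletion F)‖ * ‖y‖ ≤ 1}) ∩
      ⋂ i : ι, (fun g : Gf p s => coords b (AdeleAway p F)
        (unitVal g.2) i) ⁻¹'
        {y | ∀ v : PlaceAway p F, ‖(m : v.1.adicCompletion F)‖ * ‖y v‖ ≤ 1} := by
    ext g
    rw [mem_boundedSet_iff]
    simp
  rw [h]
  refine (isOpen_iInter_of_finite fun v => isOpen_iInter_of_finite fun i => ?_).inter
    (isOpen_iInter_of_finite fun i => ?_)
  · exact (isOpen_local_of_mul v.1 m).preimage ((continuous_apply i).comp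
      ((continuous_coords_unitaryGroup s b).comp ((continuous_apply v).comp continuous_fst)))
  · exact (isOpen_adeles_of_mul m).preimage ((continuous_apply i).comp
      ((continuous_coords_unitaryGroup s b).comp continuous_snd))

theorem exists_mem_boundedSet [Fact p.Prime] (g : Gf p s) :
    ∃ m : ℕ, m ≠ 0 ∧ g ∈ boundedSet p s b m := by
  classical
  have := finite_placeAbove p F
  cases nonempty_fintype (PlaceAbove p F)
  choose k hk h using fun z : PlaceAbove p F × ι => exists_natCast_mul_norm_le_one z.1.1
    (coords b (z.1.1.adicCompletion F) (unitVal (g.1 z.1)) z.2)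
  choose k' hk' h' using fun i => exists_mul_norm_adele_le
    (coords b (AdeleAway p F) (unitVal g.2) i)
  refine ⟨(∏ z, k z) * ∏ i, k' i, mul_ne_zero (Finset.prod_ne_zero_iff.2 fun z _ => hk z)
    (Finset.prod_ne_zero_iff.2 fun i _ => hk' i),
    (mem_boundedSet_iff b).2 ⟨fun v i => ?_, fun i v => ?_⟩⟩
  · rw [← Finset.prod_erase_mul _ _ (Finset.mem_univ (v, i)), mul_right_comm, Nat.cast_mul,
      norm_mul, mul_assoc]
    exact mul_le_one₀ (norm_natCast_le_one v.1 _) (by positivity)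
      ((norm_mul _ _).symm.le.trans (h (v, i)))
  · rw [← Finset.prod_erase_mul _ _ (Finset.mem_univ i), ← mul_assoc, Nat.cast_mul,
      norm_mul, mul_assoc]
    exact mul_le_one₀ (norm_natCast_le_one v.1 _) (by positivity) (h' i v)

/-- The bounded sets are open and exhaust G(𝔸_f); along factorials they increase. -/
theorem exists_subset_boundedSet [Fact p.Prime] {C : Set (Gf p s)} (hC : IsCompact C) :
    ∃ m : ℕ, m ≠ 0 ∧ C ⊆ boundedSet p s b m := by
  obtain ⟨m, hm⟩ := hC.elim_directed_cover (fun m : ℕ => boundedSet p s b (m + 1).factorial)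
    (fun m => isOpen_boundedSet b _)
    (fun g _ => by
      obtain ⟨m, hm, hg⟩ := exists_mem_boundedSet b g
      exact Set.mem_iUnion.2 ⟨m, boundedSet_mono b
        (Nat.dvd_factorial (Nat.pos_of_ne_zero hm) (Nat.le_succ m)) hg⟩)
    (directed_of_isDirected_le fun m n hmn =>
      boundedSet_mono b (Nat.factorial_dvd_factorial (Nat.succ_le_succ hmn)))
  exact ⟨_, Nat.factorial_ne_zero _, hm⟩

end Components

/-! ### Double cosets -/

section Movers

variable {P A Q : Type*} [Group P] [Group A] [Group Q] {ι : Q →* P × A} {H : Subgroup P}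
  {N : Subgroup A}

/-- The elements of `Q` that move `g` into `x (H × N)`. -/
def movers (ι : Q →* P × A) (H : Subgroup P) (N : Subgroup A) (x g : P × A) : Set Q :=
  {γ | x⁻¹ * ι γ * g ∈ H.prod N}

theorem mem_movers {x g : P × A} {γ : Q} :
    γ ∈ movers ι H N x g ↔ x⁻¹ * ι γ * g ∈ H.prod N := Iff.rfl

theorem movers_mul_right (x g : P × A) {c : P × A} (hc : c ∈ H.prod N) :
    movers ι H N x (g * c) = movers ι H N x g := by
  ext γ
  rw [mem_movers, mem_movers, ← mul_assoc]
  exact mul_mem_cancel_right hc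

/-- When nonempty, the set of movers of g is a coset of the stabilizer Γ_x = `movers ι H N x x`; its
cardinality is thus constant on the double coset. -/
theorem movers_eq_image {x g : P × A} {γ₀ : Q} (h : γ₀ ∈ movers ι H N x g) :
    movers ι H N x g = (fun γ => γ * γ₀) '' movers ι H N x x := by
  have key : ∀ γ, x⁻¹ * ι (γ * γ₀) * g = (x⁻¹ * ι γ * x) * (x⁻¹ * ι γ₀ * g) := fun γ => by
    rw [map_mul]; group
  ext γ
  constructor
  · intro hγ
    refine ⟨γ * γ₀⁻¹, ?_, inv_mul_cancel_right γ γ₀⟩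
    have h1 := key (γ * γ₀⁻¹)
    rw [inv_mul_cancel_right] at h1
    have hγ' : x⁻¹ * ι γ * g ∈ H.prod N := hγ
    rw [h1] at hγ'
    exact (mul_mem_cancel_right h).1 hγ'
  · rintro ⟨γ, hγ, rfl⟩
    change x⁻¹ * ι (γ * γ₀) * g ∈ H.prod N
    rw [key]
    exact mul_mem hγ h

theorem movers_finite (hfin : ∀ x, (movers ι H N x x).Finite) (x g : P × A) :
    (movers ι H N x g).Finite := by
  rcases (movers ι H N x g).eq_empty_or_nonempty with h | ⟨γ₀, h⟩
  · rw [h]; exact Set.finite_empty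
  · rw [movers_eq_image h]
    exact (hfin x).image _

end Movers

/-! ### Functions on a compact open subgroup and automorphic functions -/

section Automorphic

variable {P A Q : Type*} [Group P] [Group A] [Group Q] [TopologicalSpace P]
  {ι : Q →* P × A} {H : Subgroup P} {N : Subgroup A} {L : Type*} [NormedField L]

open Classical in
/-- The function on `P × A` which is equal to `b` on `H × N` and vanishes elsewhere. -/
noncomputable def extendByZero (N : Subgroup A) (b : C(H, L)) (y : P × A) : L :=
  if h : y.1 ∈ H ∧ y.2 ∈ N then b ⟨y.1, h.1⟩ else 0

theorem extendByZero_of_mem (b : C(H, L)) {y : P × A} (h : y.1 ∈ H) (h' : y.2 ∈ N) :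
    extendByZero N b y = b ⟨y.1, h⟩ := dif_pos ⟨h, h'⟩

theorem extendByZero_of_notMem (b : C(H, L)) {y : P × A} (h : y ∉ H.prod N) :
    extendByZero N b y = 0 := dif_neg h

theorem support_extendByZero_subset (b : C(H, L)) (x g : P × A) :
    (Function.support fun γ : Q => extendByZero N b (x⁻¹ * ι γ * g)) ⊆ movers ι H N x g := by
  intro γ hγ
  by_contra h
  exact hγ (extendByZero_of_notMem b h)

theorem extendByZero_add (b b' : C(H, L)) (y : P × A) :
    extendByZero N (b + b') y = extendByZero N b y + extendByZero N b' y := by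
  by_cases h : y ∈ H.prod N
  · simp [extendByZero_of_mem _ h.1 h.2]
  · simp [extendByZero_of_notMem _ h]

theorem extendByZero_smul (c : L) (b : C(H, L)) (y : P × A) :
    extendByZero N (c • b) y = c * extendByZero N b y := by
  by_cases h : y ∈ H.prod N
  · simp [extendByZero_of_mem _ h.1 h.2]
  · simp [extendByZero_of_notMem _ h]

theorem extendByZero_mul_right (b : C(H, L)) (y : P × A) {u : A} (hu : u ∈ N) :
    extendByZero N b (y * (1, u)) = extendByZero N b y := by
  by_cases h : y ∈ H.prod N
  · rw [extendByZero_of_mem _ h.1 h.2, extendByZero_of_mem _ (y := y * (1, u))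
      (by simpa using h.1) (mul_mem h.2 hu)]
    congr 1
    exact Subtype.ext (mul_one _)
  · rw [extendByZero_of_notMem _ h, extendByZero_of_notMem]
    intro h'
    exact h ⟨by simpa using h'.1, (mul_mem_cancel_right hu).1 h'.2⟩

theorem norm_extendByZero_le [CompactSpace H] (b : C(H, L)) (y : P × A) :
    ‖extendByZero N b y‖ ≤ ‖b‖ := by
  by_cases h : y ∈ H.prod N
  · rw [extendByZero_of_mem _ h.1 h.2]
    exact b.norm_coe_le_norm _
  · rw [extendByZero_of_notMem _ h, norm_zero]
    exact norm_nonneg _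

/-- The automorphic function attached to a function `b` on `H` and a point `x`. -/
noncomputable def thetaFun (ι : Q →* P × A) (N : Subgroup A) (x : P × A) (b : C(H, L))
    (g : P × A) : L :=
  ∑ᶠ γ : Q, extendByZero N b (x⁻¹ * ι γ * g)

theorem thetaFun_eq_sum (hfin : ∀ x, (movers ι H N x x).Finite) (x : P × A) (b : C(H, L))
    (g : P × A) : thetaFun ι N x b g =
      ∑ γ ∈ (movers_finite hfin x g).toFinset, extendByZero N b (x⁻¹ * ι γ * g) :=
  finsum_eq_sum_of_support_subset _ (by simpa using support_extendByZero_subset b x g)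

/-- By the ultrametric inequality the number of terms in the sum does not matter. -/
theorem norm_thetaFun_le [IsUltrametricDist L] [CompactSpace H]
    (hfin : ∀ x, (movers ι H N x x).Finite) (x : P × A) (b : C(H, L)) (g : P × A) :
    ‖thetaFun ι N x b g‖ ≤ ‖b‖ := by
  rw [thetaFun_eq_sum hfin]
  exact IsUltrametricDist.norm_sum_le_of_forall_le_of_nonneg (norm_nonneg _)
    fun γ _ => norm_extendByZero_le b _

variable [TopologicalSpace A]

theorem isOpen_prod_subgroup (hH : IsOpen (H : Set P)) (hN : IsOpen (N : Set A)) :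
    IsOpen ((H.prod N : Subgroup (P × A)) : Set (P × A)) := by
  rw [Subgroup.coe_prod]
  exact hH.prod hN

variable [ContinuousMul P] [ContinuousMul A]

theorem continuous_extendByZero (hH : IsOpen (H : Set P)) (hN : IsOpen (N : Set A)) (b : C(H, L)) :
    Continuous (extendByZero N b) := by
  have hC := isOpen_prod_subgroup hH hN
  rw [continuous_iff_continuousAt]
  intro y
  by_cases h : y ∈ H.prod N
  · refine (hC.isOpenEmbedding_subtypeVal.continuousAt_iff (x := ⟨y, h⟩)).1 ?_
    have heq : extendByZero N b ∘ Subtype.val =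
        fun z : ((H.prod N : Subgroup (P × A)) : Set (P × A)) => b ⟨z.1.1, z.2.1⟩ := by
      funext z
      exact extendByZero_of_mem b z.2.1 z.2.2
    rw [heq]
    exact (b.continuous.comp ((continuous_fst.comp continuous_subtype_val).subtype_mk _)).continuousAt
  · have hcl : IsClosed ((H.prod N : Subgroup (P × A)) : Set (P × A)) :=
      (H.prod N).isClosed_of_isOpen hC
    refine (continuousAt_const (y := (0 : L))).congr ?_
    filter_upwards [hcl.isOpen_compl.mem_nhds h] with z hz
    exact (extendByZero_of_notMem b hz).symm

/-- On the open neighbourhood g(H × N) of g the set of relevant γ is constant, so the function is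
there a fixed finite sum of continuous functions. -/
theorem continuous_thetaFun (hH : IsOpen (H : Set P)) (hN : IsOpen (N : Set A))
    (hfin : ∀ x, (movers ι H N x x).Finite) (x : P × A) (b : C(H, L)) :
    Continuous (thetaFun ι N x b) := by
  rw [continuous_iff_continuousAt]
  intro g
  have hcont : Continuous fun y => ∑ γ ∈ (movers_finite hfin x g).toFinset,
      extendByZero N b (x⁻¹ * ι γ * y) :=
    continuous_finsetSum _ fun γ _ =>
      (continuous_extendByZero hH hN b).comp (continuous_const.mul continuous_id)
  refine hcont.continuousAt.congr ?_
  have hopen : IsOpen {y | g⁻¹ * y ∈ H.prod N} :=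
    (isOpen_prod_subgroup hH hN).preimage (continuous_const.mul continuous_id)
  filter_upwards [hopen.mem_nhds (show g⁻¹ * g ∈ H.prod N by rw [inv_mul_cancel]; exact one_mem _)]
    with y hy
  rw [thetaFun_eq_sum hfin]
  refine Finset.sum_congr ?_ fun _ _ => rfl
  ext γ
  rw [Set.Finite.mem_toFinset, Set.Finite.mem_toFinset, ← mul_inv_cancel_left g y,
    movers_mul_right x g hy]

/-- The map `C(H, L) → H̃⁰` attached to a point `x`. -/
noncomputable def theta [IsUltrametricDist L] [CompactSpace H] (hH : IsOpen (H : Set P))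
    (hN : IsOpen (N : Set A)) (hfin : ∀ x, (movers ι H N x x).Finite) (x : P × A) :
    C(H, L) →L[L] H0 ι N L :=
  LinearMap.mkContinuous
    { toFun := fun b => ⟨BoundedContinuousFunction.ofNormedAddCommGroup (thetaFun ι N x b)
          (continuous_thetaFun hH hN hfin x b) ‖b‖ (norm_thetaFun_le hfin x b), fun γ g u hu => by
        change ∑ᶠ δ : Q, extendByZero N b (x⁻¹ * ι δ * (ι γ * g * (1, u))) =
          ∑ᶠ δ : Q, extendByZero N b (x⁻¹ * ι δ * g)
        rw [← finsum_comp_equiv (Equiv.mulRight γ)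
          (f := fun δ : Q => extendByZero N b (x⁻¹ * ι δ * g))]
        refine finsum_congr fun δ => ?_
        rw [← mul_assoc, extendByZero_mul_right _ _ hu]
        congr 1
        simp [mul_assoc]⟩
      map_add' := fun b b' => H0.ext fun g => by
        change thetaFun ι N x (b + b') g = thetaFun ι N x b g + thetaFun ι N x b' g
        simp only [thetaFun_eq_sum hfin, extendByZero_add, Finset.sum_add_distrib]
      map_smul' := fun c b => H0.ext fun g => by
        change thetaFun ι N x (c • b) g = c * thetaFun ι N x b g
        simp only [thetaFun_eq_sum hfin, extendByZero_smul, Finset.mul_sum] }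
    1 (fun b => by
      rw [one_mul]
      exact BoundedContinuousFunction.norm_ofNormedAddCommGroup_le _ (norm_nonneg _)
        (norm_thetaFun_le hfin x b))

theorem theta_apply [IsUltrametricDist L] [CompactSpace H] (hH : IsOpen (H : Set P))
    (hN : IsOpen (N : Set A)) (hfin : ∀ x, (movers ι H N x x).Finite) (x : P × A)
    (b : C(H, L)) (g : P × A) : (theta hH hN hfin x b).toFun g = thetaFun ι N x b g := rfl

/-- Right translation of functions on `H`. -/
noncomputable def rightTranslate (k : H) (b : C(H, L)) : C(H, L) :=
  b.comp ⟨fun h => h * k, ((continuous_mul_const (k : P)).comp continuous_subtype_val).subtype_mk _⟩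

/-- Translation by k ∈ H preserves H × N, so it commutes with extension by zero. -/
theorem translate_theta [IsUltrametricDist L] [CompactSpace H] (hH : IsOpen (H : Set P))
    (hN : IsOpen (N : Set A)) (hfin : ∀ x, (movers ι H N x x).Finite) (x : P × A) (k : H)
    (b : C(H, L)) :
    translate (k : P) (theta hH hN hfin x b) = theta hH hN hfin x (rightTranslate k b) := by
  refine H0.ext fun g => finsum_congr fun γ => ?_
  change extendByZero N b (x⁻¹ * ι γ * (g * ((k : P), 1))) = _
  rw [← mul_assoc]
  set y := x⁻¹ * ι γ * g
  by_cases h : y ∈ H.prod N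
  · rw [extendByZero_of_mem _ h.1 h.2, extendByZero_of_mem _ (y := y * ((k : P), 1))
      (mul_mem h.1 k.2) (by simpa using h.2)]
    rfl
  · rw [extendByZero_of_notMem _ h, extendByZero_of_notMem]
    intro h'
    exact h ⟨(mul_mem_cancel_right k.2).1 h'.1, by simpa using h'.2⟩

/-- The restriction of an element of `H̃⁰` to `x H`. -/
def H0.restrict (H : Subgroup P) (x : P × A) (f : H0 ι N L) : C(H, L) where
  toFun h := f.toFun (x * ((h : P), 1))
  continuous_toFun := f.1.continuous.comp
    (continuous_const.mul (continuous_subtype_val.prodMk continuous_const))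

theorem H0.toFun_eq_restrict (f : H0 ι N L) {x g : P × A} {γ : Q}
    (hγ : γ ∈ movers ι H N x g) : f.toFun g = f.restrict H x ⟨(x⁻¹ * ι γ * g).1, hγ.1⟩ := by
  change f.1 g = f.1 (x * ((x⁻¹ * ι γ * g).1, 1))
  rw [← f.2 γ g _ (inv_mem hγ.2)]
  congr 1
  ext1
  · simp [mul_assoc]
  · simp [mul_assoc]

/-- Each mover γ of g contributes exactly f(g), because f is invariant under γ on the left and under
N on the right. -/
theorem theta_restrict [IsUltrametricDist L] [CompactSpace H] (hH : IsOpen (H : Set P))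
    (hN : IsOpen (N : Set A)) (hfin : ∀ x, (movers ι H N x x).Finite) (x : P × A)
    (f : H0 ι N L) (g : P × A) :
    (theta hH hN hfin x (f.restrict H x)).toFun g = (movers ι H N x g).ncard • f.toFun g := by
  rw [theta_apply, thetaFun_eq_sum hfin, Set.ncard_eq_toFinset_card _ (movers_finite hfin x g),
    ← Finset.sum_const]
  refine Finset.sum_congr rfl fun γ hγ => ?_
  have hγ' : x⁻¹ * ι γ * g ∈ H.prod N := mem_movers.1 ((Set.Finite.mem_toFinset _).1 hγ)
  rw [extendByZero_of_mem _ hγ'.1 hγ'.2, ← f.toFun_eq_restrict (mem_movers.2 hγ')]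

/-- If `P × A` is a finite union of double cosets, then there are finitely many representatives
such that elements of `H̃⁰` are combinations of the functions attached to their restrictions. -/
theorem exists_sum_theta [CharZero L] [IsUltrametricDist L] [CompactSpace H]
    (hH : IsOpen (H : Set P))
    (hN : IsOpen (N : Set A)) (hfin : ∀ x, (movers ι H N x x).Finite)
    (hcover : ∃ X : Set (P × A), X.Finite ∧ ∀ g, ∃ x ∈ X, (movers ι H N x g).Nonempty) :
    ∃ (X : Finset (P × A)) (c : P × A → L), ∀ f : H0 ι N L,
      ∑ x ∈ X, c x • theta hH hN hfin x (f.restrict H x) = f := by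
  classical
  -- This is the double coset relation. With one representative per class, a single term of the sum
  -- survives at any given g.
  let r : Setoid (P × A) :=
    { r := fun x g => (movers ι H N x g).Nonempty
      iseqv :=
        { refl := fun x => ⟨1, by
            change x⁻¹ * ι 1 * x ∈ H.prod N
            rw [map_one, mul_one, inv_mul_cancel]
            exact one_mem _⟩
          symm := fun {x g} ⟨γ, hγ⟩ => ⟨γ⁻¹, by
            change g⁻¹ * ι γ⁻¹ * x ∈ H.prod N
            have := inv_mem (mem_movers.1 hγ)
            simpa [mul_assoc] using this⟩
          trans := fun {x g y} ⟨γ, hγ⟩ ⟨δ, hδ⟩ => ⟨γ * δ, by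
            change x⁻¹ * ι (γ * δ) * y ∈ H.prod N
            have := mul_mem (mem_movers.1 hγ) (mem_movers.1 hδ)
            simpa [mul_assoc] using this⟩ } }
  obtain ⟨X, hX, hcov⟩ := hcover
  have : Finite (Quotient r) := by
    refine Set.finite_univ_iff.1 ((hX.image (Quotient.mk r)).subset fun q _ => ?_)
    induction q using Quotient.inductionOn with
    | h g =>
      obtain ⟨x, hx, h⟩ := hcov g
      exact ⟨x, hx, Quotient.sound h⟩
  cases nonempty_fintype (Quotient r)
  -- The weights are inverses of stabilizer orders, available in characteristic zero; no smallness
  -- of the level is needed.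
  refine ⟨Finset.univ.image fun q : Quotient r => q.out, fun x => ((movers ι H N x x).ncard : L)⁻¹,
    fun f => H0.ext fun g => ?_⟩
  rw [Finset.sum_image fun q _ q' _ h => by
    rw [← Quotient.out_eq q, h, Quotient.out_eq]]
  have heval : ∀ (T : Finset (Quotient r)) (F : Quotient r → H0 ι N L),
      (∑ q ∈ T, F q).toFun g = ∑ q ∈ T, (F q).toFun g := fun T F => by
    induction T using Finset.induction_on with
    | empty => rfl
    | insert q T hq ih => rw [Finset.sum_insert hq, Finset.sum_insert hq, ← ih]; rfl
  rw [heval, Finset.sum_eq_single (Quotient.mk r g)]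
  · obtain ⟨γ, hγ⟩ : (movers ι H N (Quotient.mk r g).out g).Nonempty :=
      Quotient.exact (s := r) (Quotient.out_eq _)
    change ((movers ι H N (Quotient.mk r g).out (Quotient.mk r g).out).ncard : L)⁻¹ *
      (theta hH hN hfin _ (f.restrict H _)).toFun g = _
    have hcard : (movers ι H N (Quotient.mk r g).out g).ncard =
        (movers ι H N (Quotient.mk r g).out (Quotient.mk r g).out).ncard := by
      rw [movers_eq_image hγ, Set.ncard_image_of_injective _ (mul_left_injective γ)]
    have hpos : (movers ι H N (Quotient.mk r g).out g).ncard ≠ 0 :=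
      Set.ncard_ne_zero_of_mem hγ (movers_finite hfin _ g)
    rw [theta_restrict, ← hcard, nsmul_eq_mul, inv_mul_cancel_left₀ (Nat.cast_ne_zero.2 hpos)]
  · intro q _ hq
    change ((movers ι H N q.out q.out).ncard : L)⁻¹ *
      (theta hH hN hfin _ (f.restrict H _)).toFun g = 0
    have hempty : movers ι H N q.out g = ∅ := by
      by_contra h
      refine hq ?_
      rw [← Quotient.out_eq q]
      exact Quotient.sound (Set.nonempty_iff_ne_empty.2 h)
    rw [theta_restrict, hempty, Set.ncard_empty, zero_smul, mul_zero]
  · intro h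
    exact absurd (Finset.mem_univ _) h

theorem theta_sum_mul [IsUltrametricDist L] [CompactSpace H] (hH : IsOpen (H : Set P))
    (hN : IsOpen (N : Set A)) (hfin : ∀ x, (movers ι H N x x).Finite) (x : P × A) {k : ℕ}
    (c : Fin k → L) (y : Fin k → C(H, L)) {b : C(H, L)} (h : ∀ h, b h = ∑ i, c i * y i h) :
    theta hH hN hfin x b = ∑ i, c i • theta hH hN hfin x (y i) := by
  have hb : b = ∑ i, c i • y i := by
    ext g
    rw [h, ContinuousMap.sum_apply]
    rfl
  rw [hb, map_sum]
  simp only [map_smul]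

/-- If an algebra of functions on `H`, stable under right translations, is dense in `C(H, L)`, and
its elements satisfy an addition theorem, then the algebraic vectors are dense in `H̃⁰`. -/
theorem dense_isAlgebraicVector [CharZero L] [IsUltrametricDist L] [CompactSpace H]
    (hH : IsOpen (H : Set P)) (hN : IsOpen (N : Set A))
    (hfin : ∀ x, (movers ι H N x x).Finite)
    (hcover : ∃ X : Set (P × A), X.Finite ∧ ∀ g, ∃ x ∈ X, (movers ι H N x g).Nonempty)
    (B : Subalgebra L (H → L)) (hB : ∀ a ∈ B, ∀ g, (fun k => a (k * g)) ∈ B)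
    (hexp : ∀ a ∈ B, ∃ (k : ℕ) (c : Fin k → H → L) (y : Fin k → C(H, L)), (∀ i, c i ∈ B) ∧
      ∀ g h, a (h * g) = ∑ i, c i g * y i h)
    (hdense : Dense {b : C(H, L) | (b : H → L) ∈ B}) :
    Dense {f : H0 ι N L | IsAlgebraicVector B ((rightRegular ι N L).comp H.subtype) f} := by
  obtain ⟨X, a, hX⟩ := exists_sum_theta (L := L) hH hN hfin hcover
  -- Ψ is a continuous surjection, so it carries the dense set of tuples with entries in B to a
  -- dense subset of H̃⁰.
  let Ψ : (X → C(H, L)) → H0 ι N L := fun b => ∑ x : X, a x • theta hH hN hfin x.1 (b x)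
  have hΨ : Continuous Ψ := continuous_finsetSum _ fun x _ =>
    ((theta hH hN hfin x.1).continuous.comp (continuous_apply x)).const_smul (a x)
  have hsurj : Function.Surjective Ψ := fun f =>
    ⟨fun x => f.restrict H x.1, by
      conv_rhs => rw [← hX f, ← Finset.sum_coe_sort]⟩
  refine (hsurj.denseRange.dense_image hΨ (dense_pi Set.univ fun x _ => hdense)).mono ?_
  rintro _ ⟨b, hb, rfl⟩
  choose k c y hc hy using fun x : X => hexp (b x) (hb x (Set.mem_univ x))
  refine isAlgebraicVector_of_expansion hB (ι := Σ x : X, Fin (k x)) (fun i => c i.1 i.2)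
    (fun i => hc i.1 i.2) (fun i => a i.1 • theta hH hN hfin i.1.1 (y i.1 i.2)) fun g => ?_
  change translate (g : P) (Ψ b) = _
  rw [finsum_eq_sum_of_fintype, Fintype.sum_sigma, map_sum]
  refine Finset.sum_congr rfl fun x _ => ?_
  rw [map_smul, translate_theta, theta_sum_mul hH hN hfin x.1 (fun i => c x i g) (y x)
    (fun h => hy x g h), Finset.smul_sum]
  exact Finset.sum_congr rfl fun i _ => smul_comm _ _ _

end Automorphic

/-! ### Algebraic vectors in localizations -/

section Localization

variable {L H Γ : Type*} [NormedField L] [NormedAddCommGroup H] [NormedSpace L H] [Group Γ]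

/-- The canonical map `H → H_𝔪` as a linear map. -/
noncomputable def toLocLinear {B : Subring (H →L[L] H)} (m : Ideal (CenterRing B)) [m.IsPrime] :
    H →ₗ[L] LocModule m where
  toFun := toLocModule m
  map_add' f g := TensorProduct.add_tmul f g _
  map_smul' _ _ := rfl

/-- The map H → H_𝔪 is continuous for the quotient topology and equivariant. As it is surjective, it
preserves both density and algebraic vectors. -/
theorem dense_isAlgebraicVector_loc {B : Subring (H →L[L] H)} (m : Ideal (CenterRing B))
    [m.IsPrime] (hm : Function.Surjective (toLocModule m)) (A : Subalgebra L (Γ → L))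
    (ρ : Representation L Γ H) (hρ : ∀ g, ∀ φ ∈ B, ∀ f, φ (ρ g f) = ρ g (φ f))
    (hdense : Dense {f : H | IsAlgebraicVector A ρ f}) :
    Dense {x : LocModule m | IsAlgebraicVector A (locRep m ρ hρ) x} := by
  refine (hm.denseRange.dense_image continuous_coinduced_rng hdense).mono ?_
  rintro _ ⟨f, hf, rfl⟩
  exact IsAlgebraicVector.map (toLocLinear m) (fun g x => rfl) hf

end Localization

/-! ### Completeness of `H̃⁰` and recurrence of Hecke operators -/

section Recurrence

variable {P A Q : Type*} [Group P] [Group A] [Group Q] [TopologicalSpace P] [TopologicalSpace A]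
  {ι : Q →* P × A} {H : Subgroup P} {N : Subgroup A} {L : Type*} [NormedField L]

theorem H0.norm_toFun_le (f : H0 ι N L) (x : P × A) : ‖f.toFun x‖ ≤ ‖f‖ :=
  BoundedContinuousFunction.norm_coe_le_norm f.1 x

theorem H0.norm_le {f : H0 ι N L} {r : ℝ} (hr : 0 ≤ r) : ‖f‖ ≤ r ↔ ∀ x, ‖f.toFun x‖ ≤ r :=
  BoundedContinuousFunction.norm_le hr

theorem H0.sub_toFun (f g : H0 ι N L) (x : P × A) : (f - g).toFun x = f.toFun x - g.toFun x := rfl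

instance H0.instIsUltrametricDist [IsUltrametricDist L] : IsUltrametricDist (H0 ι N L) :=
  IsUltrametricDist.isUltrametricDist_of_forall_norm_add_le_max_norm fun f g =>
    (H0.norm_le (le_max_of_le_left (norm_nonneg f))).2 fun x =>
      (IsUltrametricDist.norm_add_le_max (f.toFun x) (g.toFun x)).trans
        (max_le_max (f.norm_toFun_le x) (g.norm_toFun_le x))

instance H0.instCompleteSpace [CompleteSpace L] : CompleteSpace (H0 ι N L) := by
  have hcl : IsClosed (invariantFunctions ι N L : Set (BoundedContinuousFunction (P × A) L)) := by
    have h : (invariantFunctions ι N L : Set (BoundedContinuousFunction (P × A) L)) =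
        ⋂ (γ : Q) (x : P × A) (u : A) (_ : u ∈ N), {f | f (ι γ * x * (1, u)) = f x} := by
      ext f
      simp only [Set.mem_iInter]
      rfl
    rw [h]
    refine isClosed_iInter fun γ => isClosed_iInter fun x => isClosed_iInter fun u =>
      isClosed_iInter fun _ => ?_
    exact isClosed_eq (continuous_eval_const _)
      (continuous_eval_const _)
  exact hcl.completeSpace_coe

theorem norm_finsum_le_of_forall_le {α E : Type*} [NormedAddCommGroup E] [IsUltrametricDist E]
    {f : α → E} {r : ℝ} (hr : 0 ≤ r) (h : ∀ a, ‖f a‖ ≤ r) : ‖∑ᶠ a, f a‖ ≤ r := by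
  by_cases hf : (Function.support f).Finite
  · rw [finsum_eq_sum_of_support_subset f (s := hf.toFinset) (by simp)]
    exact IsUltrametricDist.norm_sum_le_of_forall_le_of_nonneg hr fun a _ => h a
  · rw [finsum_of_infinite_support hf, norm_zero]
    exact hr

/-- A Hecke operator sums values of f, so the ultrametric inequality makes it a contraction. A sum
with infinite support has the default value 0, which satisfies the same bound. -/
theorem norm_heckeImage_le [IsUltrametricDist L] {X : Set A} {φ : H0 ι N L →L[L] H0 ι N L}
    (hφ : φ ∈ heckeImage ι N L X) (f : H0 ι N L) : ‖φ f‖ ≤ ‖f‖ := by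
  induction hφ using Subring.closure_induction generalizing f with
  | mem φ hφ =>
    rcases hφ with ⟨g, -, hg⟩ | ⟨a, ha, rfl⟩
    · refine (H0.norm_le (norm_nonneg _)).2 fun x => ?_
      rw [hg]
      exact norm_finsum_le_of_forall_le (norm_nonneg _) fun c => f.norm_toFun_le _
    · rw [_root_.smul_apply, ContinuousLinearMap.id_apply, norm_smul]
      exact mul_le_of_le_one_left (norm_nonneg _) ha
  | zero => simp
  | one => exact le_rfl
  | add φ ψ _ _ hφ hψ =>
    exact (IsUltrametricDist.norm_add_le_max (φ f) (ψ f)).trans (max_le (hφ f) (hψ f))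
  | neg φ _ hφ => rw [_root_.neg_apply, norm_neg]; exact hφ f
  | mul φ ψ _ _ hφ hψ => exact (hφ _).trans (hψ f)

theorem norm_pointwiseClosure_le {E : Type*} [NormedAddCommGroup E] [NormedSpace L E]
    {B : Subring (E →L[L] E)} (hB : ∀ φ ∈ B, ∀ f, ‖φ f‖ ≤ ‖f‖) {φ : E →L[L] E}
    (hφ : φ ∈ pointwiseClosure B) (f : E) : ‖φ f‖ ≤ ‖f‖ := by
  have hcl : IsClosed {a : E → E | ‖a f‖ ≤ ‖f‖} :=
    isClosed_le (continuous_apply f).norm continuous_const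
  refine closure_minimal ?_ hcl hφ
  rintro _ ⟨a, ha, rfl⟩
  exact hB a ha f

variable [ContinuousMul P] [ContinuousMul A]

/-- The translates of an element of `H̃⁰` by a compact subgroup form a totally bounded set. -/
theorem exists_finite_translates [CompactSpace H]
    (hcover : ∃ X : Set (P × A), X.Finite ∧ ∀ g, ∃ x ∈ X, (movers ι H N x g).Nonempty)
    (f : H0 ι N L) {ε : ℝ} (hε : 0 < ε) :
    ∃ Y : Set H, Y.Finite ∧ ∀ k : H, ∃ y ∈ Y, ‖translate (k : P) f - translate (y : P) f‖ ≤ ε := by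
  obtain ⟨X, hX, hcov⟩ := hcover
  have := hX.fintype
  -- T sends k to the functions h ↦ f(xhk); it is continuous by currying, so its image is compact
  -- and covered by finitely many balls.
  let T : C(H, X → C(H, L)) := ⟨fun k x => ContinuousMap.curry
    ⟨fun z : H × H => f.toFun (x.1 * (((z.2 : P) * z.1 : P), 1)), f.1.continuous.comp
      (continuous_const.mul (((continuous_subtype_val.comp continuous_snd).mul
        (continuous_subtype_val.comp continuous_fst)).prodMk continuous_const))⟩ k,
    continuous_pi fun x => ContinuousMap.continuous _⟩
  obtain ⟨t, ht, htfin, htcov⟩ := (isCompact_range T.continuous).finite_cover_balls hε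
  choose! k hk using fun y (hy : y ∈ t) => ht hy
  refine ⟨k '' t, htfin.image k, fun k₀ => ?_⟩
  obtain ⟨y, hy, hball⟩ := Set.mem_iUnion₂.1 (htcov ⟨k₀, rfl⟩)
  refine ⟨k y, ⟨y, hy, rfl⟩, (H0.norm_le hε.le).2 fun g => ?_⟩
  obtain ⟨x, hx, γ, hγ⟩ := hcov g
  rw [H0.sub_toFun, H0.toFun_eq_restrict _ hγ, H0.toFun_eq_restrict _ hγ, ← dist_eq_norm]
  set h : H := ⟨(x⁻¹ * ι γ * g).1, hγ.1⟩
  have h1 : ∀ k' : H, (translate (k' : P) f).restrict H x h = T k' ⟨x, hx⟩ h := fun k' => by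
    change f.toFun (x * ((h : P), 1) * ((k' : P), 1)) = f.toFun (x * (((h : P) * k' : P), 1))
    congr 1
    ext1 <;> simp [mul_assoc]
  rw [h1, h1]
  refine (ContinuousMap.dist_apply_le_dist h).trans ((dist_le_pi_dist _ _ _).trans ?_)
  rw [Metric.mem_ball, ← hk y hy] at hball
  exact hball.le

/-- The powers of an operator on `H̃⁰` which is a contraction and commutes with translations are
recurrent. -/
theorem exists_pow_close [CompactSpace H] [ProperSpace L]
    (hcover : ∃ X : Set (P × A), X.Finite ∧ ∀ g, ∃ x ∈ X, (movers ι H N x g).Nonempty)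
    {φ : ℕ → H0 ι N L →L[L] H0 ι N L} (hφ : ∀ n f, ‖φ n f‖ ≤ ‖f‖)
    (hcomm : ∀ n (k : P) f, φ n (translate k f) = translate k (φ n f)) (f : H0 ι N L)
    {ε : ℝ} (hε : 0 < ε) : ∃ i j, i < j ∧ ‖φ i f - φ j f‖ ≤ ε := by
  -- The operators commute with translations and contract, so φ_n f at xh is within ε/4 of its value
  -- at some xy with y ∈ Y, uniformly in n. Finitely many values in a compact ball of L thus
  -- determine φ_n f up to ε, and the pigeonhole principle applies.
  obtain ⟨Y, hY, hYf⟩ := exists_finite_translates hcover f (show 0 < ε / 4 by positivity)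
  obtain ⟨X, hX, hcov⟩ := hcover
  have := hX.to_subtype
  have := hY.to_subtype
  obtain ⟨t, -, htfin, htcov⟩ := (isCompact_closedBall (0 : L) ‖f‖).finite_cover_balls
    (show 0 < ε / 4 by positivity)
  have := htfin.to_subtype
  have hval : ∀ (n : ℕ) (x : X) (y : Y), ∃ c : t,
      ‖(φ n f).toFun (x.1 * ((y.1 : P), 1)) - c‖ ≤ ε / 4 := fun n x y => by
    have hmem : (φ n f).toFun (x.1 * ((y.1 : P), 1)) ∈ Metric.closedBall (0 : L) ‖f‖ := by
      rw [mem_closedBall_zero_iff]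
      exact ((φ n f).norm_toFun_le _).trans (hφ n f)
    obtain ⟨c, hc, hball⟩ := Set.mem_iUnion₂.1 (htcov hmem)
    rw [Metric.mem_ball, dist_eq_norm] at hball
    exact ⟨⟨c, hc⟩, hball.le⟩
  choose c hc using hval
  obtain ⟨i, j, hij, hcij⟩ : ∃ i j, i < j ∧ c i = c j := by
    obtain ⟨i, j, hne, h⟩ := Finite.exists_ne_map_eq_of_infinite c
    rcases lt_or_gt_of_ne hne with h' | h'
    · exact ⟨i, j, h', h⟩
    · exact ⟨j, i, h', h.symm⟩
  refine ⟨i, j, hij, (H0.norm_le hε.le).2 fun g => ?_⟩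
  obtain ⟨x, hx, γ, hγ⟩ := hcov g
  obtain ⟨y, hy, hky⟩ := hYf ⟨(x⁻¹ * ι γ * g).1, hγ.1⟩
  have hclose : ∀ n, ‖(φ n f).toFun g - (φ n f).toFun (x * ((y : P), 1))‖ ≤ ε / 4 := fun n => by
    rw [H0.toFun_eq_restrict _ hγ]
    have h1 := ((hφ n _).trans hky)
    rw [map_sub, hcomm, hcomm] at h1
    exact (H0.norm_toFun_le _ x).trans h1
  have h1 := hclose i
  have h2 := hclose j
  have h3 := hc i ⟨x, hx⟩ ⟨y, hy⟩
  have h4 := hc j ⟨x, hx⟩ ⟨y, hy⟩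
  rw [← hcij] at h4
  rw [H0.sub_toFun]
  set u := (φ i f).toFun g
  set u' := (φ j f).toFun g
  set w := (φ i f).toFun (x * ((y : P), 1))
  set w' := (φ j f).toFun (x * ((y : P), 1))
  set z : L := (c i ⟨x, hx⟩ ⟨y, hy⟩ : L)
  calc ‖u - u'‖ = ‖(u - w) + (w - z) - (w' - z) - (u' - w')‖ := by congr 1; ring
    _ ≤ ‖u - w‖ + ‖w - z‖ + ‖w' - z‖ + ‖u' - w'‖ :=
        (norm_sub_le _ _).trans (add_le_add_left ((norm_sub_le _ _).trans
          (add_le_add_left (norm_add_le _ _) _)) _)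
    _ ≤ ε := by linarith

theorem H0.toLocModule_surjective [CompactSpace H] [ProperSpace L] [IsUltrametricDist L]
    (hcover : ∃ X : Set (P × A), X.Finite ∧ ∀ g, ∃ x ∈ X, (movers ι H N x g).Nonempty)
    (X : Set A) (m : Ideal (CenterRing (pointwiseClosure (heckeImage ι N L X)))) [m.IsMaximal] :
    Function.Surjective (toLocModule m) := by
  have hB : ∀ φ ∈ pointwiseClosure (heckeImage ι N L X), ∀ f, ‖φ f‖ ≤ ‖f‖ := fun φ hφ f =>
    norm_pointwiseClosure_le (fun ψ hψ f => norm_heckeImage_le hψ f) hφ f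
  refine DefiniteUnitary.toLocModule_surjective (heckeImage ι N L X) hB ?_ m
  intro x f ε hε
  exact exists_pow_close hcover (φ := fun n => (x ^ n).1.1)
    (fun n f => hB _ (x ^ n).1.2 f)
    (fun n k f => pointwiseClosure_comm _ (translate k)
      (fun _ hψ => heckeImage_comm X k hψ) (x ^ n).1.2 f) f hε

end Recurrence

/-! ### Finiteness of the class number and of the stabilizers -/

section Finiteness

theorem exists_finite_cover_mul_subgroup {G : Type*} [Group G] [TopologicalSpace G]
    [ContinuousMul G] {M : Subgroup G} (hM : IsOpen (M : Set G)) {C : Set G} (hC : IsCompact C) :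
    ∃ Y : Finset G, ∀ g ∈ C, ∃ y ∈ Y, y⁻¹ * g ∈ M := by
  obtain ⟨Y, -, hY⟩ := hC.elim_nhds_subcover (fun y => (fun g => y⁻¹ * g) ⁻¹' (M : Set G))
    fun y _ => (hM.preimage (continuous_const.mul continuous_id)).mem_nhds (by simp)
  refine ⟨Y, fun g hg => ?_⟩
  obtain ⟨y, hy, h⟩ := Set.mem_iUnion₂.1 (hY hg)
  exact ⟨y, hy, h⟩

variable {p : ℕ} {F K D ι : Type*} [Field F] [NumberField F] [Field K] [Algebra F K] [Ring D]
  [Algebra F D] [Algebra K D] {s : InvolutionSecondKind F K D}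

theorem isTopologicalGroup_Gp [FiniteDimensional F D] : IsTopologicalGroup (Gp p s) := by
  have (v : PlaceAbove p F) : IsTopologicalGroup (U s (v.1.adicCompletion F)) :=
    isTopologicalGroup_unitaryGroup s
  infer_instance

theorem isTopologicalGroup_Gf [FiniteDimensional F D] : IsTopologicalGroup (Gf p s) := by
  have : IsTopologicalGroup (Gp p s) := isTopologicalGroup_Gp
  have : IsTopologicalGroup (Gaway p s) := isTopologicalGroup_unitaryGroup s
  infer_instance

/-- Finiteness of the class number: with g' fixed in a class, every other g of the class has some
g⁻¹δg' in a fixed compact set, and the inverse of that set is covered by finitely many cosets of the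
open subgroup H × N. -/
theorem exists_finite_movers [Fact p.Prime] [FiniteDimensional F D] [IsSimpleRing D]
    (haniso : ∀ x : D, s.toLinearMap x * x = 0 → x = 0)
    {H : Subgroup (Gp p s)} {N : Subgroup (Gaway p s)}
    (hM : IsOpen (H.prod N : Set (Gf p s))) :
    ∃ X : Set (Gf p s), X.Finite ∧ ∀ g, ∃ x ∈ X, (movers (diag p s) H N x g).Nonempty := by
  classical
  have : IsTopologicalGroup (Gf p s) := isTopologicalGroup_Gf
  let b := Module.finBasis F D
  obtain ⟨r, cls, hcls⟩ := exists_finite_classes s b haniso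
  let fam (g : Gf p s) (v : HeightOneSpectrum (𝓞 F)) := compFull v g
  have key : ∀ q : Fin r, ∃ X : Finset (Gf p s), ∀ g, cls (fam g) = q →
      ∃ x ∈ X, (movers (diag p s) H N x g).Nonempty := by
    intro q
    by_cases hq : ∃ g' : Gf p s, cls (fam g') = q
    · obtain ⟨g', rfl⟩ := hq
      obtain ⟨m, hm, h⟩ := hcls (fam g') (exists_mem_boundedSet b g')
      obtain ⟨Y, hY⟩ := exists_finite_cover_mul_subgroup hM (isCompact_boundedSet b hm).inv
      refine ⟨Y.image (g' * ·), fun g hg => ?_⟩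
      obtain ⟨δ, hδ⟩ := h (fam g) (exists_mem_boundedSet b g) hg
      have hmem : g⁻¹ * diag p s δ * g' ∈ boundedSet p s b m := fun v => by
        rw [map_mul, map_mul, map_inv, compFull_diag]
        exact hδ v
      obtain ⟨y, hy, hyM⟩ := hY (g⁻¹ * diag p s δ * g')⁻¹ (Set.inv_mem_inv.2 hmem)
      refine ⟨_, Finset.mem_image_of_mem _ hy, δ⁻¹, ?_⟩
      rw [mem_movers, map_inv]
      convert hyM using 1
      group
    · exact ⟨∅, fun g hg => absurd ⟨g, hg⟩ hq⟩
  choose X hX using key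
  refine ⟨⋃ q, (X q : Set (Gf p s)), Set.finite_iUnion fun q => (X q).finite_toSet, fun g => ?_⟩
  obtain ⟨x, hx, h⟩ := hX _ g rfl
  exact ⟨x, Set.mem_iUnion.2 ⟨_, hx⟩, h⟩

theorem norm_algebraMap_infiniteAdele {F : Type*} [Field F] (c : F) (v : InfinitePlace F) :
    ‖algebraMap F (InfiniteAdeleRing F) c v‖ = v c :=
  InfinitePlace.Completion.norm_coe v (WithAbs.toAbs v.1 c)

/-- After multiplication by m the coordinates of δ are algebraic integers, and compactness at
infinity bounds all their archimedean absolute values. Only finitely many such integers exist in F.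
-/
theorem finite_diag_mem_boundedSet [Fintype ι] (b : Module.Basis ι F D)
    (hdef : CompactSpace (U s (InfiniteAdeleRing F))) {m : ℕ} (hm : m ≠ 0) :
    {δ : U s F | diag p s δ ∈ boundedSet p s b m}.Finite := by
  obtain ⟨B, hB⟩ := exists_bound_of_compactSpace b hdef
  have hfin := (Set.Finite.pi' fun _ : ι =>
    Embeddings.finite_of_norm_le F ℂ ((m : ℝ) * B))
  refine Set.Finite.of_finite_image (f := fun δ i => (m : F) * coords b F (unitVal δ) i)
    (hfin.subset ?_) ?_
  · rintro _ ⟨δ, hδ, rfl⟩ i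
    constructor
    · have h : ∀ v : HeightOneSpectrum (𝓞 F),
          ‖algebraMap F (v.adicCompletion F) ((m : F) * coords b F (unitVal δ) i)‖ ≤ 1 := by
        intro v
        have h1 := hδ v
        rw [compFull_diag] at h1
        rw [map_mul, map_natCast, norm_mul]
        refine (mul_le_mul_of_nonneg_left ?_ (norm_nonneg _)).trans h1
        refine le_trans (le_of_eq ?_) (norm_coords_le b v _ i)
        exact congrArg norm (coords_map b (Algebra.ofId F (v.adicCompletion F)) (unitVal δ) i).symm
      obtain ⟨c, hc⟩ := mem_integers_of_forall_norm_le_one h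
      exact (congrArg (IsIntegral ℤ) hc).mpr c.2
    · intro φ
      have h1 := hB (U.map s (Algebra.ofId F (InfiniteAdeleRing F)) δ) i (InfinitePlace.mk φ)
      have h2 : coords b (InfiniteAdeleRing F)
          (unitVal (U.map s (Algebra.ofId F (InfiniteAdeleRing F)) δ)) i =
            algebraMap F (InfiniteAdeleRing F) (coords b F (unitVal δ) i) :=
        coords_map b (Algebra.ofId F (InfiniteAdeleRing F)) (unitVal δ) i
      rw [h2, norm_algebraMap_infiniteAdele, InfinitePlace.apply] at h1
      rw [map_mul, map_natCast, norm_mul, Complex.norm_natCast]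
      exact mul_le_mul_of_nonneg_left h1 (Nat.cast_nonneg m)
  · intro δ _ δ' _ h
    refine Subtype.ext (Units.ext ((coords b F).injective (funext fun i => ?_)))
    exact mul_left_cancel₀ (Nat.cast_ne_zero.2 hm) (congrFun h i)

/-- The conjugate x(H × N)x⁻¹ is compact, so its elements have bounded denominators. -/
theorem movers_self_finite [Fact p.Prime] [FiniteDimensional F D]
    (hdef : CompactSpace (U s (InfiniteAdeleRing F)))
    {H : Subgroup (Gp p s)} {N : Subgroup (Gaway p s)}
    (hM : IsCompact (H.prod N : Set (Gf p s))) (x : Gf p s) :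
    (movers (diag p s) H N x x).Finite := by
  have : IsTopologicalGroup (Gf p s) := isTopologicalGroup_Gf
  let b := Module.finBasis F D
  obtain ⟨m, hm, h⟩ := exists_subset_boundedSet b
    (hM.image (show Continuous fun c => x * c * x⁻¹ from
      (continuous_const.mul continuous_id).mul continuous_const))
  refine (finite_diag_mem_boundedSet b hdef hm).subset fun δ hδ => h ⟨_, hδ, ?_⟩
  change x * (x⁻¹ * diag p s δ * x) * x⁻¹ = _
  group

end Finiteness

/-! ### The subgroup `G(ℤ_p)` is compact and open -/

section Quadratic

variable {F K D : Type*} [Field F] [Field K] [Algebra F K] [Ring D] [Algebra F D]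
  [Algebra K D] (s : InvolutionSecondKind F K D)

theorem exists_skew_scalar [Nontrivial D] : ∃ θ : K, θ ≠ 0 ∧
    s.toLinearMap (algebraMap K D θ) = -algebraMap K D θ := by
  obtain ⟨c, hc, h⟩ := s.second_kind
  obtain ⟨k, hk⟩ : ∃ k, c k ≠ k := by
    by_contra! hall
    exact hc (AlgEquiv.ext hall)
  have hcc : c (c k) = k := by
    apply (algebraMap K D).injective
    rw [← h, ← h]
    exact s.involutive _
  refine ⟨k - c k, sub_ne_zero.2 hk.symm, ?_⟩
  refine (h _).trans ?_
  rw [map_sub, hcc, ← map_neg, neg_sub]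

/-- The involution fixes F and negates θ, so 1 and θ are independent and form a basis of the
quadratic extension. -/
theorem exists_add_mul_skew [Nontrivial D] [CharZero F] [Algebra.IsQuadraticExtension F K] {θ : K} (hθ : θ ≠ 0)
    [IsScalarTower F K D] (h : s.toLinearMap (algebraMap K D θ) = -algebraMap K D θ) (k : K) :
    ∃ a a' : F, k = algebraMap F K a + algebraMap F K a' * θ := by
  have hli : LinearIndependent F ![(1 : K), θ] := by
    rw [LinearIndependent.pair_iff]
    intro a a' haa
    have h1 : algebraMap F K a + algebraMap F K a' * θ = 0 := by
      rw [← haa, Algebra.smul_def, Algebra.smul_def, mul_one]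
    have h2 : algebraMap F K a - algebraMap F K a' * θ = 0 := by
      apply (algebraMap K D).injective
      have h3 : a • (1 : D) + a' • algebraMap K D θ = 0 := by
        rw [← map_zero (algebraMap K D), ← h1, map_add, map_mul,
          ← IsScalarTower.algebraMap_apply, ← IsScalarTower.algebraMap_apply, Algebra.smul_def,
          Algebra.smul_def, mul_one]
      replace h3 := congrArg s.toLinearMap h3
      rw [map_add, map_smul, map_smul, h, map_one_involution, map_zero] at h3
      rw [map_zero, ← h3, map_sub, map_mul, ← IsScalarTower.algebraMap_apply,
        ← IsScalarTower.algebraMap_apply, Algebra.smul_def, Algebra.smul_def, mul_one, mul_neg,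
        sub_eq_add_neg]
    have : CharZero K := charZero_of_injective_algebraMap (algebraMap F K).injective
    have ha : algebraMap F K a = 0 := by
      have : (2 : K) * algebraMap F K a = 0 := by linear_combination h1 + h2
      simpa using this
    have ha' : algebraMap F K a' = 0 := by
      rw [ha, zero_add] at h1
      exact (mul_eq_zero.1 h1).resolve_right hθ
    exact ⟨by simpa using ha, by simpa using ha'⟩
  have hspan : Submodule.span F (Set.range ![(1 : K), θ]) = ⊤ :=
    hli.span_eq_top_of_card_eq_finrank
      (by rw [Fintype.card_fin, Algebra.IsQuadraticExtension.finrank_eq_two])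
  have hk : k ∈ Submodule.span F (Set.range ![(1 : K), θ]) := hspan ▸ Submodule.mem_top
  rw [Matrix.range_cons, Matrix.range_cons, Matrix.range_empty, Set.union_empty,
    Set.singleton_union, Submodule.mem_span_pair] at hk
  obtain ⟨a, a', rfl⟩ := hk
  exact ⟨a, a', by rw [Algebra.smul_def, Algebra.smul_def, mul_one]⟩

variable {A B : Type*} {n : ℕ} [IsScalarTower F K D] [CommRing A] [Algebra F A] [Field B]
  [Algebra F B] [Algebra K B] [IsScalarTower F K B]

theorem baseChangeMatrix_tmul (j : A →ₐ[F] B)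
    (e : B ⊗[K] D ≃ₐ[B] Matrix (Fin n) (Fin n) B) (a : A) (d : D) :
    baseChangeMatrix j e (a ⊗ₜ[F] d) = e (j a ⊗ₜ[K] d) := by
  have h : j a ⊗ₜ[K] d = j a • ((1 : B) ⊗ₜ[K] d) := by
    rw [TensorProduct.smul_tmul', smul_eq_mul, mul_one]
  rw [h, map_smul, Algebra.smul_def]
  rfl

theorem baseChangeMatrix_smul (j : A →ₐ[F] B)
    (e : B ⊗[K] D ≃ₐ[B] Matrix (Fin n) (Fin n) B) (a : A) (x : A ⊗[F] D) :
    baseChangeMatrix j e (a • x) = j a • baseChangeMatrix j e x := by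
  have h : a • x = (a ⊗ₜ[F] 1) * x := by
    rw [Algebra.smul_def]
    rfl
  rw [h, map_mul, baseChangeMatrix_tmul, Algebra.smul_def]
  congr 1
  exact e.commutes (j a)

/-- Write x = ∑ (a_i ⊗ β_i + a'_i ⊗ θβ_i) for a K-basis β of D and a skew scalar θ. Since the
involution negates θ, the two hypotheses become j(a_i) + θj(a'_i) = 0 and j(a_i) - θj(a'_i) = 0. In
effect, the matrix of x⋆ sees the conjugate embedding that the matrix of x misses. -/
theorem eq_zero_of_baseChangeMatrix_eq_zero [Nontrivial D] [CharZero F] [Algebra.IsQuadraticExtension F K]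
    [FiniteDimensional K D] {j : A →ₐ[F] B} (hj : Function.Injective j)
    (e : B ⊗[K] D ≃ₐ[B] Matrix (Fin n) (Fin n) B) {x : A ⊗[F] D}
    (hx : baseChangeMatrix j e x = 0) (hx' : baseChangeMatrix j e (starBase s A x) = 0) :
    x = 0 := by
  obtain ⟨θ, hθ, hs⟩ := exists_skew_scalar s
  let β := Module.finBasis K D
  have hstar : ∀ (k : K), ∃ k' : K, (∀ d : D, s.toLinearMap (k • d) = k' • s.toLinearMap d) ∧
      (k' = 0 → k = 0) := by
    intro k
    obtain ⟨c, -, hc⟩ := s.second_kind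
    refine ⟨c k, fun d => ?_, fun h => by simpa using h⟩
    have h1 : s.toLinearMap (k • d) = s.toLinearMap d * algebraMap K D (c k) := by
      rw [Algebra.smul_def]
      exact (s.map_mul_rev _ _).trans (congrArg _ (hc k))
    rw [h1, Algebra.smul_def, Algebra.commutes]
  have hli : LinearIndependent K fun i => s.toLinearMap (β i) := by
    rw [Fintype.linearIndependent_iff]
    intro g hg
    choose g' hg' hg0 using fun i => hstar (g i)
    have h1 : ∑ i, g' i • β i = 0 := by
      have h2 := congrArg s.toLinearMap hg
      rw [map_sum, map_zero] at h2
      rw [← h2]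
      refine Finset.sum_congr rfl fun i _ => ?_
      rw [hg']
      congr 1
      exact (s.involutive _).symm
    exact fun i => hg0 i (Fintype.linearIndependent_iff.1 β.linearIndependent g' h1 i)
  have : Nonempty (Fin (Module.finrank K D)) := ⟨⟨0, Module.finrank_pos⟩⟩
  let β' := basisOfLinearIndependentOfCardEqFinrank hli (Fintype.card_fin _)
  have hβ' : ∀ i, β' i = s.toLinearMap (β i) := fun i => by
    rw [coe_basisOfLinearIndependentOfCardEqFinrank]
  have hθs : ∀ d, s.toLinearMap (θ • d) = -(θ • s.toLinearMap d) := by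
    intro d
    rw [Algebra.smul_def, Algebra.smul_def, Algebra.commutes θ (s.toLinearMap d), ← mul_neg, ← hs]
    exact s.map_mul_rev _ _
  obtain ⟨a, a', rfl⟩ : ∃ a a' : Fin (Module.finrank K D) → A,
      x = ∑ i, (a i ⊗ₜ[F] β i + a' i ⊗ₜ[F] (θ • β i)) := by
    clear hx hx'
    induction x using TensorProduct.induction_on with
    | zero => exact ⟨0, 0, by simp⟩
    | add y z hy hz =>
      obtain ⟨a, a', rfl⟩ := hy
      obtain ⟨b, b', rfl⟩ := hz
      refine ⟨a + b, a' + b', ?_⟩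
      rw [← Finset.sum_add_distrib]
      refine Finset.sum_congr rfl fun i _ => ?_
      rw [Pi.add_apply, Pi.add_apply, TensorProduct.add_tmul, TensorProduct.add_tmul]
      abel
    | tmul r d =>
      choose f f' hf using fun i => exists_add_mul_skew s hθ hs (β.repr d i)
      refine ⟨fun i => f i • r, fun i => f' i • r, ?_⟩
      conv_lhs => rw [← β.sum_repr d, TensorProduct.tmul_sum]
      refine Finset.sum_congr rfl fun i _ => ?_
      rw [TensorProduct.smul_tmul, TensorProduct.smul_tmul, ← TensorProduct.tmul_add, hf, add_smul,
        mul_smul, algebraMap_smul, algebraMap_smul]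
  have h1 : ∀ i, j (a i) + θ • j (a' i) = 0 := by
    have h2 : ∑ i, (j (a i) + θ • j (a' i)) • (1 : B) ⊗ₜ[K] β i = 0 := by
      apply e.injective
      rw [map_zero, ← hx, map_sum, map_sum]
      refine Finset.sum_congr rfl fun i _ => ?_
      rw [map_add, baseChangeMatrix_tmul, baseChangeMatrix_tmul, ← map_add,
        ← TensorProduct.smul_tmul, ← TensorProduct.add_tmul, TensorProduct.smul_tmul', smul_eq_mul,
        mul_one]
    refine Fintype.linearIndependent_iff.1 (β.baseChange B).linearIndependent _ ?_
    simpa using h2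
  have h1' : ∀ i, j (a i) - θ • j (a' i) = 0 := by
    have h2 : ∑ i, (j (a i) - θ • j (a' i)) • (1 : B) ⊗ₜ[K] β' i = 0 := by
      apply e.injective
      rw [map_zero, ← hx', map_sum, map_sum, map_sum]
      refine Finset.sum_congr rfl fun i _ => ?_
      rw [map_add, starBase_tmul, starBase_tmul, hθs, TensorProduct.tmul_neg, map_add, map_neg,
        baseChangeMatrix_tmul, baseChangeMatrix_tmul, hβ', ← sub_eq_add_neg, ← map_sub,
        ← TensorProduct.smul_tmul, ← TensorProduct.sub_tmul, TensorProduct.smul_tmul', smul_eq_mul,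
        mul_one]
    refine Fintype.linearIndependent_iff.1 (β'.baseChange B).linearIndependent _ ?_
    simpa using h2
  have : CharZero B := charZero_of_injective_algebraMap (algebraMap F B).injective
  refine Finset.sum_eq_zero fun i _ => ?_
  have ha : a i = 0 := by
    apply hj
    have : (2 : B) * j (a i) = 0 := by linear_combination h1 i + h1' i
    rw [map_zero]
    simpa using this
  have ha' : a' i = 0 := by
    apply hj
    have := h1 i
    rw [ha, map_zero, zero_add] at this
    rw [map_zero]
    exact (smul_eq_zero.1 this).resolve_left hθ
  rw [ha, ha', TensorProduct.zero_tmul, TensorProduct.zero_tmul, add_zero]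

end Quadratic

/-! ### Integral points at one place above p -/

section LocalIntegral

variable {n : ℕ} {F K D : Type*} [Field F] [NumberField F] [Field K] [NumberField K]
  [Algebra F K] [Ring D] [Algebra F D] [Algebra K D] [IsScalarTower F K D]
  {v : HeightOneSpectrum (𝓞 F)}

theorem SplitPlace.toMatrix_smul (e : SplitPlace n K D v) (a : v.adicCompletion F)
    (x : v.adicCompletion F ⊗[F] D) : e.toMatrix (a • x) = e.emb a • e.toMatrix x :=
  baseChangeMatrix_smul e.emb e.iso a x

variable (s : InvolutionSecondKind F K D) [FiniteDimensional F D]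

theorem SplitPlace.continuous_toMatrix (e : SplitPlace n K D v) :
    Continuous fun g : U s (v.adicCompletion F) => e.toMatrix (unitVal g) := by
  let b := Module.finBasis F D
  have h : ∀ g : U s (v.adicCompletion F), e.toMatrix (unitVal g) =
      ∑ i, e.emb (coords b (v.adicCompletion F) (unitVal g) i) • e.toMatrix (1 ⊗ₜ b i) := by
    intro g
    conv_lhs => rw [← sum_coords_smul b (unitVal g), map_sum]
    exact Finset.sum_congr rfl fun i _ => e.toMatrix_smul _ _
  refine Continuous.congr ?_ fun g => (h g).symm
  refine continuous_finsetSum _ fun i _ => ?_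
  have hc : Continuous fun g : U s (v.adicCompletion F) =>
      e.emb (coords b (v.adicCompletion F) (unitVal g) i) :=
    e.continuous_emb.comp ((continuous_apply i).comp (continuous_coords_unitaryGroup s b))
  exact continuous_matrix fun k l => hc.mul continuous_const

theorem SplitPlace.isOpen_integralPoints (e : SplitPlace n K D v) :
    IsOpen (e.integralPoints s : Set (U s (v.adicCompletion F))) := by
  have : IsTopologicalGroup (U s (v.adicCompletion F)) := isTopologicalGroup_unitaryGroup s
  have h : IsOpen {g : U s (v.adicCompletion F) | ∀ i j, e.toMatrix (unitVal g) i j ∈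
      e.w.adicCompletionIntegers K} := by
    simp only [Set.ofPred_forall]
    exact isOpen_iInter_of_finite fun i => isOpen_iInter_of_finite fun j =>
      (Valued.isOpen_valuationSubring _).preimage
        ((continuous_apply j).comp ((continuous_apply i).comp (e.continuous_toMatrix s)))
  exact h.inter (h.preimage continuous_inv)

theorem isCompact_integralMatrices (w : HeightOneSpectrum (𝓞 K)) :
    IsCompact {M : Matrix (Fin n) (Fin n) (w.adicCompletion K) |
      ∀ i ∈ Set.univ, M i ∈ {r | ∀ j ∈ Set.univ, r j ∈ (w.adicCompletionIntegers K : Set _)}} :=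
  isCompact_univ_pi fun _ => isCompact_univ_pi fun _ => isCompact_adicCompletionIntegers w

/-- The map x ↦ (matrix of x, matrix of x⋆) is linear and injective on a finite-dimensional
F_v-space, hence a closed embedding. On U(F_v), where x⋆ = x⁻¹, the integral points are the preimage
of the compact set of pairs of integral matrices. -/
theorem SplitPlace.isCompact_integralPoints [FiniteDimensional K D] [Nontrivial D]
    [Algebra.IsQuadraticExtension F K] (e : SplitPlace n K D v) :
    IsCompact (e.integralPoints s : Set (U s (v.adicCompletion F))) := by
  let _ := adicNontriviallyNormedField v
  let b := Module.finBasis F D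
  let V := Matrix (Fin n) (Fin n) (e.w.adicCompletion K)
  let _ : Module (v.adicCompletion F) V := Module.compHom V e.emb.toRingHom
  have hsmul : ∀ (a : v.adicCompletion F) (M : V), a • M = e.emb a • M := fun _ _ => rfl
  have : ContinuousSMul (v.adicCompletion F) V :=
    ⟨((e.continuous_emb.comp continuous_fst).smul continuous_snd :
      Continuous fun x : v.adicCompletion F × V => e.emb x.1 • x.2)⟩
  let f : v.adicCompletion F ⊗[F] D →ₗ[v.adicCompletion F] V :=
    { toFun := e.toMatrix
      map_add' := map_add _
      map_smul' := e.toMatrix_smul }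
  let Φ : (Fin (Module.finrank F D) → v.adicCompletion F) →ₗ[v.adicCompletion F] V × V :=
    (f.prod (f ∘ₗ starBase s (v.adicCompletion F))) ∘ₗ (coords b (v.adicCompletion F)).symm
  have hker : LinearMap.ker Φ = ⊥ := by
    rw [LinearMap.ker_eq_bot']
    intro x hx
    have h1 := congrArg Prod.fst hx
    have h2 := congrArg Prod.snd hx
    have h3 := eq_zero_of_baseChangeMatrix_eq_zero s (RingHom.injective e.emb.toRingHom) e.iso h1 h2
    exact (LinearEquiv.map_eq_zero_iff _).1 h3
  have hΦ := (LinearMap.isClosedEmbedding_of_injective hker).comp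
    (isClosedEmbedding_coords s b (R := v.adicCompletion F))
  convert hΦ.isCompact_preimage ((isCompact_integralMatrices e.w).prod
    (isCompact_integralMatrices e.w)) using 1
  ext g
  have hg : (Φ ∘ fun g : U s (v.adicCompletion F) => coords b (v.adicCompletion F) (unitVal g)) g =
      (e.toMatrix (unitVal g), e.toMatrix (unitVal g⁻¹)) := by
    change (e.toMatrix ((coords b (v.adicCompletion F)).symm (coords b _ (unitVal g))),
      e.toMatrix (starBase s _ ((coords b (v.adicCompletion F)).symm
        (coords b _ (unitVal g))))) = _
    rw [LinearEquiv.symm_apply_apply, ← coe_inv_eq_starBase]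
  rw [Set.mem_preimage, hg]
  simp only [Set.mem_prod, Set.mem_ofPred_eq, Set.mem_univ, true_imp_iff]
  rfl

end LocalIntegral

/-! ### The product over all places above p -/

section Global

variable {p n : ℕ} {F K D : Type*} [Field F] [NumberField F] [Field K] [NumberField K]
  [Algebra F K] [Ring D] [Algebra F D] [Algebra K D] [IsScalarTower F K D]
  (s : InvolutionSecondKind F K D) [FiniteDimensional F D]

theorem isOpen_GZp [Fact p.Prime] (e : (v : PlaceAbove p F) → SplitPlace n K D v.1) :
    IsOpen (GZp s e : Set (Gp p s)) := by
  have := finite_placeAbove p F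
  exact isOpen_set_pi Set.finite_univ fun v _ => (e v).isOpen_integralPoints s

theorem isCompact_GZp [FiniteDimensional K D] [Nontrivial D] [Algebra.IsQuadraticExtension F K]
    (e : (v : PlaceAbove p F) → SplitPlace n K D v.1) : IsCompact (GZp s e : Set (Gp p s)) :=
  isCompact_univ_pi fun v => (e v).isCompact_integralPoints s

end Global

/-! ### Regular functions on `G(ℤ_p)` -/

theorem dense_of_padic_separation {p : ℕ} [Fact p.Prime] {X L : Type*} [TopologicalSpace X]
    [CompactSpace X] [NormedField L] [NormedAlgebra ℚ_[p] L] [CompleteSpace L]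
    (B : Subalgebra L (X → L)) (h : ∀ x y : X, x ≠ y → ∃ ξ : C(X, ℚ_[p]),
      (fun z => algebraMap ℚ_[p] L (ξ z)) ∈ B ∧ ξ x ≠ ξ y) :
    Dense {b : C(X, L) | (b : X → L) ∈ B} := by
  let S : Subalgebra L C(X, L) := B.comap (ContinuousMap.coeFnAlgHom L)
  have hS : S.topologicalClosure = ⊤ := by
    refine topologicalClosure_eq_top_of_padic (p := p) S fun x y hxy => ?_
    obtain ⟨ξ, hξ, hne⟩ := h x y hxy
    exact ⟨ξ, ⟨_, (continuous_algebraMap ℚ_[p] L).comp ξ.continuous⟩, hξ, fun _ => rfl, hne⟩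
  intro f
  have hf : f ∈ S.topologicalClosure := hS ▸ Algebra.mem_top
  exact hf

section RegularFunctions

variable {p n : ℕ} {F D : Type*} [Field F] [NumberField F] [Ring D] [Algebra F D]

/-- F_v ⊗ D is locally compact, so it is finite-dimensional over ℚ_p, and a continuous additive
functional is automatically ℚ_p-linear. It is therefore an L-combination of the coordinates ξ i. -/
theorem exists_padic_functionals [Fact p.Prime] [FiniteDimensional F D] (v : PlaceAbove p F) (L : Type*)
    [NormedField L] [NormedAlgebra ℚ_[p] L] :
    ∃ (d : ℕ) (ε : Fin d → v.1.adicCompletion F ⊗[F] D)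
      (ξ : Fin d → v.1.adicCompletion F ⊗[F] D →+ ℚ_[p]),
      (∀ i, @Continuous _ _ (moduleTopology (v.1.adicCompletion F) _) _ (ξ i)) ∧
      (∀ x y, (∀ i, ξ i x = ξ i y) → x = y) ∧
      ∀ l : v.1.adicCompletion F ⊗[F] D →+ L,
        (@Continuous _ _ (moduleTopology (v.1.adicCompletion F) _) _ l) →
          ∀ x, l x = ∑ i, l (ε i) * algebraMap ℚ_[p] L (ξ i x) := by
  let R := v.1.adicCompletion F
  let E := R ⊗[F] D
  let _ : TopologicalSpace E := moduleTopology R E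
  have : IsModuleTopology R E := ⟨rfl⟩
  let e : E ≃ₜ (Fin (Module.finrank F D) → R) :=
    basisHomeomorph (Algebra.TensorProduct.basis R (Module.finBasis F D))
  have : T2Space E := e.symm.t2Space
  have : LocallyCompactSpace R := adicCompletion_locallyCompactSpace v.1
  have : LocallyCompactSpace E := e.isOpenEmbedding.locallyCompactSpace
  have : IsTopologicalAddGroup E := IsModuleTopology.topologicalAddGroup R E
  have : ContinuousSMul R E := IsModuleTopology.toContinuousSMul R E
  obtain ⟨φ, hφ⟩ := exists_continuous_padic_ringHom v.2
  let _ : Module ℚ_[p] E := Module.compHom E φ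
  have : ContinuousSMul ℚ_[p] E :=
    ⟨((hφ.comp continuous_fst).smul continuous_snd :
      Continuous fun x : ℚ_[p] × E => φ x.1 • x.2)⟩
  obtain ⟨d, ε, ξ, h⟩ := exists_padic_coordinates (p := p) (E := E)
  refine ⟨d, ε, fun i => (ξ i : E →ₗ[ℚ_[p]] ℚ_[p]).toAddMonoidHom, fun i => (ξ i).continuous,
    fun x y hxy => ?_, fun l hl x => ?_⟩
  · rw [h x, h y]
    exact Finset.sum_congr rfl fun i _ => congrArg (· • ε i) (hxy i)
  · conv_lhs => rw [h x, map_sum]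
    exact Finset.sum_congr rfl fun i _ => (map_padic_smul l hl _ _).trans (mul_comm _ _)

variable {K : Type*} [Field K] [NumberField K] [Algebra F K] [Algebra K D] [IsScalarTower F K D]
  {s : InvolutionSecondKind F K D} {L : Type*} [NormedField L]
  (e : (v : PlaceAbove p F) → SplitPlace n K D v.1)

theorem functional_mem_regularFunctions {v : PlaceAbove p F}
    {l : v.1.adicCompletion F ⊗[F] D →+ L}
    (hl : @Continuous _ _ (moduleTopology (v.1.adicCompletion F) _) _ l) :
    (fun g : GZp s e => l (unitVal (g.1 v))) ∈ regularFunctions L e :=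
  Algebra.subset_adjoin ⟨v, l, hl, rfl⟩

theorem continuous_unitVal_apply (v : PlaceAbove p F) :
    @Continuous _ _ _ (moduleTopology (v.1.adicCompletion F) _)
      fun g : GZp s e => unitVal (g.1 v) := by
  let _ : TopologicalSpace (v.1.adicCompletion F ⊗[F] D) :=
    moduleTopology (v.1.adicCompletion F) _
  have h : Continuous fun g : U s (v.1.adicCompletion F) => unitVal g := continuous_induced_dom
  exact h.comp ((continuous_apply v).comp continuous_subtype_val)

theorem continuous_comp_linearMap {v : PlaceAbove p F} {l : v.1.adicCompletion F ⊗[F] D →+ L}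
    (hl : @Continuous _ _ (moduleTopology (v.1.adicCompletion F) _) _ l)
    (f : v.1.adicCompletion F ⊗[F] D →ₗ[v.1.adicCompletion F] v.1.adicCompletion F ⊗[F] D) :
    @Continuous _ _ (moduleTopology (v.1.adicCompletion F) _) _ (l.comp f.toAddMonoidHom) := by
  let _ : TopologicalSpace (v.1.adicCompletion F ⊗[F] D) :=
    moduleTopology (v.1.adicCompletion F) _
  have : IsModuleTopology (v.1.adicCompletion F) (v.1.adicCompletion F ⊗[F] D) := ⟨rfl⟩
  have : ContinuousAdd (v.1.adicCompletion F ⊗[F] D) :=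
    IsModuleTopology.toContinuousAdd (v.1.adicCompletion F) _
  have : ContinuousSMul (v.1.adicCompletion F) (v.1.adicCompletion F ⊗[F] D) :=
    IsModuleTopology.toContinuousSMul (v.1.adicCompletion F) _
  exact hl.comp (IsModuleTopology.continuous_of_linearMap f)

theorem regularFunctions_translate {a : GZp s e → L} (ha : a ∈ regularFunctions L e)
    (g : GZp s e) : (fun k => a (k * g)) ∈ regularFunctions L e := by
  induction ha using Algebra.adjoin_induction with
  | mem a ha =>
    obtain ⟨v, l, hl, rfl⟩ := ha
    exact functional_mem_regularFunctions e (continuous_comp_linearMap hl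
      (LinearMap.mulRight (v.1.adicCompletion F) (unitVal (g.1 v))))
  | algebraMap r => exact (regularFunctions L e).algebraMap_mem r
  | add a b _ _ ha hb => exact add_mem ha hb
  | mul a b _ _ ha hb => exact mul_mem ha hb

/-- This is the comultiplication of the coordinate ring. For a linear functional, expand l(hg) in
the ℚ_p-coordinates of h; the coefficients l(ε_i g) are regular in g. Sums and products follow
formally. -/
theorem regularFunctions_expansion [Fact p.Prime] [FiniteDimensional F D] [NormedAlgebra ℚ_[p] L]
    {a : GZp s e → L} (ha : a ∈ regularFunctions L e) :
    ∃ (k : ℕ) (c : Fin k → GZp s e → L) (y : Fin k → C(GZp s e, L)),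
      (∀ i, c i ∈ regularFunctions L e) ∧ ∀ g h, a (h * g) = ∑ i, c i g * y i h := by
  -- Arbitrary finite index types are convenient here: expansions of sums and products are indexed
  -- by disjoint unions and products.
  suffices H : ∃ (κ : Type) (_ : Fintype κ) (c : κ → GZp s e → L) (y : κ → C(GZp s e, L)),
      (∀ i, c i ∈ regularFunctions L e) ∧ ∀ g h, a (h * g) = ∑ i, c i g * y i h by
    obtain ⟨κ, _, c, y, hc, h⟩ := H
    let σ := (Fintype.equivFin κ).symm
    refine ⟨_, fun i => c (σ i), fun i => y (σ i), fun i => hc _, fun g g' => ?_⟩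
    rw [h]
    exact (σ.sum_comp fun i => c i g * y i g').symm
  induction ha using Algebra.adjoin_induction with
  | mem a ha =>
    obtain ⟨v, l, hl, rfl⟩ := ha
    obtain ⟨d, ε, ξ, hξ, -, h⟩ := exists_padic_functionals (D := D) v L
    refine ⟨Fin d, inferInstance, fun i g => l (ε i * unitVal (g.1 v)),
      fun i => ⟨fun g => algebraMap ℚ_[p] L (ξ i (unitVal (g.1 v))), ?_⟩, fun i => ?_,
      fun g g' => ?_⟩
    · let _ : TopologicalSpace (v.1.adicCompletion F ⊗[F] D) :=
        moduleTopology (v.1.adicCompletion F) _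
      exact (continuous_algebraMap ℚ_[p] L).comp ((hξ i).comp (continuous_unitVal_apply e v))
    · exact functional_mem_regularFunctions e (continuous_comp_linearMap hl
        (LinearMap.mulLeft (v.1.adicCompletion F) (ε i)))
    · exact h _ (continuous_comp_linearMap hl
        (LinearMap.mulRight (v.1.adicCompletion F) (unitVal (g.1 v)))) _
  | algebraMap r =>
    refine ⟨Unit, inferInstance, fun _ _ => r, fun _ => 1,
      fun _ => (regularFunctions L e).algebraMap_mem r, fun g g' => ?_⟩
    simp
  | add a b _ _ ha hb =>
    obtain ⟨κ, _, c, y, hc, h⟩ := ha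
    obtain ⟨κ', _, c', y', hc', h'⟩ := hb
    refine ⟨κ ⊕ κ', inferInstance, Sum.elim c c', Sum.elim y y', ?_, fun g g' => ?_⟩
    · rintro (i | i)
      exacts [hc i, hc' i]
    · rw [Fintype.sum_sum_type, Pi.add_apply, h, h']
      rfl
  | mul a b _ _ ha hb =>
    obtain ⟨κ, _, c, y, hc, h⟩ := ha
    obtain ⟨κ', _, c', y', hc', h'⟩ := hb
    refine ⟨κ × κ', inferInstance, fun i => c i.1 * c' i.2, fun i => y i.1 * y' i.2,
      fun i => mul_mem (hc _) (hc' _), fun g g' => ?_⟩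
    rw [Pi.mul_apply, h, h', Finset.sum_mul_sum, Fintype.sum_prod_type]
    refine Finset.sum_congr rfl fun i _ => Finset.sum_congr rfl fun i' _ => ?_
    exact mul_mul_mul_comm _ _ _ _

/-- The ℚ_p-coordinates at the places above p are regular, ℚ_p-valued and separate points, as
Stone–Weierstrass demands. -/
theorem dense_regularFunctions [Fact p.Prime] [FiniteDimensional F D] [NormedAlgebra ℚ_[p] L]
    [FiniteDimensional ℚ_[p] L] [CompactSpace (GZp s e)] :
    Dense {b : C(GZp s e, L) | (b : GZp s e → L) ∈ regularFunctions L e} := by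
  have : CompleteSpace L := FiniteDimensional.complete ℚ_[p] L
  refine dense_of_padic_separation (p := p) _ fun x y hxy => ?_
  obtain ⟨v, hv⟩ : ∃ v, x.1 v ≠ y.1 v := by
    by_contra! hall
    exact hxy (Subtype.ext (funext hall))
  obtain ⟨d, ε, ξ, hξ, hsep, -⟩ := exists_padic_functionals (D := D) v L
  obtain ⟨i, hi⟩ : ∃ i, ξ i (unitVal (x.1 v)) ≠ ξ i (unitVal (y.1 v)) := by
    by_contra! hall
    exact hv (Subtype.ext (Units.ext (hsep _ _ hall)))
  let _ : TopologicalSpace (v.1.adicCompletion F ⊗[F] D) :=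
    moduleTopology (v.1.adicCompletion F) _
  refine ⟨⟨fun g => ξ i (unitVal (g.1 v)), (hξ i).comp (continuous_unitVal_apply e v)⟩, ?_, hi⟩
  exact functional_mem_regularFunctions e
    (l := (algebraMap ℚ_[p] L).toAddMonoidHom.comp (ξ i))
    ((continuous_algebraMap ℚ_[p] L).comp (hξ i))

end RegularFunctions

end DefiniteUnitary

theorem mainTheorem7 (p : ℕ) [Fact p.Prime] (n : ℕ)
    {F K D : Type*} [Field F] [NumberField F] [IsTotallyReal F]
    [Field K] [NumberField K] [IsTotallyComplex K]
    [Algebra F K] [Algebra.IsQuadraticExtension F K]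
    [Ring D] [Algebra F D] [Algebra K D] [IsScalarTower F K D]
    [Algebra.IsCentral K D] [IsSimpleRing D] [FiniteDimensional K D]
    (hD : Module.finrank K D = n ^ 2)
    (s : InvolutionSecondKind F K D)
    (hdefinite : CompactSpace (U s (InfiniteAdeleRing F)))
    (e : (v : PlaceAbove p F) → SplitPlace n K D v.1)
    (T : TameLevel p s)
    (L : Type*) [NormedField L] [NormedAlgebra ℚ_[p] L] [FiniteDimensional ℚ_[p] L]
    (S : Set (PlaceAway p F)) :
    Dense {f : CompletedH0 T L |
        IsAlgebraicVector (regularFunctions L e) (actionGZp T L e) f} ∧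
      ∀ (m : Ideal (TameHeckeRing T L S)) [m.IsMaximal],
        Dense {x : CompletedH0Loc m |
          IsAlgebraicVector (regularFunctions L e) (actionGZpLoc e m) x} := by
  have : FiniteDimensional F D := FiniteDimensional.trans F K D
  have : IsTopologicalGroup (Gp p s) := isTopologicalGroup_Gp
  have : IsTopologicalGroup (Gaway p s) := isTopologicalGroup_unitaryGroup s
  have : ProperSpace L := FiniteDimensional.proper ℚ_[p] L
  have : IsUltrametricDist L := isUltrametricDist_of_padic p L
  have : CharZero L := charZero_of_injective_algebraMap (algebraMap ℚ_[p] L).injective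
  have : CompactSpace (GZp s e) := isCompact_iff_compactSpace.1 (isCompact_GZp s e)
  have hcover := exists_finite_movers (p := p) (anisotropic_of_compactSpace hdefinite)
    ((isOpen_GZp s e).prod T.isOpen_prod : IsOpen ((GZp s e).prod T.group : Set (Gf p s)))
  have hdense : Dense {f : CompletedH0 T L |
      IsAlgebraicVector (regularFunctions L e) (actionGZp T L e) f} :=
    dense_isAlgebraicVector (isOpen_GZp s e) T.isOpen_prod
      (movers_self_finite hdefinite ((isCompact_GZp s e).prod T.isCompact_prod)) hcover
      (regularFunctions L e) (fun _ ha => regularFunctions_translate e ha)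
      (fun _ ha => regularFunctions_expansion e ha) (dense_regularFunctions e)
  have hloc : ∀ (m : Ideal (TameHeckeRing T L S)) [m.IsMaximal],
      Function.Surjective (toLocModule m) :=
    @H0.toLocModule_surjective _ _ _ _ _ _ _ _ _ _ _ L _ _ _ _ _ _ hcover (outside T S)
  exact ⟨hdense, fun m _ => dense_isAlgebraicVector_loc m (hloc m) _ _ _ hdense⟩
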